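/- Fix integers $d>2$ and $j$ with $1\le j\le J$, where $J=\max\{i\ge 0: i(i+1)<d\}$. The Hamming torus is the graph on $[n]^d$ in which two vertices are adjacent when they differ in exactly one coordinate. In bootstrap percolation with threshold $2$ on it, each vertex is open at time $0$ independently with probability $p$; at each step every closed vertex with at least two open neighbours becomes open, and open vertices stay open. Write $\omega_0$ for the set of initially open vertices, $\langle S\rangle$ for the set of vertices that are eventually open when the process starts from $S$, and $\omega_\infty=\langle\omega_0\rangle$. An $i$-dimensional subtorus is a subset of $[n]^d$ obtained by prescribing the values of exactly $d-i$ coordinates; $\mathcal F_i$ is the collection of these. Let $\mathcal I_i$ be the event that $\langle \omega_0\cap V\rangle=V$ for some $V\in\mathcal F_i$ (some $i$-dimensional subtorus is internally spanned), and $\mathcal C_i$ the event that $V\subseteq\omega_\infty$ for some $V\in\mathcal F_i$ (some $i$-dimensional subtorus is eventually fully open). Let $a>0$, $p=a\,n^{-d/(j+1)-j}$ and $\lambda_j=\binom{d}{2j}(2j)!\,2^{-j-1}a^{j+1}$. Then, as $n\to\infty$, $$\mathbb P_p(\mathcal I_{2j})\to 1-e^{-\lambda_j}\qquad\text{and}\qquad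 \mathbb P_p(\mathcal C_{2j}\setminus\mathcal I_{2j})\to 0 .$$ Hence $\gamma=d/(j+1)+j$ is the critical exponent of $\mathcal C_{2j}$: for every $\varepsilon>0$, $\mathbb P_p(\mathcal C_{2j})\to1$ for any $p=p(n)\in[0,1]$ with $p>n^{-\gamma+\varepsilon}$ for all large $n$, and $\mathbb P_p(\mathcal C_{2j})\to0$ for any $p=p(n)\in[0,1]$ with $p<n^{-\gamma-\varepsilon}$ for all large $n$. Moreover the phase transition of $\mathcal C_{2j}$ is not sharp: with $p_\alpha=p_\alpha(n)$ defined by $\mathbb P_{p_\alpha}(\mathcal C_{2j})=\alpha$, it is not the case that $p_{1-\varepsilon}-p_\varepsilon=o(p_{1/2})$ for every $\varepsilon\in(0,1)$. -/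

import Mathlib

open Filter Topology Asymptotics ProbabilityTheory
open scoped Nat

namespace HammingBootstrap

/-- The `d`-dimensional Hamming torus on `[n]^d`: two vertices are adjacent when they differ in
exactly one coordinate. -/
def hammingTorus (d n : ℕ) : SimpleGraph (Fin d → Fin n) where
  Adj v w := hammingDist v w = 1
  symm := ⟨fun v w h => by rwa [hammingDist_comm]⟩
  loopless := ⟨fun v h => by simp at h⟩

/-- One step of bootstrap percolation with threshold `θ` on a graph `G`; a configuration is
identified with its set of open vertices. -/
def bootstrapStep {V : Type*} (G : SimpleGraph V) (θ : ℕ) (S : Set V) : Set V :=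
  {v | v ∈ S ∨ (θ : ℕ∞) ≤ (G.neighborSet v ∩ S).encard}

/-- The span of `S` on the Hamming torus: the set `ω_∞` of vertices that are eventually open in
bootstrap percolation with threshold `2` started from `ω_0 = S`. -/
def spanSet {d n : ℕ} (S : Set (Fin d → Fin n)) : Set (Fin d → Fin n) :=
  {v | ∃ t : ℕ, v ∈ (bootstrapStep (hammingTorus d n) 2)^[t] S}

/-- `V` is an `i`-dimensional subtorus of `[n]^d`: it is cut out by prescribing the values of a set
`I` of exactly `d - i` coordinates. -/
def IsSubtorus {d n : ℕ} (i : ℕ) (V : Set (Fin d → Fin n)) : Prop :=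
  ∃ (I : Finset (Fin d)) (α : Fin d → Fin n), I.card + i = d ∧ V = {v | ∀ l ∈ I, v l = α l}

/-- The initial configuration `ω` internally spans `V`. -/
def InternallySpans {d n : ℕ} (ω V : Set (Fin d → Fin n)) : Prop :=
  V = spanSet (ω ∩ V)

/-- The event `I_i` (a set of initial configurations): some `i`-dimensional subtorus is internally
spanned. -/
def eventI (d i n : ℕ) : Set (Set (Fin d → Fin n)) :=
  {ω | ∃ V, IsSubtorus i V ∧ InternallySpans ω V}

/-- The event `C_i` (a set of initial configurations): some `i`-dimensional subtorus is eventually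
fully open. -/
def eventC (d i n : ℕ) : Set (Set (Fin d → Fin n)) :=
  {ω | ∃ V, IsSubtorus i V ∧ V ⊆ spanSet ω}

/-- `P_p(A)`: the probability of `A` when every vertex is initially open independently with
probability `p`. -/
noncomputable def prob {d n : ℕ} (p : unitInterval) (A : Set (Set (Fin d → Fin n))) : ℝ :=
  (setBernoulli (Set.univ : Set (Fin d → Fin n)) p).real A

/-- The parameter `a n^{-γ}`, truncated to `[0,1]`. -/
noncomputable def powerParam (a γ : ℝ) (n : ℕ) : unitInterval :=
  Set.projIcc 0 1 zero_le_one (a * (n : ℝ) ^ (-γ))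

/-- `J = max {j : j (j + 1) < d}`. -/
noncomputable def maxJ (d : ℕ) : ℕ := sSup {j : ℕ | j * (j + 1) < d}

/-- `λ(j, d, a) = (d choose 2j) (2j)! 2^{-j-1} a^{j+1}`. -/
noncomputable def lam (j d : ℕ) (a : ℝ) : ℝ :=
  (d.choose (2 * j) : ℝ) * ((2 * j)! : ℝ) * (2 : ℝ)⁻¹ ^ (j + 1) * a ^ (j + 1)

/-- `γ` is a critical exponent for the sequence of events `A n`: for each `ε > 0`, the probability
tends to `1` along any parameters `p > n^{-γ+ε}` and to `0` along any `p < n^{-γ-ε}`. -/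
def IsCriticalExponent {d : ℕ} (A : (n : ℕ) → Set (Set (Fin d → Fin n))) (γ : ℝ) : Prop :=
  ∀ ε : ℝ, 0 < ε → ∀ p : ℕ → unitInterval,
    ((∀ᶠ n : ℕ in atTop, (n : ℝ) ^ (-γ + ε) < (p n : ℝ)) →
      Tendsto (fun n => prob (p n) (A n)) atTop (𝓝 1)) ∧
    ((∀ᶠ n : ℕ in atTop, (p n : ℝ) < (n : ℝ) ^ (-γ - ε)) →
      Tendsto (fun n => prob (p n) (A n)) atTop (𝓝 0))

/-- `q n` is the parameter `p_α(n)`, at which `A n` has probability `α`, for all large `n`. -/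
def IsThreshold {d : ℕ} (A : (n : ℕ) → Set (Set (Fin d → Fin n))) (α : ℝ) (q : ℕ → unitInterval) : Prop :=
  ∀ᶠ n in atTop, prob (q n) (A n) = α

/-- The phase transition of the events `A n` is sharp: `p_{1-ε} - p_ε = o(p_c)` for each
`ε ∈ (0,1)`, where `p_c = p_{1/2}`. -/
def IsSharp {d : ℕ} (A : (n : ℕ) → Set (Set (Fin d → Fin n))) : Prop :=
  ∀ ε : ℝ, 0 < ε → ε < 1 → ∀ pLow pHigh pc : ℕ → unitInterval,
    IsThreshold A ε pLow → IsThreshold A (1 - ε) pHigh → IsThreshold A (1 / 2) pc →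
      (fun n => (pHigh n : ℝ) - (pLow n : ℝ)) =o[atTop] (fun n => (pc n : ℝ))

end HammingBootstrap

/-! A closed set containing two subtori at distance at most 2 contains the smallest subtorus above
both (`IsClosedSet.join_subset`), and a union of subtori pairwise at distance at least 3 is closed.
Merging as long as possible therefore describes the span: a subtorus is internally spanned exactly
when it is generated by open points through successive mergers (`Gen`, `mem_eventI_iff`).

The rest is a first moment computation. Merging dimensions k₁ and k₂ gives dimension at most k₁ + k₂
+ 2. For k ≤ 2j, the expected number of open sets generating a k-dimensional subtorus, summed over
all such subtori, is at most of order n ^ (d + `expo` γ k); the recursion behind this bound is the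
inequality `expo_add_le`. At the critical γ one has `expo` γ (2j) = -d, so the bound is of order
one. Up to a factor n ^ (-`gap`), the only contribution comes from `Good` sets: j + 1 points added
one at a time, each bringing two new dimensions and sharing no free coordinate with the earlier
points (`exists_weight_bads_le`). A merger that jumps over dimension 2j is also unlikely
(`expo_add_le_of_lt`), and it must occur when some 2j-dimensional subtorus is filled but none is
internally spanned. The gap is positive because j(j + 1) < d.

Good sets can be counted precisely (`card_goods_bounds`), which shows that their expected number
tends to λ. Harris' inequality bounds the probability of having no open good set from below,
Janson's from above, and both bounds tend to exp(-λ).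

Since 1 - exp(-λ) takes every value in (0, 1) as a varies, monotonicity in p gives the critical
exponent. It also shows that thresholds at different levels are separated by a multiple of n ^ (-γ),
which excludes sharpness. -/

namespace HammingBootstrap

open MeasureTheory

/-! ### Random subsets of a finite set: Harris, Janson and monotonicity in p. -/

section RandomSet

set_option linter.unusedSectionVars false

variable {V : Type*} [Fintype V] [DecidableEq V]

/-- The probability that the random set containing each point independently with probability `p`
lies in `E`. -/
noncomputable def pr (p : unitInterval) (E : Set (Set V)) : ℝ :=
  (setBernoulli (Set.univ : Set V) p).real E

/-- The weight of a single configuration. -/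
def wt (p : ℝ) (ω : Finset V) : ℝ := p ^ ω.card * (1 - p) ^ ωᶜ.card

lemma wt_nonneg (p : unitInterval) (ω : Finset V) : 0 ≤ wt (p : ℝ) ω :=
  mul_nonneg (pow_nonneg p.2.1 _) (pow_nonneg (sub_nonneg.2 p.2.2) _)

open scoped Classical in
lemma pr_eq_sum (p : unitInterval) (E : Set (Set V)) :
    pr p E = ∑ ω : Finset V, if (ω : Set V) ∈ E then wt (p : ℝ) ω else 0 := by
  have hE : E = ⋃ ω ∈ (Finset.univ.filter fun ω : Finset V => (ω : Set V) ∈ E),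
      {(ω : Set V)} := by
    ext s
    simp only [Finset.mem_filter, Finset.mem_univ, true_and, Set.mem_iUnion,
      Set.mem_singleton_iff, exists_prop]
    constructor
    · intro h
      exact ⟨s.toFinset, by simpa using h, by simp⟩
    · rintro ⟨ω, h, rfl⟩
      exact h
  rw [pr]
  conv_lhs => rw [hE]
  rw [measureReal_biUnion_finset, Finset.sum_filter]
  · refine Finset.sum_congr rfl fun ω _ => ?_
    split_ifs
    · rw [setBernoulli_real_singleton _ (Set.subset_univ _) Set.finite_univ, wt,
        Set.ncard_coe_finset, ← Set.compl_eq_univ_sdiff, ← Finset.coe_compl, Set.ncard_coe_finset]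
    · rfl
  · intro a _ b _ hab
    simpa using hab
  · intro b _
    exact measurableSet_singleton _

lemma pr_nonneg (p : unitInterval) (E : Set (Set V)) : 0 ≤ pr p E := measureReal_nonneg

lemma pr_le_one (p : unitInterval) (E : Set (Set V)) : pr p E ≤ 1 := measureReal_le_one

lemma pr_univ (p : unitInterval) : pr p (Set.univ : Set (Set V)) = 1 := by simp [pr]

lemma pr_mono {p : unitInterval} {E F : Set (Set V)} (h : E ⊆ F) : pr p E ≤ pr p F :=
  measureReal_mono h

lemma pr_union_le (p : unitInterval) (E F : Set (Set V)) : pr p (E ∪ F) ≤ pr p E + pr p F :=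
  measureReal_union_le _ _

lemma pr_inter_add_diff (p : unitInterval) (E F : Set (Set V)) :
    pr p (E ∩ F) + pr p (E \ F) = pr p E :=
  measureReal_inter_add_sdiff (Set.toFinite _).measurableSet

lemma pr_compl (p : unitInterval) (E : Set (Set V)) : pr p Eᶜ = 1 - pr p E :=
  probReal_compl_eq_one_sub (Set.toFinite _).measurableSet

lemma continuous_pr (E : Set (Set V)) : Continuous fun p : unitInterval => pr p E := by
  classical
  simp only [pr_eq_sum]
  refine continuous_finsetSum _ fun ω _ => ?_
  split_ifs
  · unfold wt; fun_prop
  · exact continuous_const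

/-- Since C ignores v, deleting v matches the configurations of C containing v with those avoiding
it, and trades a factor p for 1 - p. -/
lemma pr_mem_inter (p : unitInterval) (v : V) (C : Set (Set V))
    (hC : ∀ ω, insert v ω ∈ C ↔ ω ∈ C) : pr p ({ω | v ∈ ω} ∩ C) = p * pr p C := by
  classical
  set S1 := ∑ ω : Finset V, if (v ∈ ω ∧ (ω : Set V) ∈ C) then wt (p : ℝ) ω else 0 with hS1
  set S0 := ∑ ω : Finset V, if (v ∉ ω ∧ (ω : Set V) ∈ C) then wt (p : ℝ) ω else 0 with hS0
  have h1 : pr p ({ω | v ∈ ω} ∩ C) = S1 := by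
    rw [pr_eq_sum]; simp [hS1]
  have h2 : pr p C = S1 + S0 := by
    rw [pr_eq_sum, hS1, hS0, ← Finset.sum_add_distrib]
    refine Finset.sum_congr rfl fun ω _ => ?_
    by_cases hv : v ∈ ω <;> simp [hv]
  have h3 : (1 - (p : ℝ)) * S1 = p * S0 := by
    rw [hS1, hS0, ← Finset.sum_filter, ← Finset.sum_filter, Finset.mul_sum, Finset.mul_sum]
    refine Finset.sum_nbij' (fun ω => ω.erase v) (fun ω => insert v ω) ?_ ?_ ?_ ?_ ?_
    · intro ω hω
      simp only [Finset.mem_filter, Finset.mem_univ, true_and] at hω ⊢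
      refine ⟨by simp, ?_⟩
      rw [← hC, ← Finset.coe_insert, Finset.insert_erase hω.1]
      exact hω.2
    · intro ω hω
      simp only [Finset.mem_filter, Finset.mem_univ, true_and] at hω ⊢
      refine ⟨by simp, ?_⟩
      rw [Finset.coe_insert, hC]
      exact hω.2
    · intro ω hω
      simp only [Finset.mem_filter, Finset.mem_univ, true_and] at hω
      exact Finset.insert_erase hω.1
    · intro ω hω
      simp only [Finset.mem_filter, Finset.mem_univ, true_and] at hω
      exact Finset.erase_insert hω.1
    · intro ω hω
      simp only [Finset.mem_filter, Finset.mem_univ, true_and] at hω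
      have e1 : (ω.erase v)ᶜ = insert v ωᶜ := by
        ext x; by_cases hx : x = v <;> simp [hx]
      have e2 : v ∉ ωᶜ := by simpa using hω.1
      unfold wt
      rw [e1, Finset.card_insert_of_notMem e2, ← Finset.card_erase_add_one hω.1]
      ring
  rw [h1, h2]
  linarith

lemma pr_superset_inter (p : unitInterval) (A : Finset V) (C : Set (Set V))
    (hC : ∀ v ∈ A, ∀ ω, insert v ω ∈ C ↔ ω ∈ C) :
    pr p ({ω | (A : Set V) ⊆ ω} ∩ C) = (p : ℝ) ^ A.card * pr p C := by
  induction A using Finset.induction_on with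
  | empty => simp
  | insert v A hv ih =>
    have : {ω : Set V | ((insert v A : Finset V) : Set V) ⊆ ω} ∩ C
        = {ω | v ∈ ω} ∩ ({ω | (A : Set V) ⊆ ω} ∩ C) := by
      ext ω; simp [Set.insert_subset_iff, and_assoc]
    rw [this, pr_mem_inter, ih (fun w hw => hC w (Finset.mem_insert_of_mem hw)),
      Finset.card_insert_of_notMem hv]
    · ring
    · intro ω
      simp only [Set.mem_inter_iff, Set.mem_ofPred_eq, hC v (Finset.mem_insert_self _ _) ω]
      rw [Set.subset_insert_iff_of_notMem (by simpa using hv)]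

lemma pr_superset (p : unitInterval) (A : Finset V) :
    pr p {ω | (A : Set V) ⊆ ω} = (p : ℝ) ^ A.card := by
  have := pr_superset_inter p A Set.univ (by simp)
  simpa [pr_univ] using this

/-- Harris' inequality for two increasing events. -/
lemma pr_harris (p : unitInterval) {E F : Set (Set V)} (hE : IsUpperSet E) (hF : IsUpperSet F) :
    pr p E * pr p F ≤ pr p (E ∩ F) := by
  classical
  have hmono : ∀ G : Set (Set V), IsUpperSet G →
      Monotone fun ω : Finset V => if (ω : Set V) ∈ G then (1 : ℝ) else 0 := by
    intro G hG a b hab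
    dsimp only
    split_ifs with h1 h2
    · exact le_rfl
    · exact absurd (hG (by exact_mod_cast hab) h1) h2
    · exact zero_le_one
    · exact le_rfl
  have hpos : ∀ G : Set (Set V),
      (0 : Finset V → ℝ) ≤ fun ω : Finset V => if (ω : Set V) ∈ G then (1 : ℝ) else 0 := by
    intro G ω
    dsimp only [Pi.zero_apply]
    split_ifs <;> norm_num
  have key := fkg _ _ (μ := fun ω : Finset V => wt (p : ℝ) ω) (fun ω => wt_nonneg p ω)
    (hpos E) (hpos F) (hmono E hE) (hmono F hF) (by
      intro a b
      refine le_of_eq ?_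
      have h1 := Finset.card_union_add_card_inter a b
      have h2 := Finset.card_union_add_card_inter aᶜ bᶜ
      have e1 : (a ⊓ b)ᶜ = aᶜ ∪ bᶜ := by ext; simp
      have e2 : (a ⊔ b)ᶜ = aᶜ ∩ bᶜ := by ext; simp
      unfold wt
      rw [e1, e2, Finset.inf_eq_inter, Finset.sup_eq_union]
      calc _ = (p : ℝ) ^ (a.card + b.card) * (1 - (p : ℝ)) ^ (aᶜ.card + bᶜ.card) := by ring
        _ = _ := by rw [← h1, ← h2]; ring)
  have hu := pr_eq_sum p (Set.univ : Set (Set V))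
  simp only [Set.mem_univ, if_true, pr_univ] at hu
  rw [← hu, one_mul] at key
  simpa [pr_eq_sum, mul_ite, ← ite_and, and_comm] using key

lemma pr_harris_lower (p : unitInterval) {E F : Set (Set V)} (hE : IsLowerSet E)
    (hF : IsLowerSet F) : pr p E * pr p F ≤ pr p (E ∩ F) := by
  have h := pr_harris p hE.compl hF.compl
  have h1 : pr p (E ∪ F) = 1 - pr p (Eᶜ ∩ Fᶜ) := by
    rw [← pr_compl, Set.compl_inter, compl_compl, compl_compl]
  have h2 := pr_inter_add_diff p E F
  have h3 := pr_inter_add_diff p (E ∪ F) F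
  rw [Set.union_inter_cancel_right, Set.union_sdiff_right] at h3
  rw [pr_compl, pr_compl] at h
  linarith

lemma pr_harris_upper_lower (p : unitInterval) {E F : Set (Set V)} (hE : IsUpperSet E)
    (hF : IsLowerSet F) : pr p (E ∩ F) ≤ pr p E * pr p F := by
  have h := pr_harris p hE hF.compl
  have h1 := pr_inter_add_diff p E F
  rw [pr_compl] at h
  rw [Set.sdiff_eq] at h1
  linarith

lemma isUpperSet_superset (A : Finset V) : IsUpperSet {ω : Set V | (A : Set V) ⊆ ω} :=
  fun _ _ hab h => h.trans hab

lemma isLowerSet_forall_not_superset (𝓐 : Finset (Finset V)) :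
    IsLowerSet {ω : Set V | ∀ A ∈ 𝓐, ¬ (A : Set V) ⊆ ω} :=
  fun _ _ hab h A hA hs => h A hA (hs.trans hab)

lemma pr_exists_superset_le (p : unitInterval) (𝓐 : Finset (Finset V)) :
    pr p {ω | ∃ A ∈ 𝓐, (A : Set V) ⊆ ω} ≤ ∑ A ∈ 𝓐, (p : ℝ) ^ A.card := by
  have : {ω : Set V | ∃ A ∈ 𝓐, (A : Set V) ⊆ ω} = ⋃ A ∈ 𝓐, {ω | (A : Set V) ⊆ ω} := by
    ext; simp
  rw [this]
  refine (measureReal_biUnion_finset_le _ _).trans ?_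
  exact Finset.sum_le_sum fun A _ => (pr_superset p A).le

/-- The lower bound from Harris' inequality for the probability that no set of a family is
contained in the random set. -/
lemma prod_le_pr_forall_not_superset (p : unitInterval) (𝓐 : Finset (Finset V)) :
    ∏ A ∈ 𝓐, (1 - (p : ℝ) ^ A.card) ≤ pr p {ω | ∀ A ∈ 𝓐, ¬ (A : Set V) ⊆ ω} := by
  classical
  induction 𝓐 using Finset.induction_on with
  | empty => simp [pr_univ]
  | insert A 𝓐 hA ih =>
    rw [Finset.prod_insert hA]
    have e : {ω : Set V | ∀ B ∈ insert A 𝓐, ¬ (B : Set V) ⊆ ω}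
        = {ω | (A : Set V) ⊆ ω}ᶜ ∩ {ω | ∀ B ∈ 𝓐, ¬ (B : Set V) ⊆ ω} := by
      ext; simp
    rw [e]
    refine le_trans ?_ (pr_harris_lower p (isUpperSet_superset A).compl
      (isLowerSet_forall_not_superset 𝓐))
    rw [pr_compl, pr_superset]
    exact mul_le_mul_of_nonneg_left ih (sub_nonneg.2 (pow_le_one₀ p.2.1 p.2.2))

/-- One step of Janson's argument: conditionally on D (no set of 𝓑 is contained in ω), A is still
contained in ω with probability at least p ^ |A| minus the overlap sum. The sets of 𝓑 disjoint from
A do not affect this event. Those meeting A are handled by a union bound, where Harris decouples A ∪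
B ⊆ ω from the decreasing event C. -/
lemma pr_forall_not_superset_insert_le (p : unitInterval) (A : Finset V) (𝓑 : Finset (Finset V)) :
    pr p {ω | ∀ B ∈ insert A 𝓑, ¬ (B : Set V) ⊆ ω} ≤
      pr p {ω | ∀ B ∈ 𝓑, ¬ (B : Set V) ⊆ ω} *
        Real.exp (-(p : ℝ) ^ A.card + ∑ B ∈ 𝓑 with ¬ Disjoint A B, (p : ℝ) ^ (A ∪ B).card) := by
  set 𝓢 := 𝓑.filter fun B => ¬ Disjoint A B with h𝓢
  set 𝓒 := 𝓑.filter fun B => Disjoint A B with h𝓒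
  set D : Set (Set V) := {ω | ∀ B ∈ 𝓑, ¬ (B : Set V) ⊆ ω} with hD
  set C : Set (Set V) := {ω | ∀ B ∈ 𝓒, ¬ (B : Set V) ⊆ ω} with hCdef
  set E : Set (Set V) := {ω | (A : Set V) ⊆ ω} with hE
  set q : ℝ := (p : ℝ) ^ A.card - ∑ B ∈ 𝓢, (p : ℝ) ^ (A ∪ B).card with hq
  have hDC : pr p D ≤ pr p C := pr_mono fun ω h B hB => h B (Finset.mem_filter.1 hB).1
  have hECval : pr p (E ∩ C) = (p : ℝ) ^ A.card * pr p C := by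
    refine pr_superset_inter p A C fun v hv ω => ?_
    simp only [hCdef, Set.mem_ofPred_eq]
    refine forall₂_congr fun B hB => ?_
    rw [Set.subset_insert_iff_of_notMem]
    exact fun hvB => Finset.disjoint_left.1 (Finset.mem_filter.1 hB).2 hv (by simpa using hvB)
  have hsub : E ∩ C ⊆ (E ∩ D) ∪ ⋃ B ∈ 𝓢, ({ω | ((A ∪ B : Finset V) : Set V) ⊆ ω} ∩ C) := by
    rintro ω ⟨h1, h2⟩
    by_cases h3 : ω ∈ D
    · exact Or.inl ⟨h1, h3⟩
    · right
      simp only [hD, Set.mem_ofPred_eq, not_forall, not_not] at h3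
      obtain ⟨B, hB, hBω⟩ := h3
      have hBN : B ∈ 𝓢 := by
        refine Finset.mem_filter.2 ⟨hB, fun hdis => h2 B (Finset.mem_filter.2 ⟨hB, hdis⟩) hBω⟩
      simp only [Set.mem_iUnion]
      refine ⟨B, hBN, ?_, h2⟩
      simp only [Finset.coe_union, Set.mem_ofPred_eq, Set.union_subset_iff]
      exact ⟨h1, hBω⟩
  have hlow : pr p C * q ≤ pr p (E ∩ D) := by
    have h1 := (pr_mono (p := p) hsub).trans (pr_union_le p _ _)
    have h2 : pr p (⋃ B ∈ 𝓢, ({ω | ((A ∪ B : Finset V) : Set V) ⊆ ω} ∩ C)) ≤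
        ∑ B ∈ 𝓢, (p : ℝ) ^ (A ∪ B).card * pr p C := by
      refine (measureReal_biUnion_finset_le _ _).trans (Finset.sum_le_sum fun B _ => ?_)
      have := pr_harris_upper_lower p (isUpperSet_superset (A ∪ B))
        (isLowerSet_forall_not_superset 𝓒)
      rwa [pr_superset] at this
    rw [← Finset.sum_mul] at h2
    rw [hECval] at h1
    rw [hq]
    linarith
  -- Replacing C by the smaller event D is legitimate only when q ≥ 0; otherwise the bound is
  -- trivial.
  have hlow' : pr p D * q ≤ pr p (E ∩ D) := by
    rcases le_total 0 q with h | h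
    · exact (mul_le_mul_of_nonneg_right hDC h).trans hlow
    · exact (mul_nonpos_of_nonneg_of_nonpos (pr_nonneg p D) h).trans (pr_nonneg p _)
  have hins : {ω : Set V | ∀ B ∈ insert A 𝓑, ¬ (B : Set V) ⊆ ω} = D \ E := by
    ext ω; simp [hD, hE, and_comm]
  have hsplit := pr_inter_add_diff p D E
  rw [Set.inter_comm] at hsplit
  rw [hins]
  have hexp : 1 - q ≤ Real.exp (-(p : ℝ) ^ A.card + ∑ B ∈ 𝓢, (p : ℝ) ^ (A ∪ B).card) := by
    have := Real.add_one_le_exp (-(p : ℝ) ^ A.card + ∑ B ∈ 𝓢, (p : ℝ) ^ (A ∪ B).card)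
    rw [hq]; linarith
  calc pr p (D \ E) ≤ pr p D * (1 - q) := by linarith
    _ ≤ _ := mul_le_mul_of_nonneg_left hexp (pr_nonneg p D)

/-- A form of Janson's inequality. -/
lemma pr_forall_not_superset_le_exp (p : unitInterval) (𝓐 : Finset (Finset V)) :
    pr p {ω | ∀ A ∈ 𝓐, ¬ (A : Set V) ⊆ ω} ≤
      Real.exp (-(∑ A ∈ 𝓐, (p : ℝ) ^ A.card) +
        ∑ A ∈ 𝓐, ∑ B ∈ 𝓐 with B ≠ A ∧ ¬ Disjoint A B, (p : ℝ) ^ (A ∪ B).card) := by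
  induction 𝓐 using Finset.induction_on with
  | empty => simp [pr_univ]
  | insert A 𝓐 hA ih =>
    refine (pr_forall_not_superset_insert_le p A 𝓐).trans ?_
    refine (mul_le_mul_of_nonneg_right ih (Real.exp_pos _).le).trans ?_
    rw [← Real.exp_add, Real.exp_le_exp, Finset.sum_insert hA, Finset.sum_insert hA]
    have h1 : ∑ B ∈ 𝓐 with ¬ Disjoint A B, (p : ℝ) ^ (A ∪ B).card ≤
        ∑ B ∈ insert A 𝓐 with B ≠ A ∧ ¬ Disjoint A B, (p : ℝ) ^ (A ∪ B).card := by
      refine Finset.sum_le_sum_of_subset_of_nonneg ?_ fun _ _ _ => pow_nonneg p.2.1 _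
      intro B hB
      simp only [Finset.mem_filter, Finset.mem_insert] at hB ⊢
      exact ⟨Or.inr hB.1, fun h => hA (h ▸ hB.1), hB.2⟩
    have h2 : ∑ A' ∈ 𝓐, ∑ B ∈ 𝓐 with B ≠ A' ∧ ¬ Disjoint A' B, (p : ℝ) ^ (A' ∪ B).card ≤
        ∑ A' ∈ 𝓐, ∑ B ∈ insert A 𝓐 with B ≠ A' ∧ ¬ Disjoint A' B, (p : ℝ) ^ (A' ∪ B).card := by
      refine Finset.sum_le_sum fun A' _ =>
        Finset.sum_le_sum_of_subset_of_nonneg ?_ fun _ _ _ => pow_nonneg p.2.1 _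
      exact Finset.filter_subset_filter _ (Finset.subset_insert _ _)
    linarith

/-- The standard coupling: independent uniform labels, a point being kept when its label is at most
p. All parameters then live on one probability space, where increasing p enlarges the random set. -/
lemma setBernoulli_eq_map_uniform (p : unitInterval) :
    setBernoulli (Set.univ : Set V) p =
      (Measure.pi fun _ : V => (volume : Measure unitInterval)).map fun u => {v | u v ≤ p} := by
  have hmeas : Measurable fun (u : V → unitInterval) => {v | u v ≤ p} := by
    refine measurable_set_iff.2 fun v => ?_
    exact measurableSet_setOfPred.1 (measurableSet_Iic.preimage (measurable_pi_apply v))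
  refine Measure.ext_of_singleton fun s => ?_
  classical
  rw [Measure.map_apply hmeas (measurableSet_singleton _),
    setBernoulli_singleton _ (Set.subset_univ _) Set.finite_univ]
  have : (fun u : V → unitInterval => {v | u v ≤ p}) ⁻¹' {s} =
      Set.univ.pi fun v => if v ∈ s then Set.Iic p else Set.Ioi p := by
    ext u
    simp only [Set.mem_preimage, Set.mem_singleton_iff, Set.mem_pi, Set.mem_univ, true_imp_iff,
      Set.ext_iff, Set.mem_ofPred_eq]
    refine forall_congr' fun v => ?_
    by_cases hv : v ∈ s <;> simp [hv]
  rw [this, Measure.pi_pi]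
  have h2 : ∀ v : V, (volume : Measure unitInterval) (if v ∈ s then Set.Iic p else Set.Ioi p) =
      if v ∈ s then ENNReal.ofReal p else ENNReal.ofReal (1 - p) := by
    intro v; split_ifs <;> simp
  simp only [h2]
  rw [Finset.prod_ite, Finset.prod_const, Finset.prod_const]
  have e1 : s.ncard = (Finset.univ.filter (· ∈ s)).card := by
    rw [← Set.ncard_coe_finset]; simp
  have e2 : (Set.univ \ s).ncard = (Finset.univ.filter (· ∉ s)).card := by
    rw [← Set.ncard_coe_finset]; congr 1; ext; simp
  rw [e1, e2]
  congr 2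
  · exact (ENNReal.ofReal_eq_coe_nnreal p.2.1).symm
  · exact (ENNReal.ofReal_eq_coe_nnreal (sub_nonneg.2 p.2.2)).symm

lemma pr_mono_param {p q : unitInterval} (hpq : p ≤ q) {E : Set (Set V)} (hE : IsUpperSet E) :
    pr p E ≤ pr q E := by
  have hmeas : ∀ p : unitInterval, Measurable fun (u : V → unitInterval) => {v | u v ≤ p} := by
    intro p
    refine measurable_set_iff.2 fun v => ?_
    exact measurableSet_setOfPred.1 (measurableSet_Iic.preimage (measurable_pi_apply v))
  unfold pr
  rw [setBernoulli_eq_map_uniform, setBernoulli_eq_map_uniform,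
    map_measureReal_apply (hmeas p) (Set.toFinite _).measurableSet,
    map_measureReal_apply (hmeas q) (Set.toFinite _).measurableSet]
  refine measureReal_mono fun u hu => hE (fun v hv => ?_) hu
  exact le_trans hv hpq

end RandomSet

end HammingBootstrap

/-! ### Subtori as patterns of prescribed and free coordinates. -/

namespace HammingBootstrap

/-- A pattern describes a subtorus: each coordinate is either prescribed or free (`none`). -/
abbrev Pat (d n : ℕ) : Type := Fin d → Option (Fin n)

namespace Pat

variable {d n : ℕ}

/-- The subtorus described by a pattern. -/
def cells (P : Pat d n) : Set (Fin d → Fin n) := {v | ∀ l, P l = none ∨ P l = some (v l)}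

/-- The set of free coordinates. -/
def free (P : Pat d n) : Finset (Fin d) := Finset.univ.filter fun l => P l = none

/-- The dimension of a pattern. -/
def dim (P : Pat d n) : ℕ := P.free.card

/-- The pattern of a single point. -/
def pt (v : Fin d → Fin n) : Pat d n := fun l => some (v l)

/-- `P ≤ Q` as subtori. -/
def Le (P Q : Pat d n) : Prop := ∀ l, Q l = none ∨ P l = Q l

instance (P Q : Pat d n) : Decidable (Le P Q) := inferInstanceAs (Decidable (∀ _, _))

/-- The smallest pattern above two patterns. -/
def join (P Q : Pat d n) : Pat d n := fun l => if P l = Q l then P l else none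

/-- The coordinates prescribed differently by two patterns. -/
def diff (P Q : Pat d n) : Finset (Fin d) :=
  Finset.univ.filter fun l => P l ≠ none ∧ Q l ≠ none ∧ P l ≠ Q l

lemma mem_free {P : Pat d n} {l : Fin d} : l ∈ P.free ↔ P l = none := by simp [free]

lemma mem_diff {P Q : Pat d n} {l : Fin d} :
    l ∈ diff P Q ↔ P l ≠ none ∧ Q l ≠ none ∧ P l ≠ Q l := by simp [diff]

lemma mem_cells_pt {v w : Fin d → Fin n} : v ∈ (pt w).cells ↔ v = w := by
  simp [cells, pt, funext_iff, eq_comm]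

lemma pt_injective : Function.Injective (pt : (Fin d → Fin n) → Pat d n) := by
  intro v w h
  funext l
  simpa [pt] using congrFun h l

lemma dim_pt (v : Fin d → Fin n) : (pt v).dim = 0 := by simp [dim, free, pt]

lemma Le.refl (P : Pat d n) : Le P P := fun _ => Or.inr rfl

lemma Le.trans {P Q R : Pat d n} (h1 : Le P Q) (h2 : Le Q R) : Le P R := by
  intro l
  rcases h2 l with h | h
  · exact Or.inl h
  · rcases h1 l with h' | h'
    · exact Or.inl (h ▸ h')
    · exact Or.inr (h'.trans h)

lemma le_join_left (P Q : Pat d n) : Le P (join P Q) := by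
  intro l; unfold join; split_ifs <;> simp

lemma le_join_right (P Q : Pat d n) : Le Q (join P Q) := by
  intro l; unfold join; split_ifs with h <;> simp [h]

lemma join_le {P Q R : Pat d n} (h1 : Le P R) (h2 : Le Q R) : Le (join P Q) R := by
  intro l
  rcases h1 l with h | h
  · exact Or.inl h
  rcases h2 l with h' | h'
  · exact Or.inl h'
  · right; unfold join; rw [if_pos (h.trans h'.symm), h]

lemma Le.free_subset {P Q : Pat d n} (h : Le P Q) : P.free ⊆ Q.free := by
  intro l hl
  rw [mem_free] at hl ⊢
  rcases h l with h | h
  · exact h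
  · rw [← h, hl]

lemma Le.dim_le {P Q : Pat d n} (h : Le P Q) : P.dim ≤ Q.dim := Finset.card_le_card h.free_subset

lemma Le.eq_of_dim_le {P Q : Pat d n} (h : Le P Q) (hd : Q.dim ≤ P.dim) : P = Q := by
  have hf : P.free = Q.free := Finset.eq_of_subset_of_card_le h.free_subset hd
  funext l
  rcases h l with h' | h'
  · have : l ∈ P.free := hf ▸ mem_free.2 h'
    rw [h', mem_free.1 this]
  · exact h'

lemma Le.cells_subset {P Q : Pat d n} (h : Le P Q) : P.cells ⊆ Q.cells := by
  intro v hv l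
  rcases h l with h' | h'
  · exact Or.inl h'
  · rw [← h']; exact hv l

lemma pt_le {P : Pat d n} {v : Fin d → Fin n} : Le (pt v) P ↔ v ∈ P.cells := by
  simp [Le, cells, pt, eq_comm]

lemma dim_join_le (P Q : Pat d n) : (join P Q).dim ≤ P.dim + Q.dim + (diff P Q).card := by
  refine (Finset.card_le_card (t := P.free ∪ Q.free ∪ diff P Q) ?_).trans
    ((Finset.card_union_le _ _).trans (Nat.add_le_add_right (Finset.card_union_le _ _) _))
  intro l hl
  rw [mem_free, join] at hl
  simp only [Finset.mem_union, mem_free, mem_diff]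
  split_ifs at hl with h
  · exact Or.inl (Or.inl hl)
  · tauto

lemma diff_subset_of_mem {P Q : Pat d n} {x y : Fin d → Fin n} (hx : x ∈ P.cells)
    (hy : y ∈ Q.cells) : diff P Q ⊆ Finset.univ.filter fun l => x l ≠ y l := by
  intro l hl
  rw [mem_diff] at hl
  simp only [Finset.mem_filter, Finset.mem_univ, true_and]
  intro h
  have h1 := (hx l).resolve_left hl.1
  have h2 := (hy l).resolve_left hl.2.1
  exact hl.2.2 (by rw [h1, h2, h])

lemma card_diff_le_hammingDist {P Q : Pat d n} {x y : Fin d → Fin n} (hx : x ∈ P.cells)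
    (hy : y ∈ Q.cells) : (diff P Q).card ≤ hammingDist x y :=
  Finset.card_le_card (diff_subset_of_mem hx hy)

end Pat

/-! ### Closed sets absorb subtori at distance at most two. -/

section Closed

variable {d n : ℕ}

/-- A set is closed if no further vertices are opened by the bootstrap dynamics. -/
def IsClosedSet (S : Set (Fin d → Fin n)) : Prop :=
  ∀ z x y, x ∈ S → y ∈ S → x ≠ y → hammingDist z x = 1 → hammingDist z y = 1 → z ∈ S

lemma hammingDist_update (z : Fin d → Fin n) (l : Fin d) {a : Fin n} (h : a ≠ z l) :
    hammingDist z (Function.update z l a) = 1 := by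
  rw [hammingDist, Finset.card_eq_one]
  refine ⟨l, ?_⟩
  ext m
  by_cases hm : m = l
  · subst hm; simp [h.symm]
  · simp [hm]

lemma exists_update_of_hammingDist_eq_one {z x : Fin d → Fin n} (h : hammingDist z x = 1) :
    ∃ l, z l ≠ x l ∧ x = Function.update z l (x l) := by
  rw [hammingDist, Finset.card_eq_one] at h
  obtain ⟨l, hl⟩ := h
  have hmem : ∀ m, z m ≠ x m ↔ m = l := fun m => by
    have := Finset.ext_iff.1 hl m
    simpa using this
  refine ⟨l, (hmem l).2 rfl, ?_⟩
  funext m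
  by_cases hm : m = l
  · subst hm; simp
  · rw [Function.update_of_ne hm]
    by_contra hne
    exact hm ((hmem m).1 (Ne.symm hne))

lemma IsClosedSet.mem_of_update {S : Set (Fin d → Fin n)} (hS : IsClosedSet S)
    {z : Fin d → Fin n} {l m : Fin d} {a b : Fin n} (ha : a ≠ z l) (hb : b ≠ z m)
    (hab : l ≠ m ∨ a ≠ b) (h1 : Function.update z l a ∈ S) (h2 : Function.update z m b ∈ S) :
    z ∈ S := by
  refine hS z _ _ h1 h2 (fun h => ?_) (hammingDist_update z l ha) (hammingDist_update z m hb)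
  by_cases hlm : l = m
  · subst hlm
    have := congrFun h l
    simp only [Function.update_self] at this
    exact (hab.resolve_left (fun h => h rfl)) this
  · have := congrFun h l
    rw [Function.update_self, Function.update_of_ne hlm] at this
    exact ha this

open Pat

/-- The layer through y parallel to P fills outward from y: each of its points has one neighbour in
P and another one closer to y. Any point of a further layer then has a neighbour in each of these
two full layers. -/
lemma IsClosedSet.extend_one {S : Set (Fin d → Fin n)} (hS : IsClosedSet S) {P : Pat d n}
    (hP : P.cells ⊆ S) {y : Fin d → Fin n} (hy : y ∈ S) {a : Fin d} (ha : diff P (pt y) = {a}) :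
    Pat.cells (Function.update P a none) ⊆ S := by
  have hmem : ∀ l, l ∈ diff P (pt y) ↔ l = a := fun l => by rw [ha, Finset.mem_singleton]
  simp only [mem_diff, pt] at hmem
  have haa := (hmem a).2 rfl
  obtain ⟨c, hc⟩ := Option.ne_none_iff_exists'.1 haa.1
  have hcy : c ≠ y a := by
    intro h; apply haa.2.2; rw [hc, h]
  have hfix : ∀ l, l ≠ a → P l = none ∨ P l = some (y l) := by
    intro l hl
    by_contra hcon
    push Not at hcon
    exact hl ((hmem l).1 ⟨hcon.1, by simp, hcon.2⟩)
  have hupd : ∀ z ∈ Pat.cells (Function.update P a none), Function.update z a c ∈ P.cells := by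
    intro z hz l
    by_cases hl : l = a
    · subst hl; right; simpa using hc
    · have := hz l
      rw [Function.update_of_ne hl] at this
      rwa [Function.update_of_ne hl]
  have layer : ∀ k, ∀ z ∈ Pat.cells (Function.update P a none), z a = y a →
      hammingDist z y = k → z ∈ S := by
    intro k
    induction k with
    | zero =>
      intro z _ _ h0
      rw [hammingDist_eq_zero] at h0
      exact h0 ▸ hy
    | succ k ih =>
      intro z hz hza hk
      have : ∃ l, z l ≠ y l := by
        by_contra hcon
        push Not at hcon
        rw [funext hcon, hammingDist_self] at hk
        omega
      obtain ⟨l, hl⟩ := this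
      have hla : l ≠ a := fun h => hl (h ▸ hza)
      have hPl : P l = none := by
        rcases hfix l hla with h | h
        · exact h
        · have := hz l
          rw [Function.update_of_ne hla, h] at this
          simp only [reduceCtorEq, Option.some.injEq, false_or] at this
          exact absurd this.symm hl
      refine hS.mem_of_update (l := l) (m := a) (a := y l) (b := c) hl.symm (hza ▸ hcy)
        (Or.inl hla) (ih _ ?_ ?_ ?_) (hP (hupd z hz))
      · intro m
        by_cases hm : m = l
        · subst hm; left; rw [Function.update_of_ne hla, hPl]
        · rw [Function.update_of_ne hm]; exact hz m
      · rw [Function.update_of_ne hla.symm, hza]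
      · have hfilter : (Finset.univ.filter fun m => Function.update z l (y l) m ≠ y m)
            = (Finset.univ.filter fun m => z m ≠ y m).erase l := by
          ext m
          by_cases hm : m = l
          · subst hm; simp
          · simp [hm]
        rw [hammingDist] at hk ⊢
        rw [hfilter, Finset.card_erase_of_mem (by simpa using hl), hk]
        rfl
  intro z hz
  by_cases h1 : z a = y a
  · exact layer _ z hz h1 rfl
  by_cases h2 : z a = c
  · have := hP (hupd z hz)
    rwa [← h2, Function.update_eq_self] at this
  · refine hS.mem_of_update (l := a) (m := a) (a := c) (b := y a) (Ne.symm h2) (Ne.symm h1)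
      (Or.inr hcy) (hP (hupd z hz)) (layer _ _ ?_ (by simp) rfl)
    intro m
    by_cases hm : m = a
    · subst hm; simp
    · have := hz m
      rw [Function.update_of_ne hm] at this
      rwa [Function.update_of_ne hm, Function.update_of_ne hm]

/-- The point obtained from y by correcting coordinate a alone is adjacent to y and to a point of P,
hence lies in S. It is at distance 1 from P, so b is freed first; y is then at distance 1 from the
enlarged subtorus, and a is freed. -/
lemma IsClosedSet.extend_two {S : Set (Fin d → Fin n)} (hS : IsClosedSet S) {P : Pat d n}
    (hP : P.cells ⊆ S) {y : Fin d → Fin n} (hy : y ∈ S) {a b : Fin d} (hab : a ≠ b)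
    (hd : diff P (pt y) = {a, b}) :
    Pat.cells (Function.update (Function.update P b none) a none) ⊆ S := by
  have hmem : ∀ l, l ∈ diff P (pt y) ↔ l = a ∨ l = b := fun l => by
    rw [hd, Finset.mem_insert, Finset.mem_singleton]
  simp only [mem_diff, pt] at hmem
  have haa := (hmem a).2 (Or.inl rfl)
  have hbb := (hmem b).2 (Or.inr rfl)
  obtain ⟨c, hc⟩ := Option.ne_none_iff_exists'.1 haa.1
  obtain ⟨e, he⟩ := Option.ne_none_iff_exists'.1 hbb.1
  have hcy : c ≠ y a := by
    intro h; apply haa.2.2; rw [hc, h]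
  have hey : e ≠ y b := by
    intro h; apply hbb.2.2; rw [he, h]
  have hfix : ∀ l, l ≠ a → l ≠ b → P l = none ∨ P l = some (y l) := by
    intro l hl hl'
    by_contra hcon
    push Not at hcon
    rcases (hmem l).1 ⟨hcon.1, by simp, hcon.2⟩ with h | h
    · exact hl h
    · exact hl' h
  have hx : Function.update y a c ∈ S := by
    refine hS.mem_of_update (l := a) (m := b) (a := y a) (b := e) (by simpa using hcy.symm)
      (by rw [Function.update_of_ne hab.symm]; exact hey) (Or.inl hab) (by simpa using hy) (hP ?_)
    intro l
    by_cases hla : l = a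
    · subst hla; right; rw [Function.update_of_ne hab, Function.update_self, hc]
    by_cases hlb : l = b
    · subst hlb; right; rw [Function.update_self, he]
    · rw [Function.update_of_ne hlb, Function.update_of_ne hla]; exact hfix l hla hlb
  have h1 : diff P (pt (Function.update y a c)) = {b} := by
    ext l
    rw [mem_diff, Finset.mem_singleton]
    by_cases hla : l = a
    · subst hla; simp [pt, hc, hab]
    · simp only [pt, Function.update_of_ne hla]
      rw [hmem]; simp [hla]
  have h2 := hS.extend_one hP hx h1
  refine hS.extend_one h2 hy ?_
  ext l
  rw [mem_diff, Finset.mem_singleton]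
  by_cases hlb : l = b
  · subst hlb; simp [hab.symm]
  · simp only [pt, Function.update_of_ne hlb]
    rw [hmem]; simp [hlb]

lemma IsClosedSet.extend {S : Set (Fin d → Fin n)} (hS : IsClosedSet S) {P : Pat d n}
    (hP : P.cells ⊆ S) {y : Fin d → Fin n} (hy : y ∈ S) (hd : (diff P (pt y)).card ≤ 2) :
    (join P (pt y)).cells ⊆ S := by
  have key : ∀ R : Pat d n, R.cells ⊆ S → (∀ l, l ∉ diff P (pt y) → R l = P l) →
      (∀ l, l ∈ diff P (pt y) → R l = none) → (join P (pt y)).cells ⊆ S := by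
    intro R hR h1 h2
    refine Set.Subset.trans (Le.cells_subset fun l => ?_) hR
    by_cases hl : l ∈ diff P (pt y)
    · exact Or.inl (h2 l hl)
    · rw [h1 l hl]
      rw [mem_diff] at hl
      unfold Pat.join
      split_ifs with h
      · exact Or.inr rfl
      · left
        by_contra hne
        exact hl ⟨hne, by simp [pt], h⟩
  interval_cases hc : (diff P (pt y)).card
  · rw [Finset.card_eq_zero] at hc
    exact key P hP (fun _ _ => rfl) (by simp [hc])
  · obtain ⟨a, ha⟩ := Finset.card_eq_one.1 hc
    refine key _ (hS.extend_one hP hy ha) (fun l hl => ?_) (fun l hl => ?_)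
    · rw [ha, Finset.mem_singleton] at hl; rw [Function.update_of_ne hl]
    · rw [ha, Finset.mem_singleton] at hl; rw [hl, Function.update_self]
  · obtain ⟨a, b, hab, h⟩ := Finset.card_eq_two.1 hc
    refine key _ (hS.extend_two hP hy hab h) (fun l hl => ?_) (fun l hl => ?_)
    · rw [h, Finset.mem_insert, Finset.mem_singleton, not_or] at hl
      rw [Function.update_of_ne hl.1, Function.update_of_ne hl.2]
    · rw [h, Finset.mem_insert, Finset.mem_singleton] at hl
      rcases hl with hl | hl
      · rw [hl, Function.update_self]
      · by_cases hla : l = a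
        · rw [hla, Function.update_self]
        · rw [Function.update_of_ne hla, hl, Function.update_self]

lemma exists_ne_fin (hn : 2 ≤ n) (r : Fin n) : ∃ r', r' ≠ r := by
  have : Nontrivial (Fin n) := Fin.nontrivial_iff_two_le.2 hn
  exact exists_ne r

/-- A maximal subtorus R of S above P absorbs every point of S within distance 2. This first
captures a point of Q and then forces all of Q into R. -/
lemma IsClosedSet.join_subset (hn : 2 ≤ n) {S : Set (Fin d → Fin n)} (hS : IsClosedSet S)
    {P Q : Pat d n} (hP : P.cells ⊆ S) (hQ : Q.cells ⊆ S) (hd : (diff P Q).card ≤ 2) :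
    (join P Q).cells ⊆ S := by
  classical
  obtain ⟨R, hR, hmax⟩ := Finset.exists_max_image
    (Finset.univ.filter fun R : Pat d n => Le P R ∧ R.cells ⊆ S) Pat.dim ⟨P, by simp [Le.refl, hP]⟩
  simp only [Finset.mem_filter, Finset.mem_univ, true_and] at hR hmax
  have habsorb : ∀ y ∈ S, (diff R (pt y)).card ≤ 2 → y ∈ R.cells := by
    intro y hy hyd
    have h1 := hmax (Pat.join R (pt y)) ⟨hR.1.trans (le_join_left _ _), hS.extend hR.2 hy hyd⟩
    have h2 := (le_join_left R (pt y)).eq_of_dim_le h1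
    rw [h2]
    exact pt_le.1 (le_join_right _ _)
  -- A point of Q nearest to R: it follows R in the coordinates where Q is free, so it differs from
  -- R only where P and Q already differ.
  let y : Fin d → Fin n := fun l => (Q l).getD ((R l).getD ⟨0, by omega⟩)
  have hyQ : y ∈ Q.cells := by
    intro l
    rcases h : Q l with _ | q
    · exact Or.inl rfl
    · right; simp [y, h]
  have hyR : y ∈ R.cells := by
    refine habsorb y (hQ hyQ) ((Finset.card_le_card fun l hl => ?_).trans hd)
    rw [mem_diff] at hl ⊢
    have hPR := (hR.1 l).resolve_left hl.1
    rcases hQl : Q l with _ | q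
    · exfalso
      obtain ⟨r, hr⟩ := Option.ne_none_iff_exists'.1 hl.1
      apply hl.2.2
      simp [pt, y, hQl, hr]
    · refine ⟨hPR ▸ hl.1, by simp, ?_⟩
      rw [hPR]
      have := hl.2.2
      simpa [pt, y, hQl] using this
  have hQR : Le Q R := by
    intro l
    rcases hRl : R l with _ | r
    · exact Or.inl rfl
    right
    have hyr : y l = r := by
      have := hyR l
      rw [hRl] at this
      exact (Option.some.inj (this.resolve_left (by simp))).symm
    rcases hyQ l with h | h
    · exfalso
      -- If Q were free where R is prescribed, moving y along that coordinate would give a point of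
      -- Q outside R but at distance at most 1 from it, which R must absorb.
      obtain ⟨r', hr'⟩ := exists_ne_fin hn r
      have hy'Q : Function.update y l r' ∈ Q.cells := by
        intro m
        by_cases hm : m = l
        · subst hm; exact Or.inl h
        · rw [Function.update_of_ne hm]; exact hyQ m
      have := habsorb _ (hQ hy'Q) (by
        refine (card_diff_le_hammingDist hyR (mem_cells_pt.2 rfl)).trans ?_
        rw [hammingDist_update _ _ (by rw [hyr]; exact hr')]
        norm_num) l
      rw [hRl, Function.update_self] at this
      simp only [reduceCtorEq, Option.some.injEq, false_or] at this
      exact hr' this.symm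
    · rw [h, hyr]
  exact (join_le hR.1 hQR).cells_subset.trans hR.2

lemma mem_bootstrapStep_iff {S : Set (Fin d → Fin n)} {z : Fin d → Fin n} :
    z ∈ bootstrapStep (hammingTorus d n) 2 S ↔ z ∈ S ∨ ∃ x y, x ∈ S ∧ y ∈ S ∧ x ≠ y ∧
      hammingDist z x = 1 ∧ hammingDist z y = 1 := by
  have h2 : ((2 : ℕ) : ℕ∞) = 1 + 1 := by norm_num
  rw [bootstrapStep, Set.mem_ofPred_eq, h2, ENat.add_one_le_iff (by simp), Set.one_lt_encard_iff]
  refine or_congr_right ?_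
  simp only [Set.mem_inter_iff, SimpleGraph.mem_neighborSet, hammingTorus]
  constructor
  · rintro ⟨x, y, ⟨h1, h2⟩, ⟨h3, h4⟩, h5⟩
    exact ⟨x, y, h2, h4, h5, h1, h3⟩
  · rintro ⟨x, y, h1, h2, h3, h4, h5⟩
    exact ⟨x, y, ⟨h4, h1⟩, ⟨h5, h2⟩, h3⟩

lemma monotone_iterate_bootstrapStep (S : Set (Fin d → Fin n)) :
    Monotone fun t : ℕ => (bootstrapStep (hammingTorus d n) 2)^[t] S := by
  refine monotone_nat_of_le_succ fun t => ?_
  rw [Function.iterate_succ_apply']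
  exact fun v hv => Or.inl hv

lemma subset_spanSet (S : Set (Fin d → Fin n)) : S ⊆ spanSet S := fun _ hv => ⟨0, hv⟩

lemma isClosedSet_spanSet (S : Set (Fin d → Fin n)) : IsClosedSet (spanSet S) := by
  rintro z x y ⟨s, hs⟩ ⟨t, ht⟩ hxy hx hy
  refine ⟨max s t + 1, ?_⟩
  rw [Function.iterate_succ_apply', mem_bootstrapStep_iff]
  exact Or.inr ⟨x, y, monotone_iterate_bootstrapStep S (le_max_left s t) hs,
    monotone_iterate_bootstrapStep S (le_max_right s t) ht, hxy, hx, hy⟩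

lemma spanSet_subset {S T : Set (Fin d → Fin n)} (hST : S ⊆ T) (hT : IsClosedSet T) :
    spanSet S ⊆ T := by
  rintro v ⟨t, ht⟩
  induction t generalizing v with
  | zero => exact hST ht
  | succ t ih =>
    rw [Function.iterate_succ_apply', mem_bootstrapStep_iff] at ht
    rcases ht with h | ⟨x, y, h1, h2, h3, h4, h5⟩
    · exact ih h
    · exact hT v x y (ih h1) (ih h2) h3 h4 h5

lemma spanSet_mono {S T : Set (Fin d → Fin n)} (hST : S ⊆ T) : spanSet S ⊆ spanSet T :=
  spanSet_subset (hST.trans (subset_spanSet T)) (isClosedSet_spanSet T)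

/-- A point violating a prescribed coordinate has at most one neighbour in the subtorus, the one
with that coordinate corrected. -/
lemma Pat.isClosedSet_cells (P : Pat d n) : IsClosedSet P.cells := by
  intro z x y hx hy hxy hzx hzy l
  by_contra hcon
  push Not at hcon
  obtain ⟨r, hr⟩ := Option.ne_none_iff_exists'.1 hcon.1
  have aux : ∀ x ∈ P.cells, hammingDist z x = 1 → x = Function.update z l r := by
    intro x hx h
    obtain ⟨m, hm, hxm⟩ := exists_update_of_hammingDist_eq_one h
    have hxl : x l = r := by
      have := hx l
      rw [hr] at this
      exact (Option.some.inj (this.resolve_left (by simp))).symm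
    have hml : m = l := by
      by_contra hne
      rw [hxm, Function.update_of_ne (Ne.symm hne)] at hxl
      exact hcon.2 (by rw [hr, hxl])
    subst hml
    rw [← hxl]; exact hxm
  exact hxy ((aux x hx hzx).trans (aux y hy hzy).symm)

end Closed

end HammingBootstrap

namespace HammingBootstrap

open Pat

/-! ### The span as the outcome of successive mergers. -/

section Spanning

variable {d n : ℕ}

/-- `Gen A P`: the subtorus `P` is generated from the points of `A` by successive merging of
subtori at distance at most `2`, the dimension increasing strictly at every merger. -/
inductive Gen : Finset (Fin d → Fin n) → Pat d n → Prop
  | single (x : Fin d → Fin n) : Gen {x} (pt x)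
  | merge {A B : Finset (Fin d → Fin n)} {P Q : Pat d n} : Gen A P → Gen B Q → Disjoint A B →
      (diff P Q).card ≤ 2 → P.dim < (Pat.join P Q).dim → Q.dim < (Pat.join P Q).dim →
      Gen (A ∪ B) (Pat.join P Q)

lemma Gen.subset_cells {A : Finset (Fin d → Fin n)} {P : Pat d n} (h : Gen A P) :
    (A : Set (Fin d → Fin n)) ⊆ P.cells := by
  induction h with
  | single x => intro v hv; rw [mem_cells_pt]; simpa using hv
  | @merge A B P Q _ _ _ _ _ _ ih1 ih2 =>
    rw [Finset.coe_union, Set.union_subset_iff]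
    exact ⟨ih1.trans (le_join_left P Q).cells_subset, ih2.trans (le_join_right P Q).cells_subset⟩

lemma Gen.nonempty {A : Finset (Fin d → Fin n)} {P : Pat d n} (h : Gen A P) : A.Nonempty := by
  induction h with
  | single x => simp
  | merge _ _ _ _ _ _ ih1 _ => exact ih1.mono Finset.subset_union_left

lemma Gen.cells_subset (hn : 2 ≤ n) {A : Finset (Fin d → Fin n)} {P : Pat d n} (h : Gen A P)
    {S : Set (Fin d → Fin n)} (hS : IsClosedSet S) (hA : (A : Set (Fin d → Fin n)) ⊆ S) :
    P.cells ⊆ S := by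
  induction h with
  | single x => intro v hv; rw [mem_cells_pt] at hv; exact hA (by simp [hv])
  | merge _ _ _ hd _ _ ih1 ih2 =>
    rw [Finset.coe_union, Set.union_subset_iff] at hA
    exact hS.join_subset hn (ih1 hA.1) (ih2 hA.2) hd

lemma Pat.le_of_cells_subset (hn : 2 ≤ n) {P Q : Pat d n} (h : P.cells ⊆ Q.cells) : Le P Q := by
  intro l
  rcases hQ : Q l with _ | q
  · exact Or.inl rfl
  right
  obtain ⟨r', hr'⟩ := exists_ne_fin hn q
  let y : Fin d → Fin n := fun l => (P l).getD r'
  have hy : y ∈ P.cells := by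
    intro m
    rcases hm : P m with _ | c
    · exact Or.inl rfl
    · right; simp [y, hm]
  have := (h hy l).resolve_left (by simp [hQ])
  rw [hQ] at this
  have hyl := Option.some.inj this
  rcases hPl : P l with _ | c
  · exact absurd (by simp [hyl, y, hPl]) hr'
  · simp [hyl, y, hPl]

lemma Gen.le_of_subset (hn : 2 ≤ n) {A : Finset (Fin d → Fin n)} {P Q : Pat d n} (h : Gen A P)
    (hA : (A : Set (Fin d → Fin n)) ⊆ Q.cells) : Le P Q :=
  Pat.le_of_cells_subset hn (h.cells_subset hn Q.isClosedSet_cells hA)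

/-- The generated subtorus is the smallest one containing the points, whatever the order of the
mergers. Hence families of generating sets of different subtori are disjoint. -/
lemma Gen.pat_unique (hn : 2 ≤ n) {A : Finset (Fin d → Fin n)} {P Q : Pat d n} (h : Gen A P)
    (h' : Gen A Q) : P = Q :=
  (h.le_of_subset hn h'.subset_cells).eq_of_dim_le (h'.le_of_subset hn h.subset_cells).dim_le

/-- Disjoint generated subtori covering a set. -/
structure IsCover (ω : Set (Fin d → Fin n)) (F : Finset (Finset (Fin d → Fin n) × Pat d n)) :
    Prop where
  gen : ∀ a ∈ F, Gen a.1 a.2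
  subset : ∀ a ∈ F, (a.1 : Set (Fin d → Fin n)) ⊆ ω
  disjoint : ∀ a ∈ F, ∀ b ∈ F, a ≠ b → Disjoint a.1 b.1
  cover : ∀ x ∈ ω, ∃ a ∈ F, x ∈ a.2.cells

/-- While two subtori of the cover are within distance 2, either one contains the other and the
smaller is dropped, or both are replaced by their join. The cover shrinks each time, so the process
stops. -/
lemma IsCover.exists_separated {ω : Set (Fin d → Fin n)} :
    ∀ (k : ℕ) (F : Finset (Finset (Fin d → Fin n) × Pat d n)), F.card = k → IsCover ω F →
      ∃ F', IsCover ω F' ∧ ∀ a ∈ F', ∀ b ∈ F', a ≠ b → 3 ≤ (diff a.2 b.2).card := by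
  classical
  intro k
  induction k using Nat.strong_induction_on with
  | _ k ih =>
  intro F hk hF
  by_cases hsep : ∀ a ∈ F, ∀ b ∈ F, a ≠ b → 3 ≤ (diff a.2 b.2).card
  · exact ⟨F, hF, hsep⟩
  push Not at hsep
  obtain ⟨a, ha, b, hb, hab, hd⟩ := hsep
  have drop : ∀ a ∈ F, ∀ b ∈ F, a ≠ b → Le b.2 a.2 →
      ∃ F', IsCover ω F' ∧ ∀ a ∈ F', ∀ b ∈ F', a ≠ b → 3 ≤ (diff a.2 b.2).card := by
    intro a ha b hb hab hle
    refine ih (F.erase b).card (hk ▸ Finset.card_erase_lt_of_mem hb) _ rfl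
      ⟨fun c hc => hF.gen c (Finset.mem_of_mem_erase hc),
        fun c hc => hF.subset c (Finset.mem_of_mem_erase hc),
        fun c hc e he => hF.disjoint c (Finset.mem_of_mem_erase hc) e (Finset.mem_of_mem_erase he),
        fun x hx => ?_⟩
    obtain ⟨c, hc, hxc⟩ := hF.cover x hx
    by_cases hcb : c = b
    · exact ⟨a, Finset.mem_erase.2 ⟨hab, ha⟩, hle.cells_subset (hcb ▸ hxc)⟩
    · exact ⟨c, Finset.mem_erase.2 ⟨hcb, hc⟩, hxc⟩
  by_cases h1 : a.2.dim < (Pat.join a.2 b.2).dim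
  swap
  · have := (le_join_left a.2 b.2).eq_of_dim_le (not_lt.1 h1)
    exact drop a ha b hb hab (by rw [this]; exact le_join_right _ _)
  by_cases h2 : b.2.dim < (Pat.join a.2 b.2).dim
  swap
  · have := (le_join_right a.2 b.2).eq_of_dim_le (not_lt.1 h2)
    exact drop b hb a ha hab.symm (by rw [this]; exact le_join_left _ _)
  set c : Finset (Fin d → Fin n) × Pat d n := (a.1 ∪ b.1, Pat.join a.2 b.2) with hc
  have hlt : (insert c ((F.erase a).erase b)).card < k := by
    have e1 := Finset.card_insert_le c ((F.erase a).erase b)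
    have e2 := Finset.card_erase_lt_of_mem (Finset.mem_erase.2 ⟨hab.symm, hb⟩)
    have e3 := Finset.card_erase_lt_of_mem ha
    omega
  refine ih _ hlt _ rfl ⟨?_, ?_, ?_, ?_⟩
  · intro e he
    rcases Finset.mem_insert.1 he with rfl | he
    · exact Gen.merge (hF.gen a ha) (hF.gen b hb) (hF.disjoint a ha b hb hab) (by omega) h1 h2
    · exact hF.gen e (Finset.mem_of_mem_erase (Finset.mem_of_mem_erase he))
  · intro e he
    rcases Finset.mem_insert.1 he with rfl | he
    · simp only [hc, Finset.coe_union, Set.union_subset_iff]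
      exact ⟨hF.subset a ha, hF.subset b hb⟩
    · exact hF.subset e (Finset.mem_of_mem_erase (Finset.mem_of_mem_erase he))
  · have aux : ∀ e ∈ (F.erase a).erase b, Disjoint c.1 e.1 := by
      intro e he
      simp only [Finset.mem_erase] at he
      simp only [hc, Finset.disjoint_union_left]
      exact ⟨hF.disjoint a ha e he.2.2 (Ne.symm he.2.1), hF.disjoint b hb e he.2.2 (Ne.symm he.1)⟩
    intro e he f hf hef
    rcases Finset.mem_insert.1 he with rfl | he <;> rcases Finset.mem_insert.1 hf with rfl | hf
    · exact absurd rfl hef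
    · exact aux f hf
    · exact (aux e he).symm
    · simp only [Finset.mem_erase] at he hf
      exact hF.disjoint e he.2.2 f hf.2.2 hef
  · intro x hx
    obtain ⟨e, he, hxe⟩ := hF.cover x hx
    by_cases hea : e = a
    · exact ⟨c, Finset.mem_insert_self _ _, (le_join_left a.2 b.2).cells_subset (hea ▸ hxe)⟩
    by_cases heb : e = b
    · exact ⟨c, Finset.mem_insert_self _ _, (le_join_right a.2 b.2).cells_subset (heb ▸ hxe)⟩
    · exact ⟨e, by simp [hea, heb, he], hxe⟩

lemma exists_separated_cover (ω : Set (Fin d → Fin n)) :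
    ∃ F, IsCover ω F ∧ ∀ a ∈ F, ∀ b ∈ F, a ≠ b → 3 ≤ (diff a.2 b.2).card := by
  classical
  refine IsCover.exists_separated _
    (ω.toFinset.image fun x => (({x} : Finset (Fin d → Fin n)), pt x)) rfl ⟨?_, ?_, ?_, ?_⟩
  · simp only [Finset.mem_image, Set.mem_toFinset]
    rintro _ ⟨x, _, rfl⟩
    exact Gen.single x
  · simp only [Finset.mem_image, Set.mem_toFinset]
    rintro _ ⟨x, hx, rfl⟩
    simpa using hx
  · simp only [Finset.mem_image, Set.mem_toFinset]
    rintro _ ⟨x, _, rfl⟩ _ ⟨y, _, rfl⟩ h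
    rw [Finset.disjoint_singleton]
    rintro rfl
    exact h rfl
  · intro x hx
    exact ⟨_, Finset.mem_image.2 ⟨x, by simpa using hx, rfl⟩, mem_cells_pt.2 rfl⟩

/-- A subtorus contained in the span of `ω` is contained in a subtorus generated by points of
`ω`. -/
lemma exists_gen_of_subset_spanSet (hn : 2 ≤ n) {ω : Set (Fin d → Fin n)} {V : Pat d n}
    (hV : V.cells ⊆ spanSet ω) :
    ∃ A P, Gen A P ∧ (A : Set (Fin d → Fin n)) ⊆ ω ∧ Le V P := by
  obtain ⟨F, hF, hsep⟩ := exists_separated_cover ω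
  have huniq : ∀ a ∈ F, ∀ b ∈ F, ∀ x ∈ a.2.cells, ∀ y ∈ b.2.cells, hammingDist x y ≤ 2 → a = b := by
    intro a ha b hb x hx y hy hxy
    by_contra hab
    have := hsep a ha b hb hab
    have := card_diff_le_hammingDist hx hy
    omega
  -- Two neighbours of a common point are within distance 2, so they lie in the same subtorus of the
  -- separated cover, and that subtorus is closed.
  have hclosed : IsClosedSet {v | ∃ a ∈ F, v ∈ a.2.cells} := by
    rintro z x y ⟨a, ha, hxa⟩ ⟨b, hb, hyb⟩ hxy hx hy
    have hd : hammingDist x y ≤ 2 := by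
      have := hammingDist_triangle_left x y z
      omega
    obtain rfl := huniq a ha b hb x hxa y hyb hd
    exact ⟨a, ha, a.2.isClosedSet_cells z x y hxa hyb hxy hx hy⟩
  have hsub := hV.trans (spanSet_subset (T := {v | ∃ a ∈ F, v ∈ a.2.cells}) hF.cover hclosed)
  let y : Fin d → Fin n := fun l => (V l).getD ⟨0, by omega⟩
  have hy : y ∈ V.cells := by
    intro m
    rcases hm : V m with _ | c
    · exact Or.inl rfl
    · right; simp [y, hm]
  obtain ⟨a, ha, hya⟩ := hsub hy
  refine ⟨a.1, a.2, hF.gen a ha, hF.subset a ha, fun l => ?_⟩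
  rcases hl : a.2 l with _ | r
  · exact Or.inl rfl
  right
  have hyr : y l = r := by
    have := (hya l).resolve_left (by simp [hl])
    rw [hl] at this
    exact (Option.some.inj this).symm
  rcases hy l with h | h
  · exfalso
    obtain ⟨r', hr'⟩ := exists_ne_fin hn r
    have hne : r' ≠ y l := hyr ▸ hr'
    -- Moving y inside V by one coordinate stays within distance 1, so separation keeps it in the
    -- same subtorus a; thus a cannot prescribe a coordinate that V leaves free.
    obtain ⟨b, hb, hyb⟩ := hsub (show Function.update y l r' ∈ V.cells by
      intro m
      by_cases hm : m = l
      · subst hm; exact Or.inl h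
      · rw [Function.update_of_ne hm]; exact hy m)
    obtain rfl := huniq a ha b hb y hya _ hyb (by rw [hammingDist_update _ _ hne]; norm_num)
    have := (hyb l).resolve_left (by simp [hl])
    rw [hl, Function.update_self] at this
    exact hr' (Option.some.inj this).symm
  · rw [h, hyr]

/-- Following the mergers, the dimension passes a level `m`. -/
lemma Gen.exists_first_passage {A : Finset (Fin d → Fin n)} {P : Pat d n} (h : Gen A P) {m : ℕ}
    (hm : 0 < m) (hP : m ≤ P.dim) :
    ∃ A₁ P₁ A₂ P₂, Gen A₁ P₁ ∧ Gen A₂ P₂ ∧ Disjoint A₁ A₂ ∧ A₁ ∪ A₂ ⊆ A ∧ (diff P₁ P₂).card ≤ 2 ∧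
      P₁.dim < m ∧ P₂.dim < m ∧ m ≤ (Pat.join P₁ P₂).dim := by
  induction h with
  | single x => rw [dim_pt] at hP; omega
  | @merge A B P Q hA hB hAB hd h1 h2 ih1 ih2 =>
    by_cases hP' : m ≤ P.dim
    · obtain ⟨A₁, P₁, A₂, P₂, g1, g2, g3, g4, g5⟩ := ih1 hP'
      exact ⟨A₁, P₁, A₂, P₂, g1, g2, g3, g4.trans Finset.subset_union_left, g5⟩
    by_cases hQ' : m ≤ Q.dim
    · obtain ⟨A₁, P₁, A₂, P₂, g1, g2, g3, g4, g5⟩ := ih2 hQ'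
      exact ⟨A₁, P₁, A₂, P₂, g1, g2, g3, g4.trans Finset.subset_union_right, g5⟩
    exact ⟨A, P, B, Q, hA, hB, hAB, subset_rfl, hd, not_le.1 hP', not_le.1 hQ', hP⟩

lemma isSubtorus_iff_exists_pat (hn : 0 < n) {i : ℕ} {V : Set (Fin d → Fin n)} :
    IsSubtorus i V ↔ ∃ P : Pat d n, P.dim = i ∧ V = P.cells := by
  classical
  constructor
  · rintro ⟨I, α, hI, rfl⟩
    refine ⟨fun l => if l ∈ I then some (α l) else none, ?_, ?_⟩
    · have : Pat.free (fun l => if l ∈ I then some (α l) else none) = Iᶜ := by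
        ext l; simp [mem_free]
      rw [dim, this, Finset.card_compl, Fintype.card_fin]
      omega
    · ext v
      simp only [Set.mem_ofPred_eq, cells]
      refine forall_congr' fun l => ?_
      by_cases hl : l ∈ I <;> simp [hl, eq_comm]
  · rintro ⟨P, hP, rfl⟩
    refine ⟨P.freeᶜ, fun l => (P l).getD ⟨0, hn⟩, ?_, ?_⟩
    · rw [Finset.card_compl, Fintype.card_fin, ← hP, dim]
      have := Finset.card_le_univ P.free
      rw [Fintype.card_fin] at this
      omega
    · ext v
      simp only [Set.mem_ofPred_eq, cells, Finset.mem_compl, mem_free]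
      refine forall_congr' fun l => ?_
      rcases P l with _ | c <;> simp [eq_comm]

/-- For the forward direction, `exists_gen_of_subset_spanSet` gives a generated subtorus above P.
Its generating points lie in P, so it cannot be larger than P. -/
lemma mem_eventI_iff (hn : 2 ≤ n) {i : ℕ} {ω : Set (Fin d → Fin n)} :
    ω ∈ eventI d i n ↔ ∃ (A : Finset (Fin d → Fin n)) (P : Pat d n), Gen A P ∧ (A : Set (Fin d → Fin n)) ⊆ ω ∧ P.dim = i := by
  constructor
  · rintro ⟨V, hV, hspan⟩
    obtain ⟨P, hP, rfl⟩ := (isSubtorus_iff_exists_pat (by omega)).1 hV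
    obtain ⟨A, Q, hA, hAω, hle⟩ := exists_gen_of_subset_spanSet hn hspan.subset
    rw [Set.subset_inter_iff] at hAω
    have := hle.eq_of_dim_le (hA.le_of_subset hn hAω.2).dim_le
    exact ⟨A, Q, hA, hAω.1, this ▸ hP⟩
  · rintro ⟨A, P, hA, hAω, hP⟩
    refine ⟨P.cells, (isSubtorus_iff_exists_pat (by omega)).2 ⟨P, hP, rfl⟩,
      Set.Subset.antisymm ?_ ?_⟩
    · exact hA.cells_subset hn (isClosedSet_spanSet _)
        ((Set.subset_inter hAω hA.subset_cells).trans (subset_spanSet _))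
    · exact spanSet_subset Set.inter_subset_right P.isClosedSet_cells

lemma eventI_subset_eventC {i : ℕ} : eventI d i n ⊆ eventC d i n := by
  rintro ω ⟨V, hV, hspan⟩
  exact ⟨V, hV, (show V = _ from hspan).subset.trans (spanSet_mono Set.inter_subset_left)⟩

lemma isUpperSet_eventC {i : ℕ} : IsUpperSet (eventC d i n) := by
  rintro ω ω' h ⟨V, hV, hs⟩
  exact ⟨V, hV, hs.trans (spanSet_mono h)⟩

/-- The first merger reaching dimension i cannot produce exactly i, since its points would then
internally span an i-dimensional subtorus. So it jumps over i. -/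
lemma exists_merge_of_mem_eventC_diff (hn : 2 ≤ n) {i : ℕ} (hi : 0 < i) {ω : Set (Fin d → Fin n)}
    (h : ω ∈ eventC d i n \ eventI d i n) :
    ∃ A₁ P₁ A₂ P₂, Gen A₁ P₁ ∧ Gen A₂ P₂ ∧ Disjoint A₁ A₂ ∧
      ((A₁ ∪ A₂ : Finset (Fin d → Fin n)) : Set (Fin d → Fin n)) ⊆ ω ∧ (diff P₁ P₂).card ≤ 2 ∧
      P₁.dim < i ∧ P₂.dim < i ∧ i < (Pat.join P₁ P₂).dim := by
  obtain ⟨⟨V, hV, hspan⟩, hI⟩ := h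
  obtain ⟨P, hP, rfl⟩ := (isSubtorus_iff_exists_pat (by omega)).1 hV
  obtain ⟨A, Q, hA, hAω, hle⟩ := exists_gen_of_subset_spanSet hn hspan
  obtain ⟨A₁, P₁, A₂, P₂, g1, g2, g3, g4, g5, g6, g7, g8⟩ :=
    hA.exists_first_passage hi (hP ▸ hle.dim_le)
  have hsub : ((A₁ ∪ A₂ : Finset (Fin d → Fin n)) : Set (Fin d → Fin n)) ⊆ ω :=
    (Finset.coe_subset.2 g4).trans hAω
  refine ⟨A₁, P₁, A₂, P₂, g1, g2, g3, hsub, g5, g6, g7, lt_of_le_of_ne g8 fun heq => hI ?_⟩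
  rw [mem_eventI_iff hn]
  exact ⟨_, _, Gen.merge g1 g2 g3 g5 (by omega) (by omega), hsub, heq.symm⟩

end Spanning

end HammingBootstrap

namespace HammingBootstrap

open Pat

/-! ### Inequalities for the exponents of mergers. -/

section Exponents

/-- The exponent `(c + 1) (c - γ) - [k odd]`, `c = ⌈k / 2⌉`: the number `n ^ (k + expo γ k)` bounds
the weight of all sets of points generating a given `k`-dimensional subtorus. -/
noncomputable def expo (γ : ℝ) (k : ℕ) : ℝ :=
  ((((k + 1) / 2 : ℕ) : ℝ) + 1) * ((((k + 1) / 2 : ℕ) : ℝ) - γ) - ((k % 2 : ℕ) : ℝ)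

lemma expo_zero (γ : ℝ) : expo γ 0 = -γ := by simp [expo]

lemma expo_two_mul (γ : ℝ) (c : ℕ) : expo γ (2 * c) = ((c : ℝ) + 1) * (c - γ) := by
  have h1 : (2 * c + 1) / 2 = c := by omega
  have h2 : (2 * c) % 2 = 0 := by omega
  simp [expo, h1]

/-- Here k = 2c - o with o the parity of k, and c + 1 is the number of points that the exponent
charges for dimension k. Put T = c₁ + c₂ + 1 - c, the number of surplus points in the merger. Apart
from e, the right side minus the left side is T(γ - 2c) + 2c₁c₂ - T(T - 1) + o₁ + o₂. If T = 0, only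
2c₁c₂ + o₁ + o₂ remains; if T ≥ 1, the first term already gives δ. -/
lemma expo_add_le_aux {c₁ c₂ o₁ o₂ c o j : ℤ} {γ δ : ℝ} (hδ0 : 0 ≤ δ) (hγ : 2 * (j : ℝ) + δ ≤ γ)
    (hc1 : 0 ≤ c₁) (hc2 : 0 ≤ c₂) (ho1 : 0 ≤ o₁) (ho2 : 0 ≤ o₂)
    (h1 : c₁ ≤ c) (h2 : c₂ ≤ c) (hc : c ≤ j) (hT : c ≤ c₁ + c₂ + 1) {e : ℝ}
    (he : e ≤ δ) (h0 : c = c₁ + c₂ + 1 → e ≤ ((2 * c₁ * c₂ + o₁ + o₂ : ℤ) : ℝ)) :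
    ((c₁ : ℝ) + 1) * (c₁ - γ) - o₁ + (((c₂ : ℝ) + 1) * (c₂ - γ) - o₂) + (2 * c - o) ≤
      ((c : ℝ) + 1) * (c - γ) - o - e := by
  rcases hT.eq_or_lt with h | h
  · have hcr : (c : ℝ) = c₁ + c₂ + 1 := by rw [h]; push_cast; ring
    have := h0 h
    push_cast at this
    rw [hcr]
    nlinarith
  · have hD : 0 ≤ 2 * c₁ * c₂ - (c₁ + c₂ + 1 - c) * (c₁ + c₂ - c) + o₁ + o₂ := by
      rcases le_total c₁ c₂ with h12 | h12
      · have : (c₁ + c₂ + 1 - c) * (c₁ + c₂ - c) ≤ (c₁ + 1) * c₁ :=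
          mul_le_mul (by linarith) (by linarith) (by linarith) (by linarith)
        rcases hc1.eq_or_lt with h' | h'
        · rw [← h'] at this ⊢; linarith
        · nlinarith
      · have : (c₁ + c₂ + 1 - c) * (c₁ + c₂ - c) ≤ (c₂ + 1) * c₂ :=
          mul_le_mul (by linarith) (by linarith) (by linarith) (by linarith)
        rcases hc2.eq_or_lt with h' | h'
        · rw [← h'] at this ⊢; linarith
        · nlinarith
    have hDr : (0 : ℝ) ≤ 2 * c₁ * c₂ - (c₁ + c₂ + 1 - c) * (c₁ + c₂ - c) + o₁ + o₂ := by
      exact_mod_cast hD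
    have hTr : (1 : ℝ) ≤ (c₁ : ℝ) + c₂ + 1 - c := by
      have : 1 ≤ c₁ + c₂ + 1 - c := by linarith
      exact_mod_cast this
    have hcj : (c : ℝ) ≤ j := by exact_mod_cast hc
    have hg : (2 * (c : ℝ) + δ) * ((c₁ : ℝ) + c₂ + 1 - c) ≤ γ * ((c₁ : ℝ) + c₂ + 1 - c) :=
      mul_le_mul_of_nonneg_right (by linarith) (by linarith)
    nlinarith

lemma two_mul_succ_half (k : ℕ) : 2 * ((k + 1) / 2) = k + k % 2 := by omega

lemma expo_eq (γ : ℝ) (k : ℕ) : expo γ k =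
    (((((k + 1) / 2 : ℕ) : ℤ) : ℝ) + 1) * (((((k + 1) / 2 : ℕ) : ℤ) : ℝ) - γ) -
      (((k % 2 : ℕ) : ℤ) : ℝ) := by
  rw [expo, Int.cast_natCast, Int.cast_natCast]

lemma cast_eq_two_mul_sub (k : ℕ) : (k : ℝ) =
    2 * ((((k + 1) / 2 : ℕ) : ℤ) : ℝ) - (((k % 2 : ℕ) : ℤ) : ℝ) := by
  have := two_mul_succ_half k
  rw [Int.cast_natCast, Int.cast_natCast]
  have h : (2 : ℝ) * (((k + 1) / 2 : ℕ) : ℝ) = (k : ℝ) + ((k % 2 : ℕ) : ℝ) := by exact_mod_cast this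
  linarith

/-- Inside a k-dimensional subtorus there are about n ^ (k - k₁) · n ^ (k - k₂) choices of the
merging pair, with weights n ^ (kᵢ + expo kᵢ). Their product must not exceed n ^ (k + expo k), which
is this inequality. -/
lemma expo_add_le {k₁ k₂ k j : ℕ} {γ δ : ℝ} (hδ0 : 0 ≤ δ) (hγ : 2 * (j : ℝ) + δ ≤ γ)
    (h1 : k₁ < k) (h2 : k₂ < k) (h3 : k ≤ k₁ + k₂ + 2) (hk : k ≤ 2 * j) :
    expo γ k₁ + expo γ k₂ + k ≤ expo γ k := by
  rw [expo_eq γ k₁, expo_eq γ k₂, expo_eq γ k, cast_eq_two_mul_sub k]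
  have := expo_add_le_aux (c₁ := ((k₁ + 1) / 2 : ℕ)) (c₂ := ((k₂ + 1) / 2 : ℕ))
    (o₁ := (k₁ % 2 : ℕ)) (o₂ := (k₂ % 2 : ℕ)) (c := ((k + 1) / 2 : ℕ)) (o := (k % 2 : ℕ))
    (j := j) (γ := γ) (δ := δ) (e := 0) hδ0 (by simpa using hγ) (by positivity) (by positivity)
    (by positivity) (by positivity) (by omega) (by omega) (by omega) (by omega) hδ0 (by
      intro _; positivity)
  linarith

/-- Without surplus points, 2c₁c₂ + o₁ + o₂ vanishes only when both dimensions are even and one of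
them is 0, that is, when a single point joins a (k - 2)-dimensional subtorus. Excluding this makes
the integer at least 1, hence at least δ. -/
lemma expo_add_le_sub {k₁ k₂ k j : ℕ} {γ δ : ℝ} (hδ0 : 0 ≤ δ) (hδ1 : δ ≤ 1)
    (hγ : 2 * (j : ℝ) + δ ≤ γ) (h1 : k₁ < k) (h2 : k₂ < k) (h3 : k ≤ k₁ + k₂ + 2) (hk : k ≤ 2 * j)
    (heven : k % 2 = 0) (h4 : ¬ (k₁ + 2 = k ∧ k₂ = 0)) (h5 : ¬ (k₂ + 2 = k ∧ k₁ = 0)) :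
    expo γ k₁ + expo γ k₂ + k ≤ expo γ k - δ := by
  rw [expo_eq γ k₁, expo_eq γ k₂, expo_eq γ k, cast_eq_two_mul_sub k]
  have := expo_add_le_aux (c₁ := ((k₁ + 1) / 2 : ℕ)) (c₂ := ((k₂ + 1) / 2 : ℕ))
    (o₁ := (k₁ % 2 : ℕ)) (o₂ := (k₂ % 2 : ℕ)) (c := ((k + 1) / 2 : ℕ)) (o := (k % 2 : ℕ))
    (j := j) (γ := γ) (δ := δ) (e := δ) hδ0 (by simpa using hγ) (by positivity) (by positivity)
    (by positivity) (by positivity) (by omega) (by omega) (by omega) (by omega) le_rfl (by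
      intro hc
      have hpos : (1 : ℤ) ≤ 2 * ((k₁ + 1) / 2 : ℕ) * ((k₂ + 1) / 2 : ℕ) + (k₁ % 2 : ℕ)
          + (k₂ % 2 : ℕ) := by
        by_contra hcon
        have e0 : (0 : ℤ) ≤ 2 * ((k₁ + 1) / 2 : ℕ) * ((k₂ + 1) / 2 : ℕ) := by positivity
        have e1 : k₁ % 2 = 0 := by omega
        have e2 : k₂ % 2 = 0 := by omega
        have e3 : (((k₁ + 1) / 2 : ℕ) : ℤ) * ((k₂ + 1) / 2 : ℕ) = 0 := by
          have : (0 : ℤ) ≤ ((k₁ + 1) / 2 : ℕ) * ((k₂ + 1) / 2 : ℕ) := by positivity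
          rw [mul_assoc] at hcon
          omega
        rcases mul_eq_zero.1 e3 with h | h <;> omega
      calc δ ≤ 1 := hδ1
        _ ≤ _ := by exact_mod_cast hpos)
  linarith

/-- A jump over dimension 2j forces c₁ + c₂ ≥ j, so at least one surplus point is paid for, and γ ≥
2j + δ makes this too expensive. What remains is an integer inequality in the deficits yᵢ = j - cᵢ.
A deficit can vanish only for dimension 2j - 1, which is why these cases are separated. -/
lemma expo_add_le_of_lt {k₁ k₂ k j : ℕ} {γ δ : ℝ} (hδ0 : 0 ≤ δ)
    (hγ : 2 * (j : ℝ) + δ ≤ γ) (h1 : k₁ < 2 * j) (h2 : k₂ < 2 * j) (h3 : k ≤ k₁ + k₂ + 2)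
    (hk : 2 * j < k) : expo γ k₁ + expo γ k₂ + k ≤ expo γ (2 * j) - δ := by
  rw [expo_two_mul, expo, expo]
  have p1 := two_mul_succ_half k₁
  have p2 := two_mul_succ_half k₂
  have q1 := Nat.mod_lt k₁ two_pos
  have q2 := Nat.mod_lt k₂ two_pos
  generalize (k₁ + 1) / 2 = c₁ at *
  generalize (k₂ + 1) / 2 = c₂ at *
  generalize k₁ % 2 = o₁ at *
  generalize k₂ % 2 = o₂ at *
  have r1 : c₁ < j ∨ (c₁ = j ∧ o₁ = 1) := by omega
  have r2 : c₂ < j ∨ (c₂ = j ∧ o₂ = 1) := by omega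
  have r3 : j ≤ c₁ + c₂ := by omega
  have r4 : k + o₁ + o₂ ≤ 2 * c₁ + 2 * c₂ + 2 := by omega
  have key : ∃ y₁ y₂ : ℤ, y₁ = j - c₁ ∧ y₂ = j - c₂ ∧
      0 ≤ (j : ℤ) ^ 2 - 3 * j - 2 - y₁ ^ 2 - y₂ ^ 2 + 3 * (y₁ + y₂) + 2 * (o₁ + o₂) := by
    refine ⟨_, _, rfl, rfl, ?_⟩
    rcases r1 with r1 | ⟨rfl, rfl⟩ <;> rcases r2 with r2 | ⟨rfl, rfl⟩
    · obtain ⟨y₁, hy1⟩ : ∃ y₁ : ℤ, y₁ = j - c₁ - 1 := ⟨_, rfl⟩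
      obtain ⟨y₂, hy2⟩ : ∃ y₂ : ℤ, y₂ = j - c₂ - 1 := ⟨_, rfl⟩
      have a1 : 0 ≤ y₁ := by omega
      have a2 : 0 ≤ y₂ := by omega
      have a3 : y₁ + y₂ + 2 ≤ j := by omega
      have e1 : (j : ℤ) - c₁ = y₁ + 1 := by omega
      have e2 : (j : ℤ) - c₂ = y₂ + 1 := by omega
      rw [e1, e2]
      obtain ⟨s, hs⟩ : ∃ s : ℤ, s = j - (y₁ + y₂ + 2) := ⟨_, rfl⟩
      have e3 : (j : ℤ) = y₁ + y₂ + 2 + s := by omega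
      have hs0 : 0 ≤ s := by omega
      have ho1 : (0 : ℤ) ≤ o₁ := by positivity
      have ho2 : (0 : ℤ) ≤ o₂ := by positivity
      rw [e3]
      have : 0 ≤ 2 * (y₁ * y₂) + 2 * (y₁ * s) + 2 * (y₂ * s) + 2 * y₁ + 2 * y₂ + s ^ 2 + s
        + 2 * ((o₁ : ℤ) + o₂) := by positivity
      linarith
    · obtain ⟨y₁, hy1⟩ : ∃ y₁ : ℤ, y₁ = c₂ - c₁ - 1 := ⟨_, rfl⟩
      have a1 : 0 ≤ y₁ := by omega
      have a3 : (0 : ℤ) ≤ c₁ := by omega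
      have e1 : (c₂ : ℤ) - c₁ = y₁ + 1 := by omega
      have e3 : (c₂ : ℤ) = c₁ + y₁ + 1 := by omega
      have ho1 : (0 : ℤ) ≤ o₁ := by positivity
      rw [e1, e3]
      have := Int.le_self_sq (c₁ : ℤ)
      have := mul_nonneg a1 a3
      push_cast
      linarith
    · obtain ⟨y₁, hy1⟩ : ∃ y₁ : ℤ, y₁ = c₁ - c₂ - 1 := ⟨_, rfl⟩
      have a1 : 0 ≤ y₁ := by omega
      have a3 : (0 : ℤ) ≤ c₂ := by omega
      have e1 : (c₁ : ℤ) - c₂ = y₁ + 1 := by omega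
      have e3 : (c₁ : ℤ) = c₂ + y₁ + 1 := by omega
      have ho1 : (0 : ℤ) ≤ o₂ := by positivity
      rw [e1, e3]
      have := Int.le_self_sq (c₂ : ℤ)
      have := mul_nonneg a1 a3
      push_cast
      linarith
    · have := Int.le_self_sq ((c₂ : ℤ) - 1)
      push_cast
      linarith
  obtain ⟨y₁, y₂, e1, e2, key⟩ := key
  have keyr : (0 : ℝ) ≤ (j : ℝ) ^ 2 - 3 * j - 2 - (j - c₁ : ℝ) ^ 2 - (j - c₂ : ℝ) ^ 2
      + 3 * ((j - c₁) + (j - c₂)) + 2 * (o₁ + o₂) := by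
    rw [e1, e2] at key
    exact_mod_cast key
  have hD : (1 : ℝ) ≤ (c₁ : ℝ) + c₂ + 1 - j := by
    have : (j : ℝ) ≤ c₁ + c₂ := by exact_mod_cast r3
    linarith
  have hg : (2 * (j : ℝ) + δ) * ((c₁ : ℝ) + c₂ + 1 - j) ≤ γ * ((c₁ : ℝ) + c₂ + 1 - j) :=
      mul_le_mul_of_nonneg_right (by linarith) (by linarith)
  have hkr : (k : ℝ) + o₁ + o₂ ≤ 2 * c₁ + 2 * c₂ + 2 := by exact_mod_cast r4
  have hδ : δ ≤ δ * ((c₁ : ℝ) + c₂ + 1 - j) := le_mul_of_one_le_right hδ0 hD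
  clear * - keyr hg hkr hδ
  linarith

end Exponents

/-! ### Counting subtori and points inside a subtorus. -/

section Counting

/-- The union bound in the form used throughout: each object has at least one code b, and the
decoding map e makes codes of different objects distinct. -/
lemma sum_le_sum_of_forall_exists {α β : Type*} [DecidableEq β] {s : Finset α} {t : Finset β}
    {f : α → ℝ} {g : β → ℝ} (e : β → α) (hg : ∀ b ∈ t, 0 ≤ g b)
    (h : ∀ a ∈ s, ∃ b ∈ t, e b = a ∧ f a ≤ g b) : ∑ a ∈ s, f a ≤ ∑ b ∈ t, g b := by
  rcases s.eq_empty_or_nonempty with rfl | ⟨a₀, ha₀⟩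
  · simpa using Finset.sum_nonneg hg
  obtain ⟨b₀, -⟩ := h a₀ ha₀
  have : Nonempty β := ⟨b₀⟩
  choose! c hc1 hc2 hc3 using h
  have hinj : Set.InjOn c (s : Set α) := by
    intro a ha a' ha' haa
    rw [← hc2 a ha, ← hc2 a' ha', haa]
  calc ∑ a ∈ s, f a ≤ ∑ a ∈ s, g (c a) := Finset.sum_le_sum hc3
    _ = ∑ b ∈ s.image c, g b := (Finset.sum_image hinj).symm
    _ ≤ ∑ b ∈ t, g b := by
      refine Finset.sum_le_sum_of_subset_of_nonneg ?_ fun b hb _ => hg b hb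
      intro b hb
      obtain ⟨a, ha, rfl⟩ := Finset.mem_image.1 hb
      exact hc1 a ha

variable {d n : ℕ}

/-- The patterns below `P`. -/
def Pat.subs (P : Pat d n) : Finset (Pat d n) := Finset.univ.filter fun Q => Le Q P

lemma Pat.mem_subs {P Q : Pat d n} : Q ∈ P.subs ↔ Le Q P := by simp [subs]

/-- Each free coordinate of P is independently left free (weight x) or given one of n values (weight
1). Coefficients in x count subtori by dimension; x = n gives the bound used for weighted sums. -/
lemma Pat.sum_subs_pow_dim {R : Type*} [CommSemiring R] (x : R) (P : Pat d n) :
    ∑ Q ∈ P.subs, x ^ Q.dim = (x + n) ^ P.dim := by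
  have h1 : P.subs = Fintype.piFinset fun l => if P l = none then Finset.univ else {P l} := by
    ext Q
    rw [mem_subs, Fintype.mem_piFinset]
    refine forall_congr' fun l => ?_
    by_cases hl : P l = none <;> simp [hl]
  have h2 : ∀ Q : Pat d n, x ^ Q.dim = ∏ l, if Q l = none then x else 1 := by
    intro Q
    rw [Finset.prod_ite, Finset.prod_const, Finset.prod_const_one, mul_one]
    rfl
  simp only [h2]
  rw [h1, ← Finset.prod_univ_sum (fun l => if P l = none then Finset.univ else {P l})
    (fun _ o => if o = none then x else 1)]
  have h3 : ∀ l, (∑ o ∈ (if P l = none then Finset.univ else {P l}),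
      if o = none then x else 1) = if P l = none then x + n else 1 := by
    intro l
    split_ifs with hl
    · rw [Fintype.sum_option]
      simp
    · rw [Finset.sum_singleton, if_neg hl]
  simp only [h3]
  rw [Finset.prod_ite, Finset.prod_const, Finset.prod_const_one, mul_one]
  rfl

lemma Pat.card_subs_dim (P : Pat d n) (m : ℕ) :
    (P.subs.filter fun Q => Q.dim = m).card = n ^ (P.dim - m) * P.dim.choose m := by
  have h := congrArg (fun q => Polynomial.coeff q m)
    (P.sum_subs_pow_dim (Polynomial.X : Polynomial ℕ))
  simp only [Polynomial.finsetSum_coeff, Polynomial.coeff_X_pow] at h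
  rw [← Polynomial.C_eq_natCast, Polynomial.coeff_X_add_C_pow] at h
  rw [Finset.card_filter]
  simpa [eq_comm] using h

/-- The whole torus. -/
def Pat.whole (d n : ℕ) : Pat d n := fun _ => none

lemma Pat.dim_whole : (whole d n).dim = d := by simp [whole, dim, free]

lemma Pat.subs_whole : (whole d n).subs = Finset.univ := by
  ext; simp [mem_subs, Le, whole]

open scoped Classical in
/-- The points of a subtorus. -/
noncomputable def Pat.points (P : Pat d n) : Finset (Fin d → Fin n) :=
  Finset.univ.filter fun v => v ∈ P.cells

lemma Pat.mem_points {P : Pat d n} {v : Fin d → Fin n} : v ∈ P.points ↔ v ∈ P.cells := by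
  simp [points]

lemma Pat.card_points (P : Pat d n) : P.points.card = n ^ P.dim := by
  have h : P.subs.filter (fun Q => Q.dim = 0) = P.points.image pt := by
    ext Q
    simp only [Finset.mem_filter, mem_subs, Finset.mem_image, mem_points]
    constructor
    · rintro ⟨h1, h2⟩
      have hne : ∀ l, Q l ≠ none := by
        intro l hl
        rw [dim, Finset.card_eq_zero] at h2
        exact absurd (mem_free.2 hl) (by simp [h2])
      choose v hv using fun l => Option.ne_none_iff_exists'.1 (hne l)
      have : pt v = Q := by funext l; rw [hv]; rfl
      exact ⟨v, pt_le.1 (this ▸ h1), this⟩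
    · rintro ⟨v, hv, rfl⟩
      exact ⟨pt_le.2 hv, dim_pt v⟩
  have h2 := P.card_subs_dim 0
  rw [h, Finset.card_image_of_injective _ pt_injective] at h2
  simpa using h2

lemma Pat.dim_update {P : Pat d n} {l : Fin d} (hl : P l = none) (c : Fin n) :
    Pat.dim (Function.update P l (some c)) + 1 = P.dim := by
  have : P.free = insert l (Pat.free (Function.update P l (some c))) := by
    ext m
    rw [Finset.mem_insert, mem_free, mem_free]
    by_cases hm : m = l
    · subst hm; simp [hl]
    · simp [hm]
  rw [dim, dim, this, Finset.card_insert_of_notMem]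
  simp [mem_free]

lemma Pat.card_points_filter_eq {P : Pat d n} {l : Fin d} (hl : P l = none) (c : Fin n) :
    (P.points.filter fun v => v l = c).card = n ^ (P.dim - 1) := by
  have h : P.points.filter (fun v => v l = c)
      = Pat.points (Function.update P l (some c)) := by
    ext v
    rw [Finset.mem_filter, mem_points, mem_points]
    constructor
    · rintro ⟨h1, h2⟩ m
      by_cases hm : m = l
      · subst hm; simp [h2]
      · rw [Function.update_of_ne hm]; exact h1 m
    · intro h
      refine ⟨fun m => ?_, ?_⟩
      · by_cases hm : m = l
        · subst hm; exact Or.inl hl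
        · have := h m
          rwa [Function.update_of_ne hm] at this
      · have := h l
        simp only [Function.update_self, reduceCtorEq, Option.some.injEq, false_or] at this
        exact this.symm
  rw [h, card_points, ← dim_update hl c]
  rfl

/-- Sharing a free coordinate with one of the points of A costs a factor n. -/
lemma Pat.card_points_filter_exists_le {P : Pat d n} (A : Finset (Fin d → Fin n)) :
    (P.points.filter fun b => ∃ x ∈ A, ∃ l, P l = none ∧ x l = b l).card ≤
      A.card * P.dim * n ^ (P.dim - 1) := by
  classical
  have hsub : (P.points.filter fun b => ∃ x ∈ A, ∃ l, P l = none ∧ x l = b l) ⊆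
      (A ×ˢ P.free).biUnion fun q => P.points.filter fun b => b q.2 = q.1 q.2 := by
    intro b hb
    rw [Finset.mem_filter] at hb
    obtain ⟨hb, x, hx, l, hl, hxb⟩ := hb
    rw [Finset.mem_biUnion]
    exact ⟨(x, l), Finset.mem_product.2 ⟨hx, mem_free.2 hl⟩, Finset.mem_filter.2 ⟨hb, hxb.symm⟩⟩
  refine (Finset.card_le_card hsub).trans (Finset.card_biUnion_le.trans ?_)
  rw [Finset.sum_congr rfl fun q hq =>
    card_points_filter_eq (mem_free.1 (Finset.mem_product.1 hq).2) _, Finset.sum_const,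
    Finset.card_product, smul_eq_mul]
  rfl

/-- The number of points of `P` all of whose free coordinates avoid those of the points of `A`. -/
lemma Pat.le_card_points_filter_generic {P : Pat d n} (A : Finset (Fin d → Fin n)) :
    (n - A.card) ^ P.dim ≤
      (P.points.filter fun b => ∀ x ∈ A, ∀ l, P l = none → x l ≠ b l).card := by
  classical
  rcases Nat.eq_zero_or_pos n with rfl | hn
  · rcases Nat.eq_zero_or_pos P.dim with h | h
    · rw [h, pow_zero, Nat.one_le_iff_ne_zero, Finset.card_ne_zero]
      have hl : ∀ l, P l ≠ none := by
        intro l hl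
        rw [dim, Finset.card_eq_zero] at h
        exact absurd (mem_free.2 hl) (by simp [h])
      refine ⟨fun l => (P l).get (Option.isSome_iff_ne_none.2 (hl l)), ?_⟩
      rw [Finset.mem_filter, mem_points]
      exact ⟨fun l => Or.inr (by simp), fun x _ l hl' => absurd hl' (hl l)⟩
    · rw [Nat.zero_sub, zero_pow h.ne']; exact Nat.zero_le _
  let t : Fin d → Finset (Fin n) := fun l =>
    if P l = none then (A.image fun x => x l)ᶜ else {(P l).getD ⟨0, hn⟩}
  have h1 : Fintype.piFinset t ⊆
      P.points.filter fun b => ∀ x ∈ A, ∀ l, P l = none → x l ≠ b l := by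
    intro b hb
    rw [Fintype.mem_piFinset] at hb
    rw [Finset.mem_filter, mem_points]
    refine ⟨fun l => ?_, fun x hx l hl => ?_⟩
    · rcases hPl : P l with _ | c
      · exact Or.inl rfl
      · have := hb l
        simp only [t, hPl, reduceCtorEq, if_false, Option.getD_some, Finset.mem_singleton] at this
        exact Or.inr (by rw [this])
    · have := hb l
      simp only [t, hl, if_true, Finset.mem_compl, Finset.mem_image, not_exists, not_and] at this
      exact this x hx
  refine le_trans ?_ (Finset.card_le_card h1)
  rw [Fintype.card_piFinset]
  have h2 : ∀ l, (if P l = none then n - A.card else 1) ≤ (t l).card := by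
    intro l
    by_cases hl : P l = none
    · simp only [t, hl, if_true, Finset.card_compl, Fintype.card_fin]
      exact Nat.sub_le_sub_left Finset.card_image_le _
    · simp [t, hl]
  calc (n - A.card) ^ P.dim = ∏ l, if P l = none then n - A.card else 1 := by
        rw [Finset.prod_ite, Finset.prod_const, Finset.prod_const_one, mul_one]; rfl
    _ ≤ _ := Finset.prod_le_prod (fun _ _ => Nat.zero_le _) fun l _ => h2 l

end Counting

end HammingBootstrap

namespace HammingBootstrap

open Pat

/-! ### Good sets, bad sets and recursive bounds for their weights. -/

section Weights

variable {d n : ℕ}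

/-- `Good A P`: the points of `A` can be added one at a time, the spanned subtorus growing by two
dimensions each time and each new point differing from the former ones in all free coordinates. -/
inductive Good : Finset (Fin d → Fin n) → Pat d n → Prop
  | single (x : Fin d → Fin n) : Good {x} (pt x)
  | add {A : Finset (Fin d → Fin n)} {P Q : Pat d n} {b : Fin d → Fin n} : Good A Q → Le Q P →
      P.dim = Q.dim + 2 → b ∈ P.cells → (∀ x ∈ A, ∀ l, P l = none → x l ≠ b l) →
      Good (insert b A) P

lemma notMem_of_forall_ne {A : Finset (Fin d → Fin n)} {P : Pat d n} {b : Fin d → Fin n}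
    (hP : 0 < P.dim) (h : ∀ x ∈ A, ∀ l, P l = none → x l ≠ b l) : b ∉ A := by
  intro hb
  obtain ⟨l, hl⟩ := Finset.card_pos.1 hP
  exact h b hb l (mem_free.1 hl) rfl

lemma Good.dim_add_two {A : Finset (Fin d → Fin n)} {P : Pat d n} (h : Good A P) :
    P.dim + 2 = 2 * A.card := by
  induction h with
  | single x => simp [dim_pt]
  | add _ _ hd _ hgen ih =>
    rw [Finset.card_insert_of_notMem (notMem_of_forall_ne (by omega) hgen)]
    omega

lemma join_pt_eq {A : Finset (Fin d → Fin n)} {P Q : Pat d n} {b x : Fin d → Fin n} (hle : Le Q P)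
    (hb : b ∈ P.cells) (hxA : x ∈ A) (hxQ : x ∈ Q.cells)
    (hgen : ∀ x ∈ A, ∀ l, P l = none → x l ≠ b l) : Pat.join Q (pt b) = P := by
  funext l
  rw [Pat.join]
  split_ifs with h
  · rcases hle l with h' | h'
    · exfalso
      have h1 : Q l = some (b l) := h
      have h2 := (hxQ l).resolve_left (by simp [h1])
      rw [h1] at h2
      exact hgen x hxA l h' (Option.some.inj h2).symm
    · exact h'
  · rcases hle l with h' | h'
    · exact h'.symm
    · rcases hb l with h'' | h''
      · exact h''.symm
      · exact absurd (h'.trans h'') h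

/-- Genericity makes the join of Q and the new point all of P, and they can differ only in the two
coordinates free in P and prescribed in Q. -/
lemma Good.gen {A : Finset (Fin d → Fin n)} {P : Pat d n} (h : Good A P) : Gen A P := by
  induction h with
  | single x => exact Gen.single x
  | @add A P Q b _ hle hd hb hgen ih =>
    obtain ⟨x, hx⟩ := ih.nonempty
    have hj := join_pt_eq hle hb hx (ih.subset_cells hx) hgen
    have hdiff : (diff Q (pt b)).card ≤ 2 := by
      have hsub : diff Q (pt b) ⊆ P.free \ Q.free := by
        intro l hl
        rw [mem_diff] at hl
        rw [Finset.mem_sdiff, mem_free, mem_free]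
        refine ⟨?_, hl.1⟩
        rcases hle l with h' | h'
        · exact h'
        · rcases hb l with h'' | h''
          · exact h''
          · exact absurd (h'.trans h'') hl.2.2
      refine (Finset.card_le_card hsub).trans ?_
      rw [Finset.card_sdiff_of_subset hle.free_subset]
      unfold dim at hd
      omega
    have := Gen.merge ih (Gen.single b)
      (Finset.disjoint_singleton_right.2 (notMem_of_forall_ne (by omega) hgen)) hdiff
      (by rw [hj]; omega) (by rw [hj, dim_pt]; omega)
    rwa [hj, Finset.union_comm, ← Finset.insert_eq] at this

lemma Gen.eq_pt_of_dim_eq_zero {A : Finset (Fin d → Fin n)} {P : Pat d n} (h : Gen A P)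
    (hP : P.dim = 0) : ∃ x, A = {x} ∧ P = pt x := by
  cases h with
  | single x => exact ⟨x, rfl, rfl⟩
  | merge _ _ _ _ h1 _ => omega

lemma Gen.exists_of_dim_pos {A : Finset (Fin d → Fin n)} {P : Pat d n} (h : Gen A P)
    (hP : 0 < P.dim) : ∃ A₁ P₁ A₂ P₂, Gen A₁ P₁ ∧ Gen A₂ P₂ ∧ Disjoint A₁ A₂ ∧ A = A₁ ∪ A₂ ∧
      Le P₁ P ∧ Le P₂ P ∧ P₁.dim < P.dim ∧ P₂.dim < P.dim ∧ P.dim ≤ P₁.dim + P₂.dim + 2 := by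
  cases h with
  | single x => rw [dim_pt] at hP; omega
  | @merge A₁ A₂ P₁ P₂ g1 g2 g3 g4 g5 g6 =>
    refine ⟨A₁, P₁, A₂, P₂, g1, g2, g3, rfl, le_join_left _ _, le_join_right _ _, g5, g6, ?_⟩
    have := dim_join_le P₁ P₂
    omega

/-- The ways a generating set can fail to be good: its last merger is not a point joining a subtorus
two dimensions lower, or it is but the earlier points were already bad, or the new point shares a
free coordinate with an earlier one. -/
lemma Gen.not_good_cases {A : Finset (Fin d → Fin n)} {P : Pat d n} (h : Gen A P)
    (hP : 0 < P.dim) (hbad : ¬ Good A P) :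
    (∃ A₁ P₁ A₂ P₂, Gen A₁ P₁ ∧ Gen A₂ P₂ ∧ Disjoint A₁ A₂ ∧ A = A₁ ∪ A₂ ∧
      Le P₁ P ∧ Le P₂ P ∧ P₁.dim < P.dim ∧ P₂.dim < P.dim ∧ P.dim ≤ P₁.dim + P₂.dim + 2 ∧
      ¬ (P₁.dim + 2 = P.dim ∧ P₂.dim = 0) ∧ ¬ (P₂.dim + 2 = P.dim ∧ P₁.dim = 0)) ∨
    (∃ A' Q b, Gen A' Q ∧ Le Q P ∧ P.dim = Q.dim + 2 ∧ b ∈ P.cells ∧ b ∉ A' ∧ A = insert b A' ∧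
      ¬ Good A' Q) ∨
    (∃ A' Q b, Gen A' Q ∧ Le Q P ∧ P.dim = Q.dim + 2 ∧ b ∈ P.cells ∧ b ∉ A' ∧ A = insert b A' ∧
      Good A' Q ∧ ∃ x ∈ A', ∃ l, P l = none ∧ x l = b l) := by
  obtain ⟨A₁, P₁, A₂, P₂, g1, g2, g3, rfl, g5, g6, g7, g8, g9⟩ := h.exists_of_dim_pos hP
  have key : ∀ A₁ P₁ A₂ P₂, Gen A₁ P₁ → Gen A₂ P₂ → Disjoint A₁ A₂ → Le P₁ P → Le P₂ P →
      ¬ Good (A₁ ∪ A₂) P → P₁.dim + 2 = P.dim → P₂.dim = 0 →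
      (∃ A' Q b, Gen A' Q ∧ Le Q P ∧ P.dim = Q.dim + 2 ∧ b ∈ P.cells ∧ b ∉ A' ∧
        A₁ ∪ A₂ = insert b A' ∧ ¬ Good A' Q) ∨
      (∃ A' Q b, Gen A' Q ∧ Le Q P ∧ P.dim = Q.dim + 2 ∧ b ∈ P.cells ∧ b ∉ A' ∧
        A₁ ∪ A₂ = insert b A' ∧ Good A' Q ∧ ∃ x ∈ A', ∃ l, P l = none ∧ x l = b l) := by
    intro A₁ P₁ A₂ P₂ g1 g2 g3 g5 g6 hbad h1 h2
    obtain ⟨b, rfl, rfl⟩ := g2.eq_pt_of_dim_eq_zero h2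
    have hins : A₁ ∪ {b} = insert b A₁ := by rw [Finset.union_comm, ← Finset.insert_eq]
    rw [hins] at hbad ⊢
    have hbA := Finset.disjoint_singleton_right.1 g3
    by_cases hgood : Good A₁ P₁
    · right
      refine ⟨A₁, P₁, b, g1, g5, h1.symm, pt_le.1 g6, hbA, rfl, hgood, ?_⟩
      by_contra hcon
      push Not at hcon
      exact hbad (Good.add hgood g5 h1.symm (pt_le.1 g6) hcon)
    · left
      exact ⟨A₁, P₁, b, g1, g5, h1.symm, pt_le.1 g6, hbA, rfl, hgood⟩
  by_cases h1 : P₁.dim + 2 = P.dim ∧ P₂.dim = 0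
  · exact Or.inr (key A₁ P₁ A₂ P₂ g1 g2 g3 g5 g6 hbad h1.1 h1.2)
  by_cases h2 : P₂.dim + 2 = P.dim ∧ P₁.dim = 0
  · have := key A₂ P₂ A₁ P₁ g2 g1 g3.symm g6 g5 (by rwa [Finset.union_comm]) h2.1 h2.2
    rw [Finset.union_comm A₂ A₁] at this
    exact Or.inr this
  · exact Or.inl ⟨A₁, P₁, A₂, P₂, g1, g2, g3, rfl, g5, g6, g7, g8, g9, h1, h2⟩

open scoped Classical in
/-- The sets of points generating `P`. -/
noncomputable def gens (P : Pat d n) : Finset (Finset (Fin d → Fin n)) :=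
  Finset.univ.filter fun A => Gen A P

lemma mem_gens {P : Pat d n} {A : Finset (Fin d → Fin n)} : A ∈ gens P ↔ Gen A P := by simp [gens]

open scoped Classical in
/-- The sets generating `P` that are not good. -/
noncomputable def bads (P : Pat d n) : Finset (Finset (Fin d → Fin n)) :=
  Finset.univ.filter fun A => Gen A P ∧ ¬ Good A P

lemma mem_bads {P : Pat d n} {A : Finset (Fin d → Fin n)} :
    A ∈ bads P ↔ Gen A P ∧ ¬ Good A P := by simp [bads]

open scoped Classical in
/-- The good sets for `P`. -/
noncomputable def goods (P : Pat d n) : Finset (Finset (Fin d → Fin n)) :=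
  Finset.univ.filter fun A => Good A P

lemma mem_goods {P : Pat d n} {A : Finset (Fin d → Fin n)} : A ∈ goods P ↔ Good A P := by
  simp [goods]

/-- The total weight of a family of sets of points. -/
def weight (p : ℝ) (𝓐 : Finset (Finset (Fin d → Fin n))) : ℝ := ∑ A ∈ 𝓐, p ^ A.card

lemma weight_nonneg {p : ℝ} (hp : 0 ≤ p) (𝓐 : Finset (Finset (Fin d → Fin n))) :
    0 ≤ weight p 𝓐 := Finset.sum_nonneg fun _ _ => pow_nonneg hp _

lemma weight_le_sum_pairs {p : ℝ} (hp : 0 ≤ p) {𝓐 : Finset (Finset (Fin d → Fin n))}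
    (R : Finset (Pat d n × Pat d n))
    (h : ∀ A ∈ 𝓐, ∃ A₁ P₁ A₂ P₂, Gen A₁ P₁ ∧ Gen A₂ P₂ ∧ Disjoint A₁ A₂ ∧ A = A₁ ∪ A₂ ∧
      (P₁, P₂) ∈ R) :
    weight p 𝓐 ≤ ∑ q ∈ R, weight p (gens q.1) * weight p (gens q.2) := by
  classical
  have h1 : ∀ q : Pat d n × Pat d n, weight p (gens q.1) * weight p (gens q.2) =
      ∑ z ∈ gens q.1 ×ˢ gens q.2, p ^ (z.1.card + z.2.card) := by
    intro q
    rw [weight, weight, Finset.sum_mul_sum, Finset.sum_product]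
    simp only [pow_add]
  simp only [h1]
  rw [← Finset.sum_sigma R (fun q => gens q.1 ×ˢ gens q.2)
    (fun z : (_ : Pat d n × Pat d n) × (Finset (Fin d → Fin n) × Finset (Fin d → Fin n)) =>
      p ^ (z.2.1.card + z.2.2.card))]
  refine sum_le_sum_of_forall_exists (fun z => z.2.1 ∪ z.2.2) (fun _ _ => pow_nonneg hp _) ?_
  intro A hA
  obtain ⟨A₁, P₁, A₂, P₂, g1, g2, g3, g4, g5⟩ := h A hA
  refine ⟨⟨(P₁, P₂), (A₁, A₂)⟩, ?_, g4.symm, ?_⟩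
  · rw [Finset.mem_sigma, Finset.mem_product]
    exact ⟨g5, mem_gens.2 g1, mem_gens.2 g2⟩
  · rw [g4, Finset.card_union_of_disjoint g3]

lemma weight_le_sum_insert {p : ℝ} (hp : 0 ≤ p) {𝓐 : Finset (Finset (Fin d → Fin n))}
    (R : Finset (Pat d n)) (𝓑 : Pat d n → Finset (Finset (Fin d → Fin n)))
    (T : Finset (Fin d → Fin n) → Finset (Fin d → Fin n)) (m : ℕ)
    (hT : ∀ Q ∈ R, ∀ A ∈ 𝓑 Q, (T A).card ≤ m)
    (h : ∀ A ∈ 𝓐, ∃ A' Q b, Q ∈ R ∧ A' ∈ 𝓑 Q ∧ b ∈ T A' ∧ b ∉ A' ∧ A = insert b A') :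
    weight p 𝓐 ≤ ∑ Q ∈ R, weight p (𝓑 Q) * (p * m) := by
  classical
  calc weight p 𝓐 ≤ ∑ z ∈ R.sigma fun Q => (𝓑 Q).sigma fun A => T A, p ^ (z.2.1.card + 1) := by
        refine sum_le_sum_of_forall_exists (fun z => insert z.2.2 z.2.1)
          (fun _ _ => pow_nonneg hp _) ?_
        intro A hA
        obtain ⟨A', Q, b, h1, h2, h3, h4, h5⟩ := h A hA
        refine ⟨⟨Q, ⟨A', b⟩⟩, ?_, h5.symm, ?_⟩
        · rw [Finset.mem_sigma, Finset.mem_sigma]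
          exact ⟨h1, h2, h3⟩
        · rw [h5, Finset.card_insert_of_notMem h4]
    _ = ∑ Q ∈ R, ∑ A ∈ 𝓑 Q, (T A).card * p ^ (A.card + 1) := by
        rw [Finset.sum_sigma]
        refine Finset.sum_congr rfl fun Q _ => ?_
        rw [Finset.sum_sigma]
        refine Finset.sum_congr rfl fun A _ => ?_
        exact (Finset.sum_const (p ^ (A.card + 1))).trans (nsmul_eq_mul _ _)
    _ ≤ ∑ Q ∈ R, weight p (𝓑 Q) * (p * m) := by
        refine Finset.sum_le_sum fun Q hQ => ?_
        rw [weight, Finset.sum_mul]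
        refine Finset.sum_le_sum fun A hA => ?_
        have : ((T A).card : ℝ) ≤ m := by exact_mod_cast hT Q hQ A hA
        calc ((T A).card : ℝ) * p ^ (A.card + 1) ≤ m * p ^ (A.card + 1) :=
              mul_le_mul_of_nonneg_right this (pow_nonneg hp _)
          _ = _ := by ring

/-- A summand of order n ^ dim Q offsets the number of subtori Q of each dimension, so every
dimension contributes the same order n ^ dim P. -/
lemma sum_subs_le {P : Pat d n} {R : Finset (Pat d n)} (hR : R ⊆ P.subs) {F : Pat d n → ℝ} {K : ℝ}
    (hK : 0 ≤ K) (hF : ∀ Q ∈ R, F Q ≤ K * (n : ℝ) ^ Q.dim) :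
    ∑ Q ∈ R, F Q ≤ K * (2 * n) ^ P.dim := by
  calc ∑ Q ∈ R, F Q ≤ ∑ Q ∈ R, K * (n : ℝ) ^ Q.dim := Finset.sum_le_sum hF
    _ ≤ ∑ Q ∈ P.subs, K * (n : ℝ) ^ Q.dim :=
        Finset.sum_le_sum_of_subset_of_nonneg hR fun _ _ _ => by positivity
    _ = K * (2 * n) ^ P.dim := by
        rw [← Finset.mul_sum, Pat.sum_subs_pow_dim, two_mul]

lemma sum_pairs_le {P : Pat d n} {R : Finset (Pat d n × Pat d n)} (hR : R ⊆ P.subs ×ˢ P.subs)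
    {F : Pat d n × Pat d n → ℝ} {K : ℝ} (hK : 0 ≤ K)
    (hF : ∀ q ∈ R, F q ≤ K * ((n : ℝ) ^ q.1.dim * (n : ℝ) ^ q.2.dim)) :
    ∑ q ∈ R, F q ≤ K * ((2 * n) ^ P.dim * (2 * n) ^ P.dim) := by
  calc ∑ q ∈ R, F q ≤ ∑ q ∈ R, K * ((n : ℝ) ^ q.1.dim * (n : ℝ) ^ q.2.dim) := Finset.sum_le_sum hF
    _ ≤ ∑ q ∈ P.subs ×ˢ P.subs, K * ((n : ℝ) ^ q.1.dim * (n : ℝ) ^ q.2.dim) :=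
        Finset.sum_le_sum_of_subset_of_nonneg hR fun _ _ _ => by positivity
    _ = K * ((2 * n) ^ P.dim * (2 * n) ^ P.dim) := by
        rw [← Finset.mul_sum, Finset.sum_product]
        simp only [← Finset.mul_sum]
        rw [← Finset.sum_mul, Pat.sum_subs_pow_dim, two_mul]

end Weights

/-! ### Power bounds for the weights of generating and bad sets. -/

section WeightBounds

variable {d : ℕ}

/-- The pairs of patterns that can merge to `P`. -/
def mergePairs {n : ℕ} (P : Pat d n) : Finset (Pat d n × Pat d n) :=
  (P.subs ×ˢ P.subs).filter fun q =>
    q.1.dim < P.dim ∧ q.2.dim < P.dim ∧ P.dim ≤ q.1.dim + q.2.dim + 2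

lemma two_mul_pow_mul_two_mul_pow {n : ℕ} (hn : 1 ≤ n) (k : ℕ) :
    ((2 * (n : ℝ)) ^ k * (2 * n) ^ k) = 4 ^ k * (n : ℝ) ^ (2 * (k : ℝ)) := by
  have hn0 : (0 : ℝ) < n := by exact_mod_cast hn
  rw [two_mul (k : ℝ), Real.rpow_add hn0, Real.rpow_natCast, ← mul_pow, ← mul_pow, ← mul_pow]
  congr 1; ring

/-- The exponent bound for a sum over pairs of merging patterns. -/
lemma sum_weight_pairs_le {n : ℕ} (hn : 1 ≤ n) {γ p C e : ℝ} (hp : 0 ≤ p) (hC : 0 ≤ C)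
    {P : Pat d n} {R : Finset (Pat d n × Pat d n)} (hR : R ⊆ P.subs ×ˢ P.subs)
    (hw : ∀ q ∈ R, weight p (gens q.1) ≤ C * (n : ℝ) ^ (expo γ q.1.dim + q.1.dim) ∧
      weight p (gens q.2) ≤ C * (n : ℝ) ^ (expo γ q.2.dim + q.2.dim))
    (he : ∀ q ∈ R, expo γ q.1.dim + expo γ q.2.dim + P.dim ≤ e) :
    ∑ q ∈ R, weight p (gens q.1) * weight p (gens q.2) ≤
      C ^ 2 * 4 ^ P.dim * (n : ℝ) ^ (e + P.dim) := by
  have hn0 : (0 : ℝ) < n := by exact_mod_cast hn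
  have hn1 : (1 : ℝ) ≤ n := by exact_mod_cast hn
  refine (sum_pairs_le hR (K := C ^ 2 * (n : ℝ) ^ (e - P.dim)) (by positivity) ?_).trans ?_
  · intro q hq
    calc weight p (gens q.1) * weight p (gens q.2)
        ≤ (C * (n : ℝ) ^ (expo γ q.1.dim + q.1.dim)) *
          (C * (n : ℝ) ^ (expo γ q.2.dim + q.2.dim)) :=
          mul_le_mul (hw q hq).1 (hw q hq).2 (weight_nonneg hp _) (by positivity)
      _ = C ^ 2 * (n : ℝ) ^ (expo γ q.1.dim + expo γ q.2.dim) *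
          ((n : ℝ) ^ q.1.dim * (n : ℝ) ^ q.2.dim) := by
          rw [Real.rpow_add hn0, Real.rpow_add hn0, Real.rpow_add hn0, Real.rpow_natCast,
            Real.rpow_natCast]
          ring
      _ ≤ _ := by
          have := he q hq
          refine mul_le_mul_of_nonneg_right (mul_le_mul_of_nonneg_left
            (Real.rpow_le_rpow_of_exponent_le hn1 (by linarith)) (by positivity)) (by positivity)
  · rw [two_mul_pow_mul_two_mul_pow hn]
    refine le_of_eq ?_
    rw [show e + (P.dim : ℝ) = (e - P.dim) + 2 * P.dim by ring, Real.rpow_add hn0]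
    ring

/-- Induction on the dimension: dimension 0 costs one open point, and a positive dimension is split
at its last merger into two smaller dimensions, whose exponents combine by `expo_add_le`. -/
lemma exists_weight_gens_le (d : ℕ) {j : ℕ} {γ a δ : ℝ} (ha : 0 ≤ a) (hδ0 : 0 ≤ δ)
    (hγ : 2 * (j : ℝ) + δ ≤ γ) (k : ℕ) (hk : k ≤ 2 * j) :
    ∃ C, 0 ≤ C ∧ ∀ n : ℕ, 1 ≤ n → ∀ p : ℝ, 0 ≤ p → p ≤ a * (n : ℝ) ^ (-γ) →
      ∀ P : Pat d n, P.dim ≤ k → weight p (gens P) ≤ C * (n : ℝ) ^ (expo γ P.dim + P.dim) := by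
  induction k with
  | zero =>
    refine ⟨a, ha, fun n hn p hp hpa P hP => ?_⟩
    have hP0 : P.dim = 0 := by omega
    have hsub : weight p (gens P) ≤ p := by
      have : ∀ A ∈ gens P, A.card = 1 ∧ A = P.points := by
        intro A hA
        obtain ⟨x, rfl, rfl⟩ := (mem_gens.1 hA).eq_pt_of_dim_eq_zero hP0
        refine ⟨Finset.card_singleton x, ?_⟩
        ext v
        rw [mem_points, mem_cells_pt, Finset.mem_singleton]
      rw [weight, Finset.sum_congr rfl fun A hA => by rw [(this A hA).1, pow_one],
        Finset.sum_const, nsmul_eq_mul]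
      refine mul_le_of_le_one_left hp ?_
      have hc : (gens P).card ≤ 1 := Finset.card_le_one.2 fun A hA B hB =>
        (this A hA).2.trans (this B hB).2.symm
      exact_mod_cast hc
    rw [hP0, expo_zero, Nat.cast_zero, add_zero]
    exact hsub.trans hpa
  | succ k ih =>
    obtain ⟨C, hC, hbound⟩ := ih (by omega)
    refine ⟨max C (C ^ 2 * 4 ^ (k + 1)), le_max_of_le_left hC, fun n hn p hp hpa P hP => ?_⟩
    have hn0 : (0 : ℝ) < n := by exact_mod_cast hn
    rcases Nat.lt_or_ge P.dim (k + 1) with hlt | hge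
    · refine (hbound n hn p hp hpa P (by omega)).trans ?_
      gcongr
      exact le_max_left _ _
    · have hPk : P.dim = k + 1 := le_antisymm hP hge
      refine (weight_le_sum_pairs hp (mergePairs P) ?_).trans ?_
      · intro A hA
        obtain ⟨A₁, P₁, A₂, P₂, g1, g2, g3, g4, g5, g6, g7⟩ :=
          (mem_gens.1 hA).exists_of_dim_pos (by omega)
        refine ⟨A₁, P₁, A₂, P₂, g1, g2, g3, g4, ?_⟩
        rw [mergePairs, Finset.mem_filter, Finset.mem_product, mem_subs, mem_subs]
        exact ⟨⟨g5, g6⟩, g7⟩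
      · refine (sum_weight_pairs_le hn (γ := γ) (e := expo γ P.dim) hp hC
          (Finset.filter_subset _ _) ?_ ?_).trans ?_
        · intro q hq
          have := (Finset.mem_filter.1 hq).2
          exact ⟨hbound n hn p hp hpa q.1 (by omega), hbound n hn p hp hpa q.2 (by omega)⟩
        · intro q hq
          have := (Finset.mem_filter.1 hq).2
          exact expo_add_le hδ0 hγ this.1 this.2.1 this.2.2 (by omega)
        · rw [hPk]
          gcongr
          exact le_max_right _ _

lemma weight_le_of_cases {n : ℕ} {p : ℝ} (hp : 0 ≤ p) {𝓐 𝓐₁ 𝓐₂ 𝓐₃ : Finset (Finset (Fin d → Fin n))}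
    (h : 𝓐 ⊆ 𝓐₁ ∪ (𝓐₂ ∪ 𝓐₃)) : weight p 𝓐 ≤ weight p 𝓐₁ + (weight p 𝓐₂ + weight p 𝓐₃) := by
  have hu : ∀ 𝓑 𝓒 : Finset (Finset (Fin d → Fin n)),
      weight p (𝓑 ∪ 𝓒) ≤ weight p 𝓑 + weight p 𝓒 := by
    intro 𝓑 𝓒
    unfold weight
    rw [← Finset.sum_union_inter]
    exact le_add_of_nonneg_right (Finset.sum_nonneg fun _ _ => pow_nonneg hp _)
  calc weight p 𝓐 ≤ weight p (𝓐₁ ∪ (𝓐₂ ∪ 𝓐₃)) :=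
        Finset.sum_le_sum_of_subset_of_nonneg h fun _ _ _ => pow_nonneg hp _
    _ ≤ weight p 𝓐₁ + weight p (𝓐₂ ∪ 𝓐₃) := hu _ _
    _ ≤ _ := by linarith [hu 𝓐₂ 𝓐₃]

lemma expo_two_mul_succ (γ : ℝ) (c : ℕ) :
    expo γ (2 * (c + 1)) = expo γ (2 * c) + (2 * c + 2 - γ) := by
  rw [expo_two_mul, expo_two_mul]; push_cast; ring

/-- Induction on c, following `Gen.not_good_cases`; each kind of failure carries the extra factor n
^ (-δ). -/
lemma exists_weight_bads_le (d : ℕ) {j : ℕ} {γ a δ : ℝ} (ha : 0 ≤ a) (hδ0 : 0 ≤ δ) (hδ1 : δ ≤ 1)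
    (hγ : 2 * (j : ℝ) + δ ≤ γ) (c : ℕ) (hc : c ≤ j) :
    ∃ C, 0 ≤ C ∧ ∀ n : ℕ, 1 ≤ n → ∀ p : ℝ, 0 ≤ p → p ≤ a * (n : ℝ) ^ (-γ) →
      ∀ P : Pat d n, P.dim = 2 * c →
        weight p (bads P) ≤ C * (n : ℝ) ^ (expo γ P.dim + P.dim - δ) := by
  classical
  obtain ⟨C₀, hC₀, hw⟩ := exists_weight_gens_le d ha hδ0 hγ (2 * j) le_rfl
  induction c with
  | zero =>
    refine ⟨0, le_rfl, fun n hn p hp hpa P hP => ?_⟩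
    have : bads P = ∅ := by
      rw [Finset.eq_empty_iff_forall_notMem]
      intro A hA
      obtain ⟨h1, h2⟩ := mem_bads.1 hA
      obtain ⟨x, rfl, rfl⟩ := h1.eq_pt_of_dim_eq_zero (by omega)
      exact h2 (Good.single x)
    simp [this, weight]
  | succ c ih =>
    obtain ⟨C, hC, hbad⟩ := ih (by omega)
    refine ⟨C₀ ^ 2 * 4 ^ (2 * (c + 1)) + (C * a * 2 ^ (2 * (c + 1)) +
      C₀ * a * ((c + 1) * (2 * (c + 1))) * 2 ^ (2 * (c + 1))), by positivity,
      fun n hn p hp hpa P hP => ?_⟩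
    have hn0 : (0 : ℝ) < n := by exact_mod_cast hn
    have hn1 : (1 : ℝ) ≤ n := by exact_mod_cast hn
    set E : ℝ := (n : ℝ) ^ (expo γ P.dim + P.dim - δ) with hE
    set R : Finset (Pat d n) := P.subs.filter fun Q => P.dim = Q.dim + 2 with hRdef
    have hRdim : ∀ Q ∈ R, Q.dim = 2 * c := by
      intro Q hQ
      have := (Finset.mem_filter.1 hQ).2
      omega
    set S₁ := (bads P).filter fun A => ∃ A₁ P₁ A₂ P₂, Gen A₁ P₁ ∧ Gen A₂ P₂ ∧ Disjoint A₁ A₂ ∧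
      A = A₁ ∪ A₂ ∧ Le P₁ P ∧ Le P₂ P ∧ P₁.dim < P.dim ∧ P₂.dim < P.dim ∧
      P.dim ≤ P₁.dim + P₂.dim + 2 ∧
      ¬ (P₁.dim + 2 = P.dim ∧ P₂.dim = 0) ∧ ¬ (P₂.dim + 2 = P.dim ∧ P₁.dim = 0) with hS₁
    set S₂ := (bads P).filter fun A => ∃ A' Q b, Gen A' Q ∧ Le Q P ∧ P.dim = Q.dim + 2 ∧
      b ∈ P.cells ∧ b ∉ A' ∧ A = insert b A' ∧ ¬ Good A' Q with hS₂
    set S₃ := (bads P).filter fun A => ∃ A' Q b, Gen A' Q ∧ Le Q P ∧ P.dim = Q.dim + 2 ∧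
      b ∈ P.cells ∧ b ∉ A' ∧ A = insert b A' ∧ Good A' Q ∧
      ∃ x ∈ A', ∃ l, P l = none ∧ x l = b l with hS₃
    have hcover : bads P ⊆ S₁ ∪ (S₂ ∪ S₃) := by
      intro A hA
      rw [Finset.mem_union, Finset.mem_union, hS₁, hS₂, hS₃, Finset.mem_filter, Finset.mem_filter,
        Finset.mem_filter]
      rcases (mem_bads.1 hA).1.not_good_cases (by omega) (mem_bads.1 hA).2 with h | h | h
      · exact Or.inl ⟨hA, h⟩
      · exact Or.inr (Or.inl ⟨hA, h⟩)
      · exact Or.inr (Or.inr ⟨hA, h⟩)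
    -- The last merger is not of the dominant type, so `expo_add_le_sub` supplies the gain.
    have b₁ : weight p S₁ ≤ C₀ ^ 2 * 4 ^ (2 * (c + 1)) * E := by
      refine (weight_le_sum_pairs hp ((mergePairs P).filter fun q =>
        ¬ (q.1.dim + 2 = P.dim ∧ q.2.dim = 0) ∧ ¬ (q.2.dim + 2 = P.dim ∧ q.1.dim = 0)) ?_).trans ?_
      · intro A hA
        obtain ⟨A₁, P₁, A₂, P₂, g1, g2, g3, g4, g5, g6, g7, g8, g9, g10⟩ :=
          (Finset.mem_filter.1 hA).2
        refine ⟨A₁, P₁, A₂, P₂, g1, g2, g3, g4, ?_⟩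
        rw [mergePairs, Finset.mem_filter, Finset.mem_filter, Finset.mem_product, mem_subs,
          mem_subs]
        exact ⟨⟨⟨g5, g6⟩, g7, g8, g9⟩, g10⟩
      · refine (sum_weight_pairs_le hn (γ := γ) (e := expo γ P.dim - δ) (P := P) hp hC₀
          ((Finset.filter_subset _ _).trans (Finset.filter_subset _ _)) ?_ ?_).trans ?_
        · intro q hq
          have := (Finset.mem_filter.1 (Finset.mem_filter.1 hq).1).2
          exact ⟨hw n hn p hp hpa q.1 (by omega), hw n hn p hp hpa q.2 (by omega)⟩
        · intro q hq
          have h1 := (Finset.mem_filter.1 (Finset.mem_filter.1 hq).1).2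
          have h2 := (Finset.mem_filter.1 hq).2
          exact expo_add_le_sub hδ0 hδ1 hγ h1.1 h1.2.1 h1.2.2 (by omega) (by omega) h2.1 h2.2
        · refine le_of_eq ?_
          rw [hE, hP, show expo γ (2 * (c + 1)) - δ + ((2 * (c + 1) : ℕ) : ℝ) =
            expo γ (2 * (c + 1)) + ((2 * (c + 1) : ℕ) : ℝ) - δ by ring]
    have hEexp : ∀ y : ℝ, y = expo γ (2 * c) - δ + -γ + 2 * (2 * c + 2) → (n : ℝ) ^ y = E := by
      intro y hy
      rw [hE, hP, hy, expo_two_mul_succ]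
      congr 1; push_cast; ring
    have h2n : (2 * (n : ℝ)) ^ (2 * (c + 1)) = 2 ^ (2 * (c + 1)) * (n : ℝ) ^ (2 * (c : ℝ) + 2) := by
      rw [mul_pow, ← Real.rpow_natCast (n : ℝ)]; push_cast; ring_nf
    -- The gain is inherited from the bad set spanning Q; the last point is an arbitrary point of P.
    have b₂ : weight p S₂ ≤ C * a * 2 ^ (2 * (c + 1)) * E := by
      refine (weight_le_sum_insert hp R bads (fun _ => P.points) (n ^ P.dim)
        (fun _ _ _ _ => P.card_points.le) ?_).trans ?_
      · intro A hA
        obtain ⟨A', Q, b, g1, g2, g3, g4, g5, g6, g7⟩ := (Finset.mem_filter.1 hA).2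
        exact ⟨A', Q, b, Finset.mem_filter.2 ⟨mem_subs.2 g2, g3⟩, mem_bads.2 ⟨g1, g7⟩,
          mem_points.2 g4, g5, g6⟩
      · refine (sum_subs_le (P := P) (Finset.filter_subset _ _)
          (K := C * a * (n : ℝ) ^ (expo γ (2 * c) - δ + -γ + (2 * c + 2))) (by positivity)
          ?_).trans ?_
        · intro Q hQ
          have hQd := hRdim Q hQ
          calc weight p (bads Q) * (p * (n ^ P.dim : ℕ))
              ≤ (C * (n : ℝ) ^ (expo γ Q.dim + Q.dim - δ)) *
                ((a * (n : ℝ) ^ (-γ)) * (n ^ P.dim : ℕ)) := by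
                refine mul_le_mul (hbad n hn p hp hpa Q hQd) ?_ (by positivity) (by positivity)
                gcongr
            _ = _ := by
                rw [hQd, hP, show expo γ (2 * c) + ((2 * c : ℕ) : ℝ) - δ =
                  (expo γ (2 * c) - δ) + ((2 * c : ℕ) : ℝ) by ring, Real.rpow_add hn0,
                  Real.rpow_natCast, Real.rpow_add hn0 _ (2 * (c : ℝ) + 2), Real.rpow_add hn0 _ (-γ),
                  show 2 * (c : ℝ) + 2 = ((2 * (c + 1) : ℕ) : ℝ) by push_cast; ring,
                  Real.rpow_natCast]
                push_cast; ring
        · rw [hP, h2n, ← hEexp _ rfl,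
            show expo γ (2 * c) - δ + -γ + 2 * (2 * (c : ℝ) + 2) =
              (expo γ (2 * c) - δ + -γ + (2 * c + 2)) + (2 * c + 2) by ring,
            Real.rpow_add hn0 (expo γ (2 * c) - δ + -γ + (2 * c + 2))]
          refine le_of_eq ?_
          ring
    -- The c + 1 earlier points and 2(c + 1) free coordinates leave at most (c + 1) · 2(c + 1) · n ^
    -- (2c + 1) positions for a coinciding point: a factor n is lost, at least n ^ δ because δ ≤ 1.
    have b₃ : weight p S₃ ≤ C₀ * a * ((c + 1) * (2 * (c + 1))) * 2 ^ (2 * (c + 1)) * E := by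
      refine (weight_le_sum_insert hp R goods
        (fun A => P.points.filter fun b => ∃ x ∈ A, ∃ l, P l = none ∧ x l = b l)
        ((c + 1) * (2 * (c + 1)) * n ^ (2 * c + 1)) ?_ ?_).trans ?_
      · intro Q hQ A hA
        have h1 := (mem_goods.1 hA).dim_add_two
        rw [hRdim Q hQ] at h1
        have h2 : A.card = c + 1 := by omega
        refine (card_points_filter_exists_le A).trans ?_
        rw [h2, hP]
        rfl
      · intro A hA
        obtain ⟨A', Q, b, g1, g2, g3, g4, g5, g6, g7, g8⟩ := (Finset.mem_filter.1 hA).2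
        exact ⟨A', Q, b, Finset.mem_filter.2 ⟨mem_subs.2 g2, g3⟩, mem_goods.2 g7,
          Finset.mem_filter.2 ⟨mem_points.2 g4, g8⟩, g5, g6⟩
      · refine (sum_subs_le (P := P) (Finset.filter_subset _ _)
          (K := C₀ * a * ((c + 1) * (2 * (c + 1))) *
            (n : ℝ) ^ (expo γ (2 * c) - δ + -γ + (2 * c + 2))) (by positivity)
          ?_).trans ?_
        · intro Q hQ
          have hQd := hRdim Q hQ
          have hg : weight p (goods Q) ≤ C₀ * (n : ℝ) ^ (expo γ Q.dim + Q.dim) := by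
            refine le_trans ?_ (hw n hn p hp hpa Q (by omega))
            exact Finset.sum_le_sum_of_subset_of_nonneg
              (fun A hA => mem_gens.2 (mem_goods.1 hA).gen) fun _ _ _ => pow_nonneg hp _
          calc weight p (goods Q) * (p * ((c + 1) * (2 * (c + 1)) * n ^ (2 * c + 1) : ℕ))
              ≤ (C₀ * (n : ℝ) ^ (expo γ Q.dim + Q.dim)) *
                ((a * (n : ℝ) ^ (-γ)) * ((c + 1) * (2 * (c + 1)) * n ^ (2 * c + 1) : ℕ)) := by
                refine mul_le_mul hg ?_ (by positivity) (by positivity)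
                gcongr
            _ = C₀ * a * ((c + 1) * (2 * (c + 1))) *
                (n : ℝ) ^ (expo γ (2 * c) + -γ + (2 * c + 1)) * (n : ℝ) ^ Q.dim := by
                rw [hQd, Real.rpow_add hn0, Real.rpow_natCast,
                  Real.rpow_add hn0 _ (2 * (c : ℝ) + 1), Real.rpow_add hn0 _ (-γ),
                  show 2 * (c : ℝ) + 1 = ((2 * c + 1 : ℕ) : ℝ) by push_cast; ring,
                  Real.rpow_natCast]
                push_cast; ring
            _ ≤ _ := by
                refine mul_le_mul_of_nonneg_right (mul_le_mul_of_nonneg_left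
                  (Real.rpow_le_rpow_of_exponent_le hn1 (by linarith)) (by positivity))
                  (by positivity)
        · rw [hP, h2n, ← hEexp _ rfl,
            show expo γ (2 * c) - δ + -γ + 2 * (2 * (c : ℝ) + 2) =
              (expo γ (2 * c) - δ + -γ + (2 * c + 2)) + (2 * c + 2) by ring,
            Real.rpow_add hn0 (expo γ (2 * c) - δ + -γ + (2 * c + 2))]
          refine le_of_eq ?_
          ring
    refine (weight_le_of_cases hp hcover).trans ?_
    calc weight p S₁ + (weight p S₂ + weight p S₃) ≤ _ := add_le_add b₁ (add_le_add b₂ b₃)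
      _ = _ := by ring

end WeightBounds

end HammingBootstrap

namespace HammingBootstrap

open Pat

/-! ### Counting good sets. -/

section GoodCount

variable {d n : ℕ}

lemma card_mul_le_sum_nat {α : Type*} {s : Finset α} {f : α → ℕ} {k : ℕ} (h : ∀ x ∈ s, k ≤ f x) :
    s.card * k ≤ ∑ x ∈ s, f x := by
  simpa using Finset.card_nsmul_le_sum s f k h

lemma sum_le_card_mul_nat {α : Type*} {s : Finset α} {f : α → ℕ} {k : ℕ} (h : ∀ x ∈ s, f x ≤ k) :
    ∑ x ∈ s, f x ≤ s.card * k := by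
  simpa using Finset.sum_le_card_nsmul s f k h

lemma Good.exists_insert {A : Finset (Fin d → Fin n)} {P : Pat d n} (h : Good A P)
    (hP : 0 < P.dim) : ∃ A' Q b, Good A' Q ∧ Le Q P ∧ P.dim = Q.dim + 2 ∧ b ∈ P.cells ∧
      (∀ x ∈ A', ∀ l, P l = none → x l ≠ b l) ∧ A = insert b A' := by
  cases h with
  | single x => rw [dim_pt] at hP; omega
  | @add A' _ Q b g1 g2 g3 g4 g5 => exact ⟨A', Q, b, g1, g2, g3, g4, g5, rfl⟩

/-- The points of `P` that can be added to `A` in a good way. -/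
noncomputable def nextPoints (P : Pat d n) (A : Finset (Fin d → Fin n)) :
    Finset (Fin d → Fin n) :=
  P.points.filter fun b => ∀ x ∈ A, ∀ l, P l = none → x l ≠ b l

lemma card_nextPoints_le (P : Pat d n) (A : Finset (Fin d → Fin n)) :
    (nextPoints P A).card ≤ n ^ P.dim :=
  (Finset.card_le_card (Finset.filter_subset _ _)).trans P.card_points.le

lemma le_card_nextPoints (P : Pat d n) (A : Finset (Fin d → Fin n)) :
    (n - A.card) ^ P.dim ≤ (nextPoints P A).card :=
  le_card_points_filter_generic A

lemma mem_nextPoints {P : Pat d n} {A : Finset (Fin d → Fin n)} {b : Fin d → Fin n} :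
    b ∈ nextPoints P A ↔ b ∈ P.cells ∧ ∀ x ∈ A, ∀ l, P l = none → x l ≠ b l := by
  rw [nextPoints, Finset.mem_filter, mem_points]

/-- Pairs of points of `P` without a common free coordinate. -/
noncomputable def genericPairs (P : Pat d n) : Finset ((Fin d → Fin n) × (Fin d → Fin n)) :=
  (P.points ×ˢ P.points).filter fun q => ∀ l, P l = none → q.1 l ≠ q.2 l

lemma card_genericPairs_eq (P : Pat d n) :
    (genericPairs P).card = ∑ x ∈ P.points, (nextPoints P {x}).card := by
  classical
  rw [genericPairs, Finset.card_filter, Finset.sum_product]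
  refine Finset.sum_congr rfl fun x _ => ?_
  rw [nextPoints, Finset.card_filter]
  simp

lemma mem_genericPairs {P : Pat d n} {x y : Fin d → Fin n} :
    (x, y) ∈ genericPairs P ↔ x ∈ P.cells ∧ y ∈ P.cells ∧ ∀ l, P l = none → x l ≠ y l := by
  simp [genericPairs, mem_points, and_assoc]

lemma good_iff_of_dim_eq_two {P : Pat d n} (hP : P.dim = 2) {A : Finset (Fin d → Fin n)} :
    Good A P ↔ ∃ q ∈ genericPairs P, ({q.2, q.1} : Finset (Fin d → Fin n)) = A := by
  constructor
  · intro h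
    obtain ⟨A', Q, b, g1, g2, g3, g4, g5, rfl⟩ := h.exists_insert (by omega)
    obtain ⟨x, rfl, rfl⟩ := g1.gen.eq_pt_of_dim_eq_zero (by omega)
    exact ⟨(x, b), mem_genericPairs.2 ⟨pt_le.1 g2, g4, g5 x (Finset.mem_singleton_self x)⟩, rfl⟩
  · rintro ⟨⟨x, b⟩, hq, rfl⟩
    obtain ⟨h1, h2, h3⟩ := mem_genericPairs.1 hq
    refine Good.add (Good.single x) (pt_le.2 h1) (by rw [dim_pt, hP]) h2 fun y hy => ?_
    rw [Finset.mem_singleton] at hy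
    exact hy ▸ h3

lemma card_genericPairs {P : Pat d n} (hP : P.dim = 2) :
    (genericPairs P).card = 2 * (goods P).card := by
  classical
  have hmaps : ∀ q ∈ genericPairs P, ({q.2, q.1} : Finset (Fin d → Fin n)) ∈ goods P :=
    fun q hq => mem_goods.2 ((good_iff_of_dim_eq_two hP).2 ⟨q, hq, rfl⟩)
  rw [Finset.card_eq_sum_card_fiberwise hmaps, Finset.sum_congr rfl (g := fun _ => 2),
    Finset.sum_const, smul_eq_mul, mul_comm]
  intro A hA
  obtain ⟨⟨x, b⟩, hq, rfl⟩ := (good_iff_of_dim_eq_two hP).1 (mem_goods.1 hA)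
  obtain ⟨h1, h2, h3⟩ := mem_genericPairs.1 hq
  have hne : x ≠ b := by
    rintro rfl
    obtain ⟨l, hl⟩ := Finset.card_pos.1 (show 0 < P.free.card by rw [dim] at hP; omega)
    exact h3 l (mem_free.1 hl) rfl
  have : ((genericPairs P).filter fun q => ({q.2, q.1} : Finset (Fin d → Fin n)) = {b, x}) =
      {(x, b), (b, x)} := by
    ext ⟨y, z⟩
    simp only [Finset.mem_filter, Finset.mem_insert, Finset.mem_singleton, Prod.mk.injEq]
    constructor
    · rintro ⟨hyz, h⟩
      have hz : z = b ∨ z = x := by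
        have : z ∈ ({b, x} : Finset (Fin d → Fin n)) := h ▸ Finset.mem_insert_self _ _
        simpa using this
      have hy : y = b ∨ y = x := by
        have : y ∈ ({b, x} : Finset (Fin d → Fin n)) := h ▸ by simp
        simpa using this
      have hyz' : y ≠ z := by
        rintro rfl
        obtain ⟨l, hl⟩ := Finset.card_pos.1 (show 0 < P.free.card by rw [dim] at hP; omega)
        exact (mem_genericPairs.1 hyz).2.2 l (mem_free.1 hl) rfl
      rcases hz with rfl | rfl <;> rcases hy with rfl | rfl
      · exact absurd rfl hyz'
      · exact Or.inl ⟨rfl, rfl⟩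
      · exact Or.inr ⟨rfl, rfl⟩
      · exact absurd rfl hyz'
    · rintro (⟨rfl, rfl⟩ | ⟨rfl, rfl⟩)
      · exact ⟨hq, rfl⟩
      · exact ⟨mem_genericPairs.2 ⟨h2, h1, fun l hl => (h3 l hl).symm⟩, Finset.pair_comm _ _⟩
  rw [this, Finset.card_pair]
  intro h
  exact hne (Prod.mk.inj h).1

/-- The ways to obtain a good set for `P` by adding a last point. -/
noncomputable def extensions (P : Pat d n) :
    Finset ((_ : Pat d n) × (_ : Finset (Fin d → Fin n)) × (Fin d → Fin n)) :=
  (P.subs.filter fun Q => Q.dim = P.dim - 2).sigma fun Q => (goods Q).sigma fun A => nextPoints P A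

lemma mem_extensions {P Q : Pat d n} {A : Finset (Fin d → Fin n)} {b : Fin d → Fin n} :
    ⟨Q, ⟨A, b⟩⟩ ∈ extensions P ↔ (Le Q P ∧ Q.dim = P.dim - 2) ∧ Good A Q ∧ b ∈ P.cells ∧
      ∀ x ∈ A, ∀ l, P l = none → x l ≠ b l := by
  rw [extensions, Finset.mem_sigma, Finset.mem_sigma, Finset.mem_filter, mem_subs, mem_goods,
    mem_nextPoints]

lemma card_extensions (P : Pat d n) : (extensions P).card =
    ∑ Q ∈ P.subs.filter fun Q => Q.dim = P.dim - 2, ∑ A ∈ goods Q, (nextPoints P A).card := by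
  rw [extensions, Finset.card_sigma]
  exact Finset.sum_congr rfl fun Q _ => Finset.card_sigma _ _

lemma card_goods_le_extensions {P : Pat d n} (hP : 0 < P.dim) :
    (goods P).card ≤ (extensions P).card := by
  classical
  refine Finset.card_le_card_of_surjOn (fun z => insert z.2.2 z.2.1) ?_
  intro A hA
  obtain ⟨A', Q, b, g1, g2, g3, g4, g5, rfl⟩ := (mem_goods.1 hA).exists_insert hP
  exact ⟨⟨Q, ⟨A', b⟩⟩, mem_extensions.2 ⟨⟨g2, by omega⟩, g1, g4, g5⟩, rfl⟩

/-- If the dimension exceeds two, the last point of a good set is determined by the set. -/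
lemma card_extensions_le_goods (hn : 2 ≤ n) {P : Pat d n} (hP : 2 < P.dim) :
    (extensions P).card ≤ (goods P).card := by
  classical
  refine Finset.card_le_card_of_injOn (fun z => insert z.2.2 z.2.1) ?_ ?_
  · rintro ⟨Q, ⟨A, b⟩⟩ hz
    obtain ⟨⟨h1, h2⟩, h3, h4, h5⟩ := mem_extensions.1 hz
    exact mem_goods.2 (Good.add h3 h1 (by omega) h4 h5)
  · rintro ⟨Q, ⟨A, b⟩⟩ hz ⟨Q', ⟨A', b'⟩⟩ hz' heq
    obtain ⟨⟨h1, h2⟩, h3, h4, h5⟩ := mem_extensions.1 hz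
    obtain ⟨⟨h1', h2'⟩, h3', h4', h5'⟩ := mem_extensions.1 hz'
    have heq' : insert b A = insert b' A' := heq
    have hb := notMem_of_forall_ne (by omega) h5
    have hb' := notMem_of_forall_ne (by omega) h5'
    have hbb : b = b' := by
      by_contra hne
      have hb'A : b' ∈ A := by
        have : b' ∈ insert b A := heq' ▸ Finset.mem_insert_self _ _
        exact (Finset.mem_insert.1 this).resolve_left (Ne.symm hne)
      have hcard : 1 < A.card := by have := h3.dim_add_two; omega
      obtain ⟨x, hxA, hxb'⟩ := Finset.exists_mem_ne hcard b'
      have hxA' : x ∈ A' := by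
        have : x ∈ insert b' A' := heq' ▸ Finset.mem_insert_of_mem hxA
        exact (Finset.mem_insert.1 this).resolve_left hxb'
      have hlt : Q.free.card < P.free.card := by
        change Q.dim < P.dim
        omega
      -- Coordinate l is free in P but prescribed in Q, so x and b' agree there because both lie in
      -- Q. This contradicts that b' was added generically to a set containing x.
      obtain ⟨l, hlP, hlQ⟩ := Finset.exists_mem_notMem_of_card_lt_card hlt
      rw [mem_free] at hlP hlQ
      have e1 := (h3.gen.subset_cells hxA l).resolve_left hlQ
      have e2 := (h3.gen.subset_cells hb'A l).resolve_left hlQ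
      exact h5' x hxA' l hlP (Option.some.inj (e1.symm.trans e2))
    subst hbb
    have hAA : A = A' := by
      rw [← Finset.erase_insert hb, heq', Finset.erase_insert hb']
    subst hAA
    obtain rfl := h3.gen.pat_unique hn h3'.gen
    rfl

/-- In dimension 2 the two points play symmetric roles, giving about n ^ 4 / 2 sets. Each further
step chooses two of the 2c + 2 free coordinates and their values, then the new point: a factor (c +
1)(2c + 1) n ^ (2c + 4), up to replacing n by n - c - 1. There is no more overcounting, since the
last point is determined by the set. -/
lemma card_goods_bounds (hn : 2 ≤ n) (c : ℕ) (hc : 1 ≤ c) : ∀ P : Pat d n, P.dim = 2 * c →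
    (2 * c)! * (n - c) ^ (c * (c + 3)) ≤ 2 ^ (c + 1) * (goods P).card ∧
    2 ^ (c + 1) * (goods P).card ≤ (2 * c)! * n ^ (c * (c + 3)) := by
  induction c, hc using Nat.le_induction with
  | base =>
    intro P hP
    have h1 := card_genericPairs hP
    have h2 := card_genericPairs_eq P
    have hPn : P.points.card = n ^ 2 := by rw [card_points, hP]
    have hlow : n ^ 2 * (n - 1) ^ 2 ≤ (genericPairs P).card := by
      rw [h2, ← hPn]
      refine card_mul_le_sum_nat fun x _ => ?_
      have := le_card_nextPoints P {x}
      rwa [Finset.card_singleton, hP] at this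
    have hupp : (genericPairs P).card ≤ n ^ 2 * n ^ 2 := by
      have : genericPairs P ⊆ P.points ×ˢ P.points := Finset.filter_subset _ _
      have := Finset.card_le_card this
      rwa [Finset.card_product, hPn] at this
    have h3 : (n - 1) ^ 4 ≤ n ^ 2 * (n - 1) ^ 2 := by
      calc (n - 1) ^ 4 = (n - 1) ^ 2 * (n - 1) ^ 2 := by ring
        _ ≤ _ := Nat.mul_le_mul_right _ (Nat.pow_le_pow_left (Nat.sub_le _ _) _)
    have h4 : n ^ 4 = n ^ 2 * n ^ 2 := by ring
    norm_num [Nat.factorial]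
    omega
  | succ c hc ih =>
    intro P hP
    have hR : ∀ Q ∈ P.subs.filter fun Q => Q.dim = P.dim - 2, Q.dim = 2 * c := by
      intro Q hQ
      have := (Finset.mem_filter.1 hQ).2
      omega
    have hRcard : (P.subs.filter fun Q => Q.dim = P.dim - 2).card =
        n ^ 2 * ((c + 1) * (2 * c + 1)) := by
      rw [card_subs_dim, hP]
      have e1 : 2 * (c + 1) - (2 * (c + 1) - 2) = 2 := by omega
      have e2 : (2 * (c + 1)).choose (2 * (c + 1) - 2) = (c + 1) * (2 * c + 1) := by
        rw [Nat.choose_symm (by omega), Nat.choose_two_right]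
        have : 2 * (c + 1) - 1 = 2 * c + 1 := by omega
        rw [this, mul_assoc, Nat.mul_div_cancel_left _ two_pos]
      rw [e1, e2]
    have heq : (goods P).card = (extensions P).card :=
      le_antisymm (card_goods_le_extensions (by omega)) (card_extensions_le_goods hn (by omega))
    have hfac : (2 * (c + 1))! = 2 * ((c + 1) * (2 * c + 1)) * (2 * c)! := by
      rw [show 2 * (c + 1) = 2 * c + 1 + 1 by ring, Nat.factorial_succ, Nat.factorial_succ]
      ring
    have hAcard : ∀ Q ∈ P.subs.filter fun Q => Q.dim = P.dim - 2, ∀ A ∈ goods Q,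
        A.card = c + 1 := by
      intro Q hQ A hA
      have h1 := (mem_goods.1 hA).dim_add_two
      have h2 := hR Q hQ
      omega
    rw [heq, card_extensions]
    constructor
    · calc (2 * (c + 1))! * (n - (c + 1)) ^ ((c + 1) * (c + 1 + 3))
          = (n - (c + 1)) ^ 2 * ((c + 1) * (2 * c + 1)) * (2 * ((2 * c)! *
            (n - (c + 1)) ^ (c * (c + 3))) * (n - (c + 1)) ^ (2 * (c + 1))) := by
            rw [hfac]; ring
        _ ≤ n ^ 2 * ((c + 1) * (2 * c + 1)) * (2 * ((2 * c)! * (n - c) ^ (c * (c + 3))) *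
            (n - (c + 1)) ^ (2 * (c + 1))) := by
            gcongr <;> omega
        _ ≤ 2 ^ (c + 1 + 1) * _ := by
            rw [← hRcard, Finset.mul_sum]
            refine card_mul_le_sum_nat fun Q hQ => ?_
            calc 2 * ((2 * c)! * (n - c) ^ (c * (c + 3))) * (n - (c + 1)) ^ (2 * (c + 1))
                ≤ 2 * (2 ^ (c + 1) * (goods Q).card) * (n - (c + 1)) ^ (2 * (c + 1)) := by
                  exact Nat.mul_le_mul_right _ (Nat.mul_le_mul_left _ (ih Q (hR Q hQ)).1)
              _ = 2 ^ (c + 1 + 1) * ((goods Q).card * (n - (c + 1)) ^ (2 * (c + 1))) := by ring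
              _ ≤ _ := by
                  refine Nat.mul_le_mul_left _ (card_mul_le_sum_nat fun A hA => ?_)
                  have := le_card_nextPoints P A
                  rwa [hAcard Q hQ A hA, hP] at this
    · calc 2 ^ (c + 1 + 1) * _
          ≤ n ^ 2 * ((c + 1) * (2 * c + 1)) * (2 * ((2 * c)! * n ^ (c * (c + 3))) *
            n ^ (2 * (c + 1))) := by
            rw [← hRcard, Finset.mul_sum]
            refine sum_le_card_mul_nat fun Q hQ => ?_
            calc 2 ^ (c + 1 + 1) * ∑ A ∈ goods Q, (nextPoints P A).card
                ≤ 2 ^ (c + 1 + 1) * ((goods Q).card * n ^ (2 * (c + 1))) := by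
                  refine Nat.mul_le_mul_left _ (sum_le_card_mul_nat fun A hA => ?_)
                  have := card_nextPoints_le P A
                  rwa [hP] at this
              _ = 2 * (2 ^ (c + 1) * (goods Q).card) * n ^ (2 * (c + 1)) := by
                  ring
              _ ≤ _ := Nat.mul_le_mul_right _ (Nat.mul_le_mul_left _ (ih Q (hR Q hQ)).2)
        _ = _ := by rw [hfac]; ring

/-- All good sets spanning a subtorus of dimension `i`. -/
noncomputable def goodSets (d n i : ℕ) : Finset (Finset (Fin d → Fin n)) :=
  (Finset.univ.filter fun P : Pat d n => P.dim = i).biUnion goods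

lemma mem_goodSets {i : ℕ} {A : Finset (Fin d → Fin n)} :
    A ∈ goodSets d n i ↔ ∃ P, P.dim = i ∧ Good A P := by
  simp [goodSets, mem_goods]

lemma card_filter_dim (i : ℕ) :
    (Finset.univ.filter fun P : Pat d n => P.dim = i).card = n ^ (d - i) * d.choose i := by
  have := (Pat.whole d n).card_subs_dim i
  rwa [subs_whole, dim_whole] at this

lemma card_goodSets_bounds (hn : 2 ≤ n) {j : ℕ} (hj : 1 ≤ j) :
    n ^ (d - 2 * j) * d.choose (2 * j) * ((2 * j)! * (n - j) ^ (j * (j + 3))) ≤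
      2 ^ (j + 1) * (goodSets d n (2 * j)).card ∧
    2 ^ (j + 1) * (goodSets d n (2 * j)).card ≤
      n ^ (d - 2 * j) * d.choose (2 * j) * ((2 * j)! * n ^ (j * (j + 3))) := by
  classical
  have hcard : (goodSets d n (2 * j)).card =
      ∑ P ∈ Finset.univ.filter fun P : Pat d n => P.dim = 2 * j, (goods P).card := by
    refine Finset.card_biUnion fun P _ Q _ hPQ => ?_
    refine Finset.disjoint_left.2 fun A hA hA' => ?_
    exact hPQ ((mem_goods.1 hA).gen.pat_unique hn (mem_goods.1 hA').gen)
  rw [hcard, Finset.mul_sum, ← card_filter_dim]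
  refine ⟨card_mul_le_sum_nat fun P hP => ?_, ?_⟩
  · exact (card_goods_bounds hn j hj P (Finset.mem_filter.1 hP).2).1
  · exact sum_le_card_mul_nat fun P hP =>
      (card_goods_bounds hn j hj P (Finset.mem_filter.1 hP).2).2

lemma card_of_mem_goodSets {j : ℕ} {A : Finset (Fin d → Fin n)} (h : A ∈ goodSets d n (2 * j)) :
    A.card = j + 1 := by
  obtain ⟨P, hP, hA⟩ := mem_goodSets.1 h
  have := hA.dim_add_two
  omega

end GoodCount

end HammingBootstrap

namespace HammingBootstrap

open Pat

/-! ### Error terms at criticality and bounds for the probability of a good set. -/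

section Estimates

/-- The critical exponent `d / (j + 1) + j`. -/
noncomputable def critExp (d j : ℕ) : ℝ := (d : ℝ) / ((j : ℝ) + 1) + (j : ℝ)

/-- The gain in the exponents of non-dominant contributions. -/
noncomputable def gap (d j : ℕ) : ℝ := min 1 (critExp d j - 2 * j)

variable {d j : ℕ}

lemma gap_pos (h : j * (j + 1) < d) : 0 < gap d j := by
  have h' : (j : ℝ) * (j + 1) < d := by exact_mod_cast h
  have : (j : ℝ) < (d : ℝ) / ((j : ℝ) + 1) := by rwa [lt_div_iff₀ (by positivity)]
  refine lt_min one_pos ?_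
  rw [critExp]; linarith

lemma gap_le_one : gap d j ≤ 1 := min_le_left _ _

lemma two_mul_add_gap_le : 2 * (j : ℝ) + gap d j ≤ critExp d j := by
  have := min_le_right 1 (critExp d j - 2 * j)
  rw [gap]; linarith

lemma succ_mul_critExp : ((j : ℝ) + 1) * critExp d j = d + j * (j + 1) := by
  rw [critExp]; field_simp

/-- This equation characterises criticality: summed over the torus, the weight bound n ^ (d + expo)
for dimension 2j is of order one. -/
lemma expo_critExp : expo (critExp d j) (2 * j) = -d := by
  rw [expo_two_mul, mul_sub, succ_mul_critExp]; ring

/-- A union bound over the mergers that jump over dimension 2j; the exponent of each is below -d by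
at least the gap, and summing over the torus restores n ^ d. -/
lemma exists_prob_eventC_diff_le (h : j * (j + 1) < d) (hj : 1 ≤ j) {a : ℝ} (ha : 0 ≤ a) :
    ∃ K : ℝ, ∀ n : ℕ, 2 ≤ n → ∀ p : unitInterval, (p : ℝ) ≤ a * (n : ℝ) ^ (-critExp d j) →
      prob p (eventC d (2 * j) n \ eventI d (2 * j) n) ≤ K * (n : ℝ) ^ (-gap d j) := by
  classical
  obtain ⟨C, hC, hw⟩ := exists_weight_gens_le d ha (gap_pos h).le two_mul_add_gap_le (2 * j) le_rfl
  refine ⟨C ^ 2 * 4 ^ d * 2 ^ d, fun n hn p hp => ?_⟩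
  have hn0 : (0 : ℝ) < n := by positivity
  set 𝓑 : Finset (Finset (Fin d → Fin n)) := Finset.univ.filter fun A =>
    ∃ A₁ P₁ A₂ P₂, Gen A₁ P₁ ∧ Gen A₂ P₂ ∧ Disjoint A₁ A₂ ∧ A = A₁ ∪ A₂ ∧
      (diff P₁ P₂).card ≤ 2 ∧ P₁.dim < 2 * j ∧ P₂.dim < 2 * j ∧ 2 * j < (Pat.join P₁ P₂).dim with h𝓑
  set R : Finset (Pat d n × Pat d n) := Finset.univ.filter fun q =>
    (diff q.1 q.2).card ≤ 2 ∧ q.1.dim < 2 * j ∧ q.2.dim < 2 * j ∧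
      2 * j < (Pat.join q.1 q.2).dim with hR
  have h1 : prob p (eventC d (2 * j) n \ eventI d (2 * j) n) ≤ weight p 𝓑 := by
    refine le_trans (pr_mono (p := p) ?_) (pr_exists_superset_le p 𝓑)
    intro ω hω
    obtain ⟨A₁, P₁, A₂, P₂, g1, g2, g3, g4, g5⟩ :=
      exists_merge_of_mem_eventC_diff hn (by omega) hω
    refine ⟨A₁ ∪ A₂, ?_, g4⟩
    rw [h𝓑, Finset.mem_filter]
    exact ⟨Finset.mem_univ _, A₁, P₁, A₂, P₂, g1, g2, g3, rfl, g5⟩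
  have h2 : weight p 𝓑 ≤ ∑ q ∈ R, weight p (gens q.1) * weight p (gens q.2) := by
    refine weight_le_sum_pairs p.2.1 R fun A hA => ?_
    obtain ⟨A₁, P₁, A₂, P₂, g1, g2, g3, g4, g5⟩ := (Finset.mem_filter.1 hA).2
    exact ⟨A₁, P₁, A₂, P₂, g1, g2, g3, g4, Finset.mem_filter.2 ⟨Finset.mem_univ _, g5⟩⟩
  have h3 : ∑ q ∈ R, weight p (gens q.1) * weight p (gens q.2) ≤
      C ^ 2 * 4 ^ d * (n : ℝ) ^ (-(d : ℝ) - gap d j) * (2 * n) ^ (Pat.whole d n).dim := by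
    -- Pairs are grouped by their join P, so that both members lie below P and the pair estimate
    -- applies in P.
    rw [← Finset.sum_fiberwise R (fun q => Pat.join q.1 q.2)]
    refine sum_subs_le (P := Pat.whole d n) (R := Finset.univ) (by rw [subs_whole])
      (by positivity) fun P _ => ?_
    refine (sum_weight_pairs_le (by omega) (γ := critExp d j) (e := -(d : ℝ) - gap d j) (P := P)
      p.2.1 hC ?_ ?_ ?_).trans ?_
    · intro q hq
      rw [← (Finset.mem_filter.1 hq).2, Finset.mem_product, mem_subs, mem_subs]
      exact ⟨le_join_left _ _, le_join_right _ _⟩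
    · intro q hq
      have := (Finset.mem_filter.1 (Finset.mem_filter.1 hq).1).2
      exact ⟨hw n (by omega) p p.2.1 hp q.1 (by omega), hw n (by omega) p p.2.1 hp q.2 (by omega)⟩
    · intro q hq
      have h4 := (Finset.mem_filter.1 (Finset.mem_filter.1 hq).1).2
      have h5 := dim_join_le q.1 q.2
      rw [← (Finset.mem_filter.1 hq).2, ← expo_critExp]
      exact expo_add_le_of_lt (gap_pos h).le two_mul_add_gap_le h4.2.1 h4.2.2.1 (by omega)
        h4.2.2.2
    · rw [Real.rpow_add hn0, Real.rpow_natCast, ← mul_assoc]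
      have hd : P.dim ≤ d := by
        have := Finset.card_le_univ P.free
        rwa [Fintype.card_fin] at this
      gcongr
      norm_num
  refine (h1.trans (h2.trans h3)).trans (le_of_eq ?_)
  rw [dim_whole, mul_pow, sub_eq_add_neg, Real.rpow_add hn0, Real.rpow_neg hn0.le (d : ℝ),
    Real.rpow_natCast]
  field_simp

/-- The event that the points of some good set are open. -/
def goodEvent (d j n : ℕ) : Set (Set (Fin d → Fin n)) :=
  {ω | ∃ A ∈ goodSets d n (2 * j), (A : Set (Fin d → Fin n)) ⊆ ω}

lemma goodEvent_subset_eventI {n : ℕ} (hn : 2 ≤ n) : goodEvent d j n ⊆ eventI d (2 * j) n := by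
  rintro ω ⟨A, hA, hAω⟩
  obtain ⟨P, hP, hgood⟩ := mem_goodSets.1 hA
  exact (mem_eventI_iff hn).2 ⟨A, P, hgood.gen, hAω, hP⟩

lemma exists_prob_eventI_le (h : j * (j + 1) < d) {a : ℝ} (ha : 0 ≤ a) :
    ∃ K : ℝ, ∀ n : ℕ, 2 ≤ n → ∀ p : unitInterval, (p : ℝ) ≤ a * (n : ℝ) ^ (-critExp d j) →
      prob p (eventI d (2 * j) n) ≤ prob p (goodEvent d j n) + K * (n : ℝ) ^ (-gap d j) := by
  classical
  obtain ⟨C, hC, hw⟩ := exists_weight_bads_le d ha (gap_pos h).le gap_le_one two_mul_add_gap_le j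
    le_rfl
  refine ⟨C * 2 ^ d, fun n hn p hp => ?_⟩
  have hn0 : (0 : ℝ) < n := by positivity
  set R : Finset (Pat d n) := Finset.univ.filter fun P => P.dim = 2 * j with hR
  have h1 : eventI d (2 * j) n ⊆ goodEvent d j n ∪
      {ω | ∃ A ∈ R.biUnion bads, (A : Set (Fin d → Fin n)) ⊆ ω} := by
    intro ω hω
    obtain ⟨A, P, hA, hAω, hP⟩ := (mem_eventI_iff hn).1 hω
    by_cases hgood : Good A P
    · exact Or.inl ⟨A, mem_goodSets.2 ⟨P, hP, hgood⟩, hAω⟩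
    · exact Or.inr ⟨A, Finset.mem_biUnion.2 ⟨P, Finset.mem_filter.2 ⟨Finset.mem_univ _, hP⟩,
        mem_bads.2 ⟨hA, hgood⟩⟩, hAω⟩
  have h2 : ∑ A ∈ R.biUnion bads, (p : ℝ) ^ A.card ≤ ∑ P ∈ R, weight p (bads P) := by
    simp only [weight]
    rw [← Finset.sum_sigma R bads fun z => (p : ℝ) ^ z.2.card]
    refine sum_le_sum_of_forall_exists (fun z => z.2) (fun _ _ => pow_nonneg p.2.1 _) ?_
    intro A hA
    obtain ⟨P, hP, hAP⟩ := Finset.mem_biUnion.1 hA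
    exact ⟨⟨P, A⟩, Finset.mem_sigma.2 ⟨hP, hAP⟩, rfl, le_rfl⟩
  have h3 : ∑ P ∈ R, weight p (bads P) ≤
      C * (n : ℝ) ^ (-(d : ℝ) - gap d j) * (2 * n) ^ (Pat.whole d n).dim := by
    refine sum_subs_le (P := Pat.whole d n) (by rw [subs_whole]; exact Finset.subset_univ _)
      (by positivity) fun P hP => ?_
    have hPd := (Finset.mem_filter.1 hP).2
    refine (hw n (by omega) p p.2.1 hp P hPd).trans (le_of_eq ?_)
    rw [hPd, expo_critExp, show -(d : ℝ) + ((2 * j : ℕ) : ℝ) - gap d j =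
      (-(d : ℝ) - gap d j) + ((2 * j : ℕ) : ℝ) by ring, Real.rpow_add hn0, Real.rpow_natCast]
    ring
  have h4 := (pr_mono (p := p) h1).trans (pr_union_le p _ _)
  have h5 := (pr_exists_superset_le p (R.biUnion bads)).trans (h2.trans h3)
  refine h4.trans (add_le_add le_rfl (h5.trans (le_of_eq ?_)))
  rw [dim_whole, mul_pow, sub_eq_add_neg, Real.rpow_add hn0, Real.rpow_neg hn0.le (d : ℝ),
    Real.rpow_natCast]
  field_simp

lemma sum_nonempty_powerset_pow_le {α : Type*} [DecidableEq α] (K : Finset α) {p : ℝ}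
    (hp : 0 ≤ p) :
    ∑ D ∈ K.powerset.erase ∅, p ^ D.card ≤ Real.exp (p * K.card) - 1 := by
  have h1 := Finset.sum_pow_mul_eq_add_pow p 1 K
  simp only [one_pow, mul_one] at h1
  rw [← Finset.add_sum_erase _ _ (Finset.empty_mem_powerset K), Finset.card_empty, pow_zero] at h1
  have h2 : (p + 1) ^ K.card ≤ Real.exp (p * K.card) := by
    rw [mul_comm, Real.exp_nat_mul]
    exact pow_le_pow_left₀ (by positivity) (Real.add_one_le_exp p) _
  linarith

/-- The subtorus through `x` with free coordinates `F`. -/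
def patThrough {n : ℕ} (x : Fin d → Fin n) (F : Finset (Fin d)) : Pat d n :=
  fun l => if l ∈ F then none else some (x l)

lemma patThrough_free {n : ℕ} {x : Fin d → Fin n} {P : Pat d n} (hx : x ∈ P.cells) :
    patThrough x P.free = P := by
  funext l
  rw [patThrough]
  split_ifs with h
  · exact (mem_free.1 h).symm
  · exact ((hx l).resolve_left fun h' => h (mem_free.2 h')).symm

lemma dim_patThrough {n : ℕ} (x : Fin d → Fin n) (F : Finset (Fin d)) :
    (patThrough x F).dim = F.card := by
  have : (patThrough x F).free = F := by ext l; simp [mem_free, patThrough]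
  rw [dim, this]

/-- The pairs of distinct intersecting good sets contribute little. -/
lemma sum_overlapping_le {n : ℕ} (p : unitInterval) {A : Finset (Fin d → Fin n)}
    (hA : A ∈ goodSets d n (2 * j)) :
    ∑ B ∈ goodSets d n (2 * j) with B ≠ A ∧ ¬ Disjoint A B, (p : ℝ) ^ (A ∪ B).card ≤
      (p : ℝ) ^ A.card * (((j + 1 : ℕ) * (d.choose (2 * j) * 2 ^ (j + 1) : ℕ)) *
        (Real.exp (p * (n : ℝ) ^ (2 * j)) - 1)) := by
  classical
  have hAc := card_of_mem_goodSets hA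
  -- Code for B: a common point x and the free coordinates determine its subtorus; B ∩ A is a subset
  -- of A; and B \ A is a set of points of that subtorus, nonempty because A and B are distinct of
  -- equal size.
  set T := A ×ˢ ((Finset.univ : Finset (Fin d)).powersetCard (2 * j) ×ˢ A.powerset) with hT
  have hTc : T.card = (j + 1) * (d.choose (2 * j) * 2 ^ (j + 1)) := by
    rw [hT, Finset.card_product, Finset.card_product, Finset.card_powersetCard,
      Finset.card_powerset, hAc, Finset.card_univ, Fintype.card_fin]
  calc _ ≤ ∑ z ∈ T.sigma fun t => (patThrough t.1 t.2.1).points.powerset.erase ∅,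
          (p : ℝ) ^ A.card * (p : ℝ) ^ z.2.card := by
        refine sum_le_sum_of_forall_exists (fun z => z.1.2.2 ∪ z.2)
          (fun _ _ => mul_nonneg (pow_nonneg p.2.1 _) (pow_nonneg p.2.1 _)) ?_
        intro B hB
        obtain ⟨hB, hBA, hdis⟩ := Finset.mem_filter.1 hB
        have hBc := card_of_mem_goodSets hB
        obtain ⟨P, hP, hgood⟩ := mem_goodSets.1 hB
        obtain ⟨x, hxA, hxB⟩ := Finset.not_disjoint_iff.1 hdis
        have hBP := hgood.gen.subset_cells
        refine ⟨⟨(x, (P.free, B ∩ A)), B \ A⟩, ?_, ?_, ?_⟩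
        · rw [Finset.mem_sigma, hT, Finset.mem_product, Finset.mem_product,
            Finset.mem_powersetCard, Finset.mem_powerset, Finset.mem_erase, Finset.mem_powerset]
          refine ⟨⟨hxA, ⟨Finset.subset_univ _, hP⟩, Finset.inter_subset_right⟩, ?_, ?_⟩
          · intro hemp
            rw [Finset.sdiff_eq_empty_iff_subset] at hemp
            exact hBA (Finset.eq_of_subset_of_card_le hemp (by omega))
          · intro y hy
            rw [mem_points, patThrough_free (hBP hxB)]
            exact hBP (Finset.mem_sdiff.1 hy).1
        · exact sup_inf_sdiff B A
        · rw [← pow_add, ← Finset.card_union_of_disjoint Finset.disjoint_sdiff,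
            Finset.union_sdiff_self_eq_union]
    _ = ∑ t ∈ T, (p : ℝ) ^ A.card *
          ∑ D ∈ (patThrough t.1 t.2.1).points.powerset.erase ∅, (p : ℝ) ^ D.card := by
        rw [Finset.sum_sigma]
        simp only [Finset.mul_sum]
    _ ≤ ∑ t ∈ T, (p : ℝ) ^ A.card * (Real.exp (p * (n : ℝ) ^ (2 * j)) - 1) := by
        refine Finset.sum_le_sum fun t ht => mul_le_mul_of_nonneg_left ?_ (pow_nonneg p.2.1 _)
        refine (sum_nonempty_powerset_pow_le _ p.2.1).trans (le_of_eq ?_)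
        rw [hT, Finset.mem_product, Finset.mem_product, Finset.mem_powersetCard] at ht
        rw [card_points, dim_patThrough, ht.2.1.2, Nat.cast_pow]
    _ = _ := by
        rw [Finset.sum_const, nsmul_eq_mul, hTc]
        push_cast
        ring

/-- The expected number of good sets. -/
noncomputable def expectedGood (d j n : ℕ) (p : ℝ) : ℝ :=
  (goodSets d n (2 * j)).card * p ^ (j + 1)

lemma sum_goodSets_pow (n : ℕ) (p : ℝ) :
    ∑ A ∈ goodSets d n (2 * j), p ^ A.card = expectedGood d j n p := by
  rw [Finset.sum_congr rfl fun A hA => by rw [card_of_mem_goodSets hA], Finset.sum_const,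
    nsmul_eq_mul, expectedGood]

lemma prob_goodEvent_eq (n : ℕ) (p : unitInterval) : prob p (goodEvent d j n) =
    1 - pr p {ω | ∀ A ∈ goodSets d n (2 * j), ¬ (A : Set (Fin d → Fin n)) ⊆ ω} := by
  rw [← pr_compl]
  congr 1
  ext ω
  simp [goodEvent]

lemma prob_goodEvent_ge (n : ℕ) (p : unitInterval) :
    1 - Real.exp (-expectedGood d j n p + expectedGood d j n p *
      (((j + 1 : ℕ) * (d.choose (2 * j) * 2 ^ (j + 1) : ℕ)) *
        (Real.exp (p * (n : ℝ) ^ (2 * j)) - 1))) ≤ prob p (goodEvent d j n) := by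
  rw [prob_goodEvent_eq]
  have h1 := pr_forall_not_superset_le_exp p (goodSets d n (2 * j))
  rw [sum_goodSets_pow] at h1
  have h2 : ∑ A ∈ goodSets d n (2 * j), ∑ B ∈ goodSets d n (2 * j) with B ≠ A ∧ ¬ Disjoint A B,
      (p : ℝ) ^ (A ∪ B).card ≤ expectedGood d j n p *
      (((j + 1 : ℕ) * (d.choose (2 * j) * 2 ^ (j + 1) : ℕ)) *
        (Real.exp (p * (n : ℝ) ^ (2 * j)) - 1)) := by
    rw [← sum_goodSets_pow, Finset.sum_mul]
    exact Finset.sum_le_sum fun A hA => sum_overlapping_le p hA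
  have h3 := h1.trans (Real.exp_le_exp.2 (add_le_add le_rfl h2))
  linarith

lemma exp_neg_div_le_one_sub {x : ℝ} (hx : x < 1) : Real.exp (-(x / (1 - x))) ≤ 1 - x := by
  have h0 : 0 < 1 - x := by linarith
  have h1 := Real.add_one_le_exp (x / (1 - x))
  have h2 : x / (1 - x) + 1 = (1 - x)⁻¹ := by field_simp; ring
  rw [h2] at h1
  rw [Real.exp_neg]
  exact inv_le_of_inv_le₀ h0 h1

lemma prob_goodEvent_le (n : ℕ) (p : unitInterval) (hp : (p : ℝ) ^ (j + 1) < 1) :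
    prob p (goodEvent d j n) ≤
      1 - Real.exp (-(expectedGood d j n p / (1 - (p : ℝ) ^ (j + 1)))) := by
  rw [prob_goodEvent_eq]
  have h1 := prod_le_pr_forall_not_superset p (goodSets d n (2 * j))
  rw [Finset.prod_congr rfl fun A hA => by rw [card_of_mem_goodSets hA], Finset.prod_const] at h1
  have h2 : Real.exp (-(expectedGood d j n p / (1 - (p : ℝ) ^ (j + 1)))) ≤
      (1 - (p : ℝ) ^ (j + 1)) ^ (goodSets d n (2 * j)).card := by
    have e : -(expectedGood d j n p / (1 - (p : ℝ) ^ (j + 1))) =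
        ((goodSets d n (2 * j)).card : ℝ) *
          (-((p : ℝ) ^ (j + 1) / (1 - (p : ℝ) ^ (j + 1)))) := by
      rw [expectedGood]; ring
    rw [e, Real.exp_nat_mul]
    exact pow_le_pow_left₀ (Real.exp_pos _).le (exp_neg_div_le_one_sub hp) _
  linarith

end Estimates

end HammingBootstrap

namespace HammingBootstrap

/-! ### Limits, critical exponent and absence of sharpness. -/

section Limits

variable {d j : ℕ}

lemma critExp_pos (h : j * (j + 1) < d) : 0 < critExp d j := by
  have h1 := two_mul_add_gap_le (d := d) (j := j)
  have h2 := gap_pos h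
  have h3 : (0 : ℝ) ≤ j := by positivity
  linarith

lemma coe_powerParam_le {a γ : ℝ} (ha : 0 ≤ a) (n : ℕ) :
    (powerParam a γ n : ℝ) ≤ a * (n : ℝ) ^ (-γ) := by
  rw [powerParam, Set.coe_projIcc]
  exact max_le (by positivity) (min_le_right _ _)

lemma tendsto_natCast_rpow_neg {γ : ℝ} (hγ : 0 < γ) :
    Tendsto (fun n : ℕ => (n : ℝ) ^ (-γ)) atTop (𝓝 0) :=
  (tendsto_rpow_neg_atTop hγ).comp tendsto_natCast_atTop_atTop

lemma eventually_coe_powerParam {a γ : ℝ} (ha : 0 ≤ a) (hγ : 0 < γ) :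
    ∀ᶠ n : ℕ in atTop, (powerParam a γ n : ℝ) = a * (n : ℝ) ^ (-γ) := by
  have h := (tendsto_natCast_rpow_neg hγ).const_mul a
  rw [mul_zero] at h
  filter_upwards [h.eventually_le_const zero_lt_one] with n hn
  rw [powerParam, Set.coe_projIcc, min_eq_right hn, max_eq_right (by positivity)]

lemma tendsto_coe_powerParam {a γ : ℝ} (ha : 0 ≤ a) (hγ : 0 < γ) :
    Tendsto (fun n : ℕ => (powerParam a γ n : ℝ)) atTop (𝓝 0) := by
  have h := (tendsto_natCast_rpow_neg hγ).const_mul a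
  rw [mul_zero] at h
  exact h.congr' ((eventually_coe_powerParam ha hγ).mono fun n hn => hn.symm)

lemma tendsto_expectedGood (h : j * (j + 1) < d) (hj : 1 ≤ j) {a : ℝ} (ha : 0 ≤ a) :
    Tendsto (fun n : ℕ => expectedGood d j n (powerParam a (critExp d j) n)) atTop
      (𝓝 (lam j d a)) := by
  have h2j : 2 * j ≤ d := by nlinarith
  have hscale : ∀ᶠ n : ℕ in atTop, (powerParam a (critExp d j) n : ℝ) ^ (j + 1) *
      ((n : ℝ) ^ (d - 2 * j) * (n : ℝ) ^ (j * (j + 3))) = a ^ (j + 1) := by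
    filter_upwards [eventually_coe_powerParam ha (critExp_pos h), eventually_ge_atTop 1] with n hn h1
    have hn0 : (0 : ℝ) < n := by exact_mod_cast h1
    rw [hn, mul_pow, ← Real.rpow_natCast ((n : ℝ) ^ (-critExp d j)), ← Real.rpow_mul hn0.le,
      ← Real.rpow_natCast (n : ℝ), ← Real.rpow_natCast (n : ℝ), mul_assoc, ← Real.rpow_add hn0,
      ← Real.rpow_add hn0]
    -- The j + 1 factors n ^ (-γ) exactly cancel the d - 2j + j(j + 3) = d + j(j + 1) powers of n
    -- counting good sets.
    have hex : -critExp d j * ((j + 1 : ℕ) : ℝ) + (((d - 2 * j : ℕ) : ℝ) + ((j * (j + 3) : ℕ) : ℝ))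
        = 0 := by
      have := succ_mul_critExp (d := d) (j := j)
      rw [Nat.cast_sub h2j]
      push_cast
      linarith
    rw [hex, Real.rpow_zero, mul_one]
  have hlam : lam j d a = (d.choose (2 * j) : ℝ) * ((2 * j)! : ℝ) * (2 : ℝ)⁻¹ ^ (j + 1) *
      a ^ (j + 1) := rfl
  have hratio : Tendsto (fun n : ℕ => (((n - j : ℕ) : ℝ) / n) ^ (j * (j + 3))) atTop (𝓝 1) := by
    have h1 : Tendsto (fun n : ℕ => 1 - (j : ℝ) / n) atTop (𝓝 (1 - 0)) :=
      tendsto_const_nhds.sub (tendsto_const_div_atTop_nhds_zero_nat _)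
    have h2 : Tendsto (fun n : ℕ => ((n - j : ℕ) : ℝ) / n) atTop (𝓝 1) := by
      rw [sub_zero] at h1
      refine h1.congr' ?_
      filter_upwards [eventually_ge_atTop (max 1 j)] with n hn
      have hn0 : (0 : ℝ) < n := by
        have : 1 ≤ n := le_trans (le_max_left _ _) hn
        exact_mod_cast this
      rw [Nat.cast_sub (le_trans (le_max_right _ _) hn)]
      field_simp
    simpa using h2.pow (j * (j + 3))
  have hlow := hratio.const_mul (lam j d a)
  rw [mul_one] at hlow
  refine tendsto_of_tendsto_of_tendsto_of_le_of_le' hlow tendsto_const_nhds ?_ ?_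
  · filter_upwards [hscale, eventually_ge_atTop 2] with n hn h2
    have hn0 : (0 : ℝ) < n := by positivity
    have hb := (card_goodSets_bounds (d := d) h2 hj).1
    have hb' : (n : ℝ) ^ (d - 2 * j) * d.choose (2 * j) * ((2 * j)! *
        ((n - j : ℕ) : ℝ) ^ (j * (j + 3))) ≤ 2 ^ (j + 1) * (goodSets d n (2 * j)).card := by
      exact_mod_cast hb
    have hp := pow_nonneg (powerParam a (critExp d j) n).2.1 (j + 1)
    rw [expectedGood, hlam, ← hn, div_pow]
    have := mul_le_mul_of_nonneg_right hb' (mul_nonneg (by positivity : (0 : ℝ) ≤ 2⁻¹ ^ (j + 1)) hp)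
    have e1 : (2 : ℝ)⁻¹ ^ (j + 1) * 2 ^ (j + 1) = 1 := by rw [← mul_pow]; norm_num
    calc _ = (n : ℝ) ^ (d - 2 * j) * d.choose (2 * j) * ((2 * j)! *
        ((n - j : ℕ) : ℝ) ^ (j * (j + 3))) * (2⁻¹ ^ (j + 1) *
          (powerParam a (critExp d j) n : ℝ) ^ (j + 1)) := by
          field_simp
      _ ≤ _ := this
      _ = ((2 : ℝ)⁻¹ ^ (j + 1) * 2 ^ (j + 1)) * ((goodSets d n (2 * j)).card *
          (powerParam a (critExp d j) n : ℝ) ^ (j + 1)) := by ring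
      _ = _ := by rw [e1, one_mul]
  · filter_upwards [hscale, eventually_ge_atTop 2] with n hn h2
    have hb := (card_goodSets_bounds (d := d) h2 hj).2
    have hb' : 2 ^ (j + 1) * ((goodSets d n (2 * j)).card : ℝ) ≤
        (n : ℝ) ^ (d - 2 * j) * d.choose (2 * j) * ((2 * j)! * (n : ℝ) ^ (j * (j + 3))) := by
      exact_mod_cast hb
    have hp := pow_nonneg (powerParam a (critExp d j) n).2.1 (j + 1)
    rw [expectedGood, hlam, ← hn]
    have := mul_le_mul_of_nonneg_right hb' (mul_nonneg (by positivity : (0 : ℝ) ≤ 2⁻¹ ^ (j + 1)) hp)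
    have e1 : (2 : ℝ)⁻¹ ^ (j + 1) * 2 ^ (j + 1) = 1 := by rw [← mul_pow]; norm_num
    calc _ = ((2 : ℝ)⁻¹ ^ (j + 1) * 2 ^ (j + 1)) * ((goodSets d n (2 * j)).card *
          (powerParam a (critExp d j) n : ℝ) ^ (j + 1)) := by rw [e1, one_mul]
      _ = 2 ^ (j + 1) * ((goodSets d n (2 * j)).card : ℝ) * (2⁻¹ ^ (j + 1) *
          (powerParam a (critExp d j) n : ℝ) ^ (j + 1)) := by ring
      _ ≤ _ := this
      _ = _ := by ring

lemma tendsto_powerParam_mul_pow (h : j * (j + 1) < d) {a : ℝ} (ha : 0 ≤ a) :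
    Tendsto (fun n : ℕ => (powerParam a (critExp d j) n : ℝ) * (n : ℝ) ^ (2 * j)) atTop (𝓝 0) := by
  have hpos : 0 < critExp d j - 2 * j := by
    have := two_mul_add_gap_le (d := d) (j := j)
    have := gap_pos h
    linarith
  have h1 := (tendsto_natCast_rpow_neg hpos).const_mul a
  rw [mul_zero] at h1
  refine h1.congr' ?_
  filter_upwards [eventually_coe_powerParam ha (critExp_pos h), eventually_ge_atTop 1] with n hn hn1
  have hn0 : (0 : ℝ) < n := by exact_mod_cast hn1
  rw [hn, mul_assoc, ← Real.rpow_natCast (n : ℝ), ← Real.rpow_add hn0]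
  congr 2
  push_cast
  ring

/-- The Janson and Harris bounds meet: the overlap correction vanishes because p n ^ (2j) → 0, and
the Harris correction because p ^ (j + 1) → 0. -/
lemma tendsto_prob_goodEvent (h : j * (j + 1) < d) (hj : 1 ≤ j) {a : ℝ} (ha : 0 ≤ a) :
    Tendsto (fun n : ℕ => prob (powerParam a (critExp d j) n) (goodEvent d j n)) atTop
      (𝓝 (1 - Real.exp (-lam j d a))) := by
  have hμ := tendsto_expectedGood h hj ha
  have hexp := (Real.continuous_exp.tendsto 0).comp (tendsto_powerParam_mul_pow h ha)
  have hpp := (tendsto_coe_powerParam ha (critExp_pos h)).pow (j + 1)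
  rw [zero_pow (Nat.succ_ne_zero j)] at hpp
  refine tendsto_of_tendsto_of_tendsto_of_le_of_le'
    (g := fun n => 1 - Real.exp (-expectedGood d j n (powerParam a (critExp d j) n) +
      expectedGood d j n (powerParam a (critExp d j) n) *
      (((j + 1 : ℕ) * (d.choose (2 * j) * 2 ^ (j + 1) : ℕ)) *
        (Real.exp (powerParam a (critExp d j) n * (n : ℝ) ^ (2 * j)) - 1))))
    (h := fun n => 1 - Real.exp (-(expectedGood d j n (powerParam a (critExp d j) n) /
      (1 - (powerParam a (critExp d j) n : ℝ) ^ (j + 1))))) ?_ ?_ ?_ ?_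
  · refine tendsto_const_nhds.sub ((Real.continuous_exp.tendsto _).comp ?_)
    have := hμ.neg.add (hμ.mul ((hexp.sub_const 1).const_mul
      (((j + 1 : ℕ) * (d.choose (2 * j) * 2 ^ (j + 1) : ℕ) : ℝ))))
    simpa using this
  · refine tendsto_const_nhds.sub ((Real.continuous_exp.tendsto _).comp ?_)
    have := (hμ.div (hpp.const_sub 1) (by norm_num)).neg
    simpa using this
  · exact Eventually.of_forall fun n => prob_goodEvent_ge n _
  · filter_upwards [hpp.eventually_lt_const zero_lt_one] with n hn
    exact prob_goodEvent_le n _ hn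

lemma tendsto_prob_eventI (h : j * (j + 1) < d) (hj : 1 ≤ j) {a : ℝ} (ha : 0 ≤ a) :
    Tendsto (fun n : ℕ => prob (powerParam a (critExp d j) n) (eventI d (2 * j) n)) atTop
      (𝓝 (1 - Real.exp (-lam j d a))) := by
  obtain ⟨K, hK⟩ := exists_prob_eventI_le h ha
  have h1 := tendsto_prob_goodEvent h hj ha
  have h2 := h1.add ((tendsto_natCast_rpow_neg (gap_pos h)).const_mul K)
  rw [mul_zero, add_zero] at h2
  refine tendsto_of_tendsto_of_tendsto_of_le_of_le' h1 h2 ?_ ?_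
  · filter_upwards [eventually_ge_atTop 2] with n hn
    exact pr_mono (goodEvent_subset_eventI hn)
  · filter_upwards [eventually_ge_atTop 2] with n hn
    exact hK n hn _ (coe_powerParam_le ha n)

lemma tendsto_prob_eventC_diff (h : j * (j + 1) < d) (hj : 1 ≤ j) {a : ℝ} (ha : 0 ≤ a) :
    Tendsto (fun n : ℕ => prob (powerParam a (critExp d j) n)
      (eventC d (2 * j) n \ eventI d (2 * j) n)) atTop (𝓝 0) := by
  obtain ⟨K, hK⟩ := exists_prob_eventC_diff_le h hj ha
  have h2 := (tendsto_natCast_rpow_neg (gap_pos h)).const_mul K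
  rw [mul_zero] at h2
  refine tendsto_of_tendsto_of_tendsto_of_le_of_le' tendsto_const_nhds h2 ?_ ?_
  · exact Eventually.of_forall fun n => pr_nonneg _ _
  · filter_upwards [eventually_ge_atTop 2] with n hn
    exact hK n hn _ (coe_powerParam_le ha n)

lemma tendsto_prob_eventC (h : j * (j + 1) < d) (hj : 1 ≤ j) {a : ℝ} (ha : 0 ≤ a) :
    Tendsto (fun n : ℕ => prob (powerParam a (critExp d j) n) (eventC d (2 * j) n)) atTop
      (𝓝 (1 - Real.exp (-lam j d a))) := by
  have h1 := (tendsto_prob_eventI h hj ha).add (tendsto_prob_eventC_diff h hj ha)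
  rw [add_zero] at h1
  refine h1.congr fun n => ?_
  have := pr_inter_add_diff (powerParam a (critExp d j) n) (eventC d (2 * j) n)
    (eventI d (2 * j) n)
  rwa [Set.inter_eq_right.2 eventI_subset_eventC] at this

lemma prob_eventC_mono {n i : ℕ} {p q : unitInterval} (hpq : p ≤ q) :
    prob p (eventC d i n) ≤ prob q (eventC d i n) :=
  pr_mono_param hpq isUpperSet_eventC

/-- The limiting probability as a function of `a`. -/
lemma lam_eq (j d : ℕ) (a : ℝ) : lam j d a = lam j d 1 * a ^ (j + 1) := by
  simp [lam]

lemma lam_one_pos (h : 2 * j ≤ d) : 0 < lam j d 1 := by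
  have : 0 < d.choose (2 * j) := Nat.choose_pos h
  have : 0 < (2 * j)! := Nat.factorial_pos _
  unfold lam
  positivity

/-- Every probability in `(0,1)` is a limiting probability. -/
lemma exists_lam_eq (h : 2 * j ≤ d) {α : ℝ} (h0 : 0 < α) (h1 : α < 1) :
    ∃ a, 0 < a ∧ 1 - Real.exp (-lam j d a) = α := by
  have hl := lam_one_pos h
  have hlog : 0 < -Real.log (1 - α) := by
    have := Real.log_neg (show 0 < 1 - α by linarith) (by linarith)
    linarith
  refine ⟨(-Real.log (1 - α) / lam j d 1) ^ (((j + 1 : ℕ) : ℝ)⁻¹), by positivity, ?_⟩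
  rw [lam_eq, Real.rpow_inv_natCast_pow (by positivity) (Nat.succ_ne_zero j),
    mul_div_cancel₀ _ hl.ne', neg_neg, Real.exp_log (by linarith)]
  ring

lemma powerParam_le_of_lt {a γ : ℝ} {n : ℕ} {q : unitInterval} (h : a * (n : ℝ) ^ (-γ) ≤ q) :
    powerParam a γ n ≤ q := by
  rw [← Subtype.coe_le_coe, powerParam, Set.coe_projIcc]
  exact max_le q.2.1 ((min_le_right _ _).trans h)

/-- A factor n ^ (±ε) eventually beats any constant a, so p is compared by monotonicity with a n ^
(-γ), where a is chosen with limiting probability arbitrarily close to 1 or to 0. -/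
lemma isCriticalExponent_eventC (h : j * (j + 1) < d) (hj : 1 ≤ j) :
    IsCriticalExponent (eventC d (2 * j)) (critExp d j) := by
  have h2j : 2 * j ≤ d := by nlinarith
  intro ε hε p
  constructor
  · intro hp
    rw [tendsto_order]
    refine ⟨fun b hb => ?_, fun b hb => Eventually.of_forall fun n => (pr_le_one _ _).trans_lt hb⟩
    obtain ⟨α, hα, hα1⟩ := exists_between (max_lt hb zero_lt_one)
    obtain ⟨a, ha, hlim⟩ := exists_lam_eq (j := j) h2j ((le_max_right _ _).trans_lt hα) hα1
    have h1 := tendsto_prob_eventC h hj ha.le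
    rw [hlim] at h1
    have hlarge : ∀ᶠ n : ℕ in atTop, a ≤ (n : ℝ) ^ ε :=
      ((tendsto_rpow_atTop hε).comp tendsto_natCast_atTop_atTop).eventually_ge_atTop a
    filter_upwards [hp, h1.eventually_const_lt ((le_max_left _ _).trans_lt hα), hlarge,
      eventually_ge_atTop 1] with n hn hb' hl hn1
    have hn0 : (0 : ℝ) < n := by exact_mod_cast hn1
    refine hb'.trans_le (prob_eventC_mono (powerParam_le_of_lt ?_))
    refine le_trans ?_ hn.le
    rw [Real.rpow_add hn0, mul_comm]
    gcongr
  · intro hp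
    rw [tendsto_order]
    refine ⟨fun b hb => Eventually.of_forall fun n => hb.trans_le (pr_nonneg _ _), fun b hb => ?_⟩
    obtain ⟨α, hα, hα1⟩ := exists_between (lt_min hb zero_lt_one)
    obtain ⟨a, ha, hlim⟩ := exists_lam_eq (j := j) h2j hα (hα1.trans_le (min_le_right _ _))
    have h1 := tendsto_prob_eventC h hj ha.le
    rw [hlim] at h1
    have hsmall : ∀ᶠ n : ℕ in atTop, (n : ℝ) ^ (-ε) ≤ a :=
      (tendsto_natCast_rpow_neg hε).eventually_le_const ha
    filter_upwards [hp, h1.eventually_lt_const (hα1.trans_le (min_le_left _ _)), hsmall,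
      eventually_coe_powerParam ha.le (critExp_pos h), eventually_ge_atTop 1] with n hn hb' hl hpn hn1
    have hn0 : (0 : ℝ) < n := by exact_mod_cast hn1
    refine (prob_eventC_mono ?_).trans_lt hb'
    rw [← Subtype.coe_le_coe, hpn]
    refine hn.le.trans ?_
    rw [sub_eq_add_neg, Real.rpow_add hn0, mul_comm]
    gcongr

lemma prob_zero_eventC {n i : ℕ} (hn : 2 ≤ n) : prob 0 (eventC d i n) = 0 := by
  have hempty : IsClosedSet (∅ : Set (Fin d → Fin n)) := fun _ _ _ h => absurd h (by simp)
  have hne : (∅ : Set (Fin d → Fin n)) ∉ eventC d i n := by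
    rintro ⟨V, hV, hs⟩
    obtain ⟨P, -, rfl⟩ := (isSubtorus_iff_exists_pat (by omega)).1 hV
    have hpt : (fun l => (P l).getD ⟨0, by omega⟩) ∈ P.cells := by
      intro m
      rcases hm : P m with _ | c
      · exact Or.inl rfl
      · right; simp [hm]
    exact spanSet_subset subset_rfl hempty (hs hpt)
  rw [prob, setBernoulli_zero]
  simp [MeasureTheory.measureReal_def, MeasureTheory.Measure.dirac_apply, hne]

lemma prob_one_eventC {n i : ℕ} (hn : 2 ≤ n) (hi : i ≤ d) : prob 1 (eventC d i n) = 1 := by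
  classical
  have hmem : (Set.univ : Set (Fin d → Fin n)) ∈ eventC d i n := by
    obtain ⟨I, -, hI⟩ := Finset.exists_subset_card_eq
      (show d - i ≤ (Finset.univ : Finset (Fin d)).card by simp)
    refine ⟨_, ⟨I, fun _ => ⟨0, by omega⟩, by omega, rfl⟩, fun v _ => ?_⟩
    exact subset_spanSet _ (Set.mem_univ v)
  rw [prob, setBernoulli_one]
  simp [MeasureTheory.measureReal_def, hmem]

/-- By the intermediate value theorem. Sharpness quantifies over all threshold sequences, so
refuting it requires that they exist. -/
lemma exists_isThreshold_eventC {i : ℕ} (hi : i ≤ d) {α : ℝ} (h0 : 0 ≤ α) (h1 : α ≤ 1) :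
    ∃ q : ℕ → unitInterval, IsThreshold (eventC d i) α q := by
  have key : ∀ n : ℕ, 2 ≤ n → ∃ q : unitInterval, prob q (eventC d i n) = α := by
    intro n hn
    have hcont : Continuous fun p : unitInterval => prob p (eventC d i n) := continuous_pr _
    have := mem_range_of_exists_le_of_exists_ge hcont (c := α)
      ⟨0, by rw [prob_zero_eventC hn]; exact h0⟩ ⟨1, by rw [prob_one_eventC hn hi]; exact h1⟩
    exact this
  choose! q hq using key
  exact ⟨q, (eventually_ge_atTop 2).mono hq⟩

/-- A threshold at level `α` is eventually above `a n ^ (-γ)` if the limiting probability at `a` is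
less than `α`. -/
lemma eventually_le_threshold (h : j * (j + 1) < d) (hj : 1 ≤ j) {a α : ℝ} (ha : 0 ≤ a)
    (hα : 1 - Real.exp (-lam j d a) < α) {q : ℕ → unitInterval}
    (hq : IsThreshold (eventC d (2 * j)) α q) :
    ∀ᶠ n : ℕ in atTop, a * (n : ℝ) ^ (-critExp d j) ≤ q n := by
  filter_upwards [hq, (tendsto_prob_eventC h hj ha).eventually_lt_const hα,
    eventually_coe_powerParam ha (critExp_pos h)] with n h1 h2 h3
  rw [← h3, Subtype.coe_le_coe]
  by_contra hcon
  have := prob_eventC_mono (d := d) (n := n) (i := 2 * j) (not_le.1 hcon).le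
  linarith

lemma eventually_threshold_le (h : j * (j + 1) < d) (hj : 1 ≤ j) {a α : ℝ} (ha : 0 ≤ a)
    (hα : α < 1 - Real.exp (-lam j d a)) {q : ℕ → unitInterval}
    (hq : IsThreshold (eventC d (2 * j)) α q) :
    ∀ᶠ n : ℕ in atTop, (q n : ℝ) ≤ a * (n : ℝ) ^ (-critExp d j) := by
  filter_upwards [hq, (tendsto_prob_eventC h hj ha).eventually_const_lt hα,
    eventually_coe_powerParam ha (critExp_pos h)] with n h1 h2 h3
  rw [← h3, Subtype.coe_le_coe]
  by_contra hcon
  have := prob_eventC_mono (d := d) (n := n) (i := 2 * j) (not_le.1 hcon).le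
  linarith

/-- Take ε = 1/4, and a < b with limiting probabilities 1/3 and 2/3. Eventually p_{1/4} ≤ a x,
p_{3/4} ≥ b x and p_{1/2} ≤ b x for x = n ^ (-γ), so the window is at least a fixed proportion of
p_{1/2}. -/
lemma not_isSharp_eventC (h : j * (j + 1) < d) (hj : 1 ≤ j) : ¬ IsSharp (eventC d (2 * j)) := by
  have h2j : 2 * j ≤ d := by nlinarith
  intro hsharp
  obtain ⟨q₁, hq₁⟩ := exists_isThreshold_eventC (d := d) (i := 2 * j) (α := 1 / 4) h2j
    (by norm_num) (by norm_num)
  obtain ⟨q₂, hq₂⟩ := exists_isThreshold_eventC (d := d) (i := 2 * j) (α := 1 - 1 / 4) h2j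
    (by norm_num) (by norm_num)
  obtain ⟨q₃, hq₃⟩ := exists_isThreshold_eventC (d := d) (i := 2 * j) (α := 1 / 2) h2j
    (by norm_num) (by norm_num)
  have ho := hsharp (1 / 4) (by norm_num) (by norm_num) q₁ q₂ q₃ hq₁ hq₂ hq₃
  obtain ⟨a, ha, hla⟩ := exists_lam_eq (j := j) h2j (α := 1 / 3) (by norm_num) (by norm_num)
  obtain ⟨b, hb, hlb⟩ := exists_lam_eq (j := j) h2j (α := 2 / 3) (by norm_num) (by norm_num)
  have hl := lam_one_pos h2j
  have hab : a < b := by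
    by_contra hcon
    have h1 : lam j d b ≤ lam j d a := by
      rw [lam_eq j d a, lam_eq j d b]
      gcongr
      exact not_lt.1 hcon
    have h2 := Real.exp_le_exp.2 (neg_le_neg h1)
    linarith
  have e1 := eventually_threshold_le h hj ha.le (by rw [hla]; norm_num) hq₁
  have e2 := eventually_le_threshold h hj hb.le (by rw [hlb]; norm_num) hq₂
  have e3 := eventually_threshold_le h hj hb.le (by rw [hlb]; norm_num) hq₃
  -- With this constant the little-o bound makes the window at most (b - a)x / 2, while it is at
  -- least (b - a)x.
  have e4 := ho.def (show 0 < (b - a) / (2 * b) by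
    have := sub_pos.2 hab
    positivity)
  obtain ⟨n, f1, f2, f3, f4, f5⟩ :=
    (e1.and (e2.and (e3.and (e4.and (eventually_ge_atTop 1))))).exists
  have hn0 : (0 : ℝ) < n := by exact_mod_cast f5
  have hx : 0 < (n : ℝ) ^ (-critExp d j) := by positivity
  set x := (n : ℝ) ^ (-critExp d j) with hxdef
  rw [Real.norm_of_nonneg (q₃ n).2.1] at f4
  have g1 : (b - a) * x ≤ (q₂ n : ℝ) - q₁ n := by linarith
  have g2 := (g1.trans (le_abs_self _)).trans f4
  have g3 : (b - a) / (2 * b) * (q₃ n : ℝ) ≤ (b - a) / (2 * b) * (b * x) :=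
    mul_le_mul_of_nonneg_left f3 (div_nonneg (by linarith) (by linarith))
  have g4 : (b - a) / (2 * b) * (b * x) = (b - a) * x / 2 := by field_simp
  have g5 : 0 < (b - a) * x := mul_pos (by linarith) hx
  linarith

lemma mul_succ_lt_of_le_maxJ (hd : 0 < d) (hjJ : j ≤ maxJ d) : j * (j + 1) < d := by
  have hmem : maxJ d ∈ {i : ℕ | i * (i + 1) < d} := by
    refine Nat.sSup_mem ⟨0, by simpa using hd⟩ ⟨d, fun i hi => ?_⟩
    have hi' : i * (i + 1) < d := hi
    nlinarith
  have hlt : maxJ d * (maxJ d + 1) < d := hmem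
  exact lt_of_le_of_lt (Nat.mul_le_mul hjJ (Nat.succ_le_succ hjJ)) hlt

end Limits

end HammingBootstrap

theorem mainTheorem2 (d : ℕ) (hd : 2 < d) (j : ℕ) (hj : 1 ≤ j)
    (hjJ : j ≤ HammingBootstrap.maxJ d) :
    (∀ a : ℝ, 0 < a →
      Tendsto (fun n : ℕ =>
          HammingBootstrap.prob
            (HammingBootstrap.powerParam a ((d : ℝ) / ((j : ℝ) + 1) + (j : ℝ)) n)
            (HammingBootstrap.eventI d (2 * j) n))
        atTop (𝓝 (1 - Real.exp (-HammingBootstrap.lam j d a))) ∧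
      Tendsto (fun n : ℕ =>
          HammingBootstrap.prob
            (HammingBootstrap.powerParam a ((d : ℝ) / ((j : ℝ) + 1) + (j : ℝ)) n)
            (HammingBootstrap.eventC d (2 * j) n \ HammingBootstrap.eventI d (2 * j) n))
        atTop (𝓝 0)) ∧
    HammingBootstrap.IsCriticalExponent (HammingBootstrap.eventC d (2 * j))
      ((d : ℝ) / ((j : ℝ) + 1) + (j : ℝ)) ∧
    ¬ HammingBootstrap.IsSharp (HammingBootstrap.eventC d (2 * j)) := by
  have h := HammingBootstrap.mul_succ_lt_of_le_maxJ (by omega) hjJ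
  exact ⟨fun a ha => ⟨HammingBootstrap.tendsto_prob_eventI h hj ha.le,
    HammingBootstrap.tendsto_prob_eventC_diff h hj ha.le⟩,
    HammingBootstrap.isCriticalExponent_eventC h hj, HammingBootstrap.not_isSharp_eventC h hj⟩
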